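/- Let $G$ be a compact Lie group acting smoothly by isometries on a closed (compact, without boundary) Riemannian manifold $(Y,g_Y)$. Let $G_0$ be a dense subgroup of $G$, let $(X,g_X)$ be a closed connected Riemannian manifold of volume $1$, and let $\varphi:\pi_1(X)\to G_0$ be a surjective homomorphism. Let $\widetilde X\to X$ be the universal cover with the pulled-back metric, on which $\pi_1(X)$ acts by deck transformations, and let $\mathcal S=(\widetilde X\times Y)/\!\sim$ be the suspension, where $(\tilde x,y)\sim([\gamma]^{-1}\cdot\tilde x,\ \varphi([\gamma])\cdot y)$ for all $[\gamma]\in\pi_1(X)$ (the product in $\pi_1(X)$ being ordered so that this is a group action). Give $\mathcal S$ the manifold structure and the Riemannian metric for which the quotient map $\sigma:\widetilde X\times Y\to\mathcal S$ is a local isometry from the product metric, and the foliation $\mathcal F_{\mathcal S}$ whose leaves are the sets $\{\sigma(\tilde x,y):\tilde x\in\widetilde X\}$, $y\in Y$. Let $C^\infty_B(\mathcal S,\mathcal F_{\mathcal S})$ be the space of basic functions, i.e. of smooth real functions on $\mathcal S$ that are constant along the leaves. The basic Laplacian is $\Delta_B=\delta_B d_B$, where $d_B$ is the exterior derivative restricted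 to basic functions and $\delta_B$ is its adjoint; that is, for basic $f,u$, $\Delta_Bf=u$ means $\int_{\mathcal S}u\,h=\int_{\mathcal S}\langle df,dh\rangle$ for all basic $h$. The $G$-invariant Laplacian $\Delta^G$ is the restriction of the Laplacian $\Delta=\delta d$ of $Y$ to the space $C^\infty(Y)^G$ of smooth functions that are constant along the $G$-orbits. Then the basic spectrum of $(\mathcal S,\mathcal F_{\mathcal S})$ is identical to the $G$-invariant spectrum of $Y$, with multiplicities: the closure of $\Delta_B$ in the $L^2$-closure of $C^\infty_B(\mathcal S,\mathcal F_{\mathcal S})$ and the closure of $\Delta^G$ in the $L^2$-closure of $C^\infty(Y)^G$ have the same spectrum, and for every real $\lambda$ the eigenspaces $\{f\in C^\infty_B(\mathcal S,\mathcal F_{\mathcal S}):\Delta_Bf=\lambda f\}$ and $\{f\in C^\infty(Y)^G:\Delta^Gf=\lambda f\}$ are isomorphic. -/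

import Mathlib

open scoped Manifold ContDiff Topology
open MeasureTheory

noncomputable section

namespace BasicSpectrum

section Riemannian

variable {E : Type*} [NormedAddCommGroup E] [NormedSpace ℝ E]
  {H : Type*} [TopologicalSpace H] (I : ModelWithCorners ℝ E H)
  {M : Type*} [TopologicalSpace M] [ChartedSpace H M]

/-- A field of bilinear forms on the tangent spaces of `M`. -/
abbrev MetricTensor (M : Type*) [TopologicalSpace M] [ChartedSpace H M] : Type _ :=
  ∀ x : M, TangentSpace I x →L[ℝ] TangentSpace I x →L[ℝ] ℝ

variable {I}

/-- The differential of a real function at `x`, as a covector. -/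
def differential (I : ModelWithCorners ℝ E H) (f : M → ℝ) (x : M) : TangentSpace I x →L[ℝ] ℝ :=
  mfderiv I 𝓘(ℝ, ℝ) f x

/-- The inner product `⟨df, dh⟩` of the differentials of `f` and `h` at `x`, for the inner product
that the metric `g` induces on covectors: `g x`, as a map from vectors to covectors, is invertible,
its inverse maps `df` to the gradient of `f`, and `⟨df, dh⟩ = dh (grad f)`. -/
def innerDifferential (g : MetricTensor I M) (f h : M → ℝ) (x : M) : ℝ :=
  differential I h x ((g x).inverse (differential I f x))

/-- In the chart around `x₀`, the Gram determinant of the metric with respect to the coordinate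
vector fields that belong to a basis `b` of the model space. -/
def gramDet (g : MetricTensor I M) {ι : Type*} [Fintype ι] [DecidableEq ι]
    (b : Module.Basis ι ℝ E) (x₀ : M) (z : E) : ℝ :=
  let c : E → M := (extChartAt I x₀).symm
  Matrix.det (Matrix.of fun i j : ι =>
    g (c z) (mfderiv 𝓘(ℝ, E) I c z (b i)) (mfderiv 𝓘(ℝ, E) I c z (b j)))

/-- The Riemannian measure on the domain of the chart around `x₀`, extended by zero: it has density
`√(det g_ij)` with respect to Lebesgue measure in the coordinates. (The Lebesgue measure is
normalized by the same basis that is used for `g_ij`, so that the choice of basis is immaterial.) -/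
def chartVolume [FiniteDimensional ℝ E] [MeasurableSpace M] (g : MetricTensor I M) (x₀ : M) :
    Measure M :=
  letI : MeasurableSpace E := borel E
  haveI : BorelSpace E := ⟨rfl⟩
  let b := Module.finBasis ℝ E
  ((b.addHaar.restrict (extChartAt I x₀).target).withDensity
    fun z => ENNReal.ofReal (√(gramDet g b x₀ z))).map (extChartAt I x₀).symm

/-- The Riemannian measure of a (second countable) Riemannian manifold. The measures of the single
charts agree on overlaps, so their supremum is the measure that restricts to each of them. -/
def riemannianVolume [FiniteDimensional ℝ E] [MeasurableSpace M] (g : MetricTensor I M) :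
    Measure M :=
  ⨆ x₀ : M, chartVolume g x₀

/-- The pull-back of a metric along a map `F : M → N`. -/
def pullbackMetric {E' : Type*} [NormedAddCommGroup E'] [NormedSpace ℝ E']
    {H' : Type*} [TopologicalSpace H'] {J : ModelWithCorners ℝ E' H'}
    {N : Type*} [TopologicalSpace N] [ChartedSpace H' N]
    (I : ModelWithCorners ℝ E H) (F : M → N) (g : MetricTensor J N) : MetricTensor I M :=
  fun x =>
    let B : E' →L[ℝ] E' →L[ℝ] ℝ := g (F x)
    let L : E →L[ℝ] E' := mfderiv I J F x
    (B.bilinearComp L L : E →L[ℝ] E →L[ℝ] ℝ)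

/-- The product metric. -/
def prodMetric {E' : Type*} [NormedAddCommGroup E'] [NormedSpace ℝ E']
    {H' : Type*} [TopologicalSpace H'] {J : ModelWithCorners ℝ E' H'}
    {N : Type*} [TopologicalSpace N] [ChartedSpace H' N]
    (g : MetricTensor I M) (g' : MetricTensor J N) : MetricTensor (I.prod J) (M × N) :=
  fun a =>
    let B : E →L[ℝ] E →L[ℝ] ℝ := g a.1
    let B' : E' →L[ℝ] E' →L[ℝ] ℝ := g' a.2
    B.bilinearComp (.fst ℝ E E') (.fst ℝ E E') + B'.bilinearComp (.snd ℝ E E') (.snd ℝ E E')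

variable [FiniteDimensional ℝ E] [MeasurableSpace M]

/-- For `f, u` in the space `D` of smooth functions: `u = δ d f`, where `δ` is the formal adjoint of
`d` with respect to the `L²` inner products, tested against the space `T` of smooth functions:
`∫ u h = ∫ ⟨df, dh⟩` for all `h` in `T`. -/
def LaplaceRel (g : MetricTensor I M) (D T : Submodule ℝ C^∞⟮I, M; ℝ⟯)
    (f u : C^∞⟮I, M; ℝ⟯) : Prop :=
  f ∈ D ∧ u ∈ D ∧ ∀ h ∈ T, ∫ x, u x * h x ∂(riemannianVolume g) =
    ∫ x, innerDifferential g f h x ∂(riemannianVolume g)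

/-- The eigenspace for `c` of an operator on smooth functions, given by its graph `R`. -/
def eigenspace (R : C^∞⟮I, M; ℝ⟯ → C^∞⟮I, M; ℝ⟯ → Prop) (c : ℝ) :
    Submodule ℝ C^∞⟮I, M; ℝ⟯ :=
  Submodule.span ℝ {f | R f (c • f)}

/-- The `L²`-closure of a space `D` of smooth functions. -/
def l2Space (g : MetricTensor I M) (D : Submodule ℝ C^∞⟮I, M; ℝ⟯) :
    Set (Lp ℝ 2 (riemannianVolume g)) :=
  closure {a | ∃ f ∈ D, a =ᵐ[riemannianVolume g] f}

/-- The closure in `L² × L²` of the graph `R` of an operator on smooth functions. -/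
def l2Graph (g : MetricTensor I M) (R : C^∞⟮I, M; ℝ⟯ → C^∞⟮I, M; ℝ⟯ → Prop) :
    Set (Lp ℝ 2 (riemannianVolume g) × Lp ℝ 2 (riemannianVolume g)) :=
  closure {a | ∃ f u, R f u ∧ a.1 =ᵐ[riemannianVolume g] f ∧ a.2 =ᵐ[riemannianVolume g] u}

/-- The spectrum of the closure `A` of the operator with graph `R`, in the `L²`-closure of `D`:
the numbers `c` for which `A - c` is not a bijection from the domain of `A` onto that space. -/
def l2Spectrum (g : MetricTensor I M) (D : Submodule ℝ C^∞⟮I, M; ℝ⟯)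
    (R : C^∞⟮I, M; ℝ⟯ → C^∞⟮I, M; ℝ⟯ → Prop) : Set ℝ :=
  {c | ¬ ∀ k ∈ l2Space g D, ∃! a, a ∈ l2Graph g R ∧ a.2 - c • a.1 = k}

end Riemannian

section Covering

variable {E : Type*} [NormedAddCommGroup E] [NormedSpace ℝ E]
  {Xt X : Type*} [TopologicalSpace Xt] [ChartedSpace E Xt] [TopologicalSpace X] [ChartedSpace E X]

variable (E) in
/-- `p : Xt → X` is a (smooth) universal covering. -/
structure IsUniversalCover (p : Xt → X) : Prop where
  isCoveringMap : IsCoveringMap p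
  surjective : Function.Surjective p
  simplyConnected : SimplyConnectedSpace Xt
  isLocalDiffeomorph : IsLocalDiffeomorph 𝓘(ℝ, E) 𝓘(ℝ, E) ∞ p

/-- The group of deck transformations of `p`. -/
def deckGroup (p : Xt → X) : Subgroup (Xt ≃ₜ Xt) where
  carrier := {d | ∀ x, p (d x) = p x}
  one_mem' _ := rfl
  mul_mem' {a b} ha hb x := (ha (b x)).trans (hb x)
  inv_mem' {a} ha x := by
    have h := ha (a.symm x)
    rw [a.apply_symm_apply] at h
    exact h.symm

instance (p : Xt → X) : MulAction (deckGroup p) Xt where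
  smul d x := d.1 x
  one_smul _ := rfl
  mul_smul _ _ _ := rfl

namespace IsUniversalCover

variable {p : Xt → X}

theorem exists_deck (hp : IsUniversalCover E p) {x x' : Xt} (h : p x = p x') :
    ∃ d : deckGroup p, d • x = x' := by
  have := hp.simplyConnected
  have : LocallyPathConnectedSpace Xt := ChartedSpace.locallyPathConnectedSpace E Xt
  let f : C(Xt, X) := ⟨p, hp.isCoveringMap.continuous⟩
  obtain ⟨F, ⟨hF, hpF⟩, -⟩ := hp.isCoveringMap.existsUnique_continuousMap_lifts f x x' h.symm
  obtain ⟨F', ⟨hF', hpF'⟩, -⟩ := hp.isCoveringMap.existsUnique_continuousMap_lifts f x' x h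
  have h1 : F' ∘ F = id := hp.isCoveringMap.eq_of_comp_eq (by fun_prop) continuous_id
    (by rw [← Function.comp_assoc, hpF']; exact hpF) x (by simp [hF, hF'])
  have h2 : F ∘ F' = id := hp.isCoveringMap.eq_of_comp_eq (by fun_prop) continuous_id
    (by rw [← Function.comp_assoc, hpF]; exact hpF') x' (by simp [hF, hF'])
  exact ⟨⟨⟨⟨F, F', congrFun h1, congrFun h2⟩, F.continuous, F'.continuous⟩, congrFun hpF⟩, hF⟩

theorem isQuotientCoveringMap (hp : IsUniversalCover E p) :
    IsQuotientCoveringMap p (deckGroup p) := by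
  have := hp.simplyConnected
  refine (isQuotientCoveringMap_iff_isCoveringMap_and p (deckGroup p)).2 ⟨hp.isCoveringMap,
    hp.surjective, ⟨fun d => d.1.continuous⟩,
    isCancelSMul_iff_eq_one_of_smul_eq.2 fun d x hd => ?_, fun {x x'} => ⟨fun h => ?_, ?_⟩⟩
  · have h1 : (d.1 : Xt → Xt) = id := hp.isCoveringMap.eq_of_comp_eq d.1.continuous continuous_id
      (funext fun y => d.2 y) x hd
    exact Subtype.ext (Homeomorph.ext (congrFun h1))
  · obtain ⟨d, hd⟩ := hp.exists_deck h.symm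
    exact ⟨d, hd⟩
  · rintro ⟨d, rfl⟩
    exact d.2 x'

/-- The deck transformation associated to a class `γ` in the fundamental group: it moves the base
point `x₀` to the end point of the lift of `γ` that starts at `x₀`. The product `γ * γ'` in
`FundamentalGroup` is the class of `γ'` followed by `γ`, so the order of products is reversed. -/
def deckOfLoop (hp : IsUniversalCover E p) (x₀ : Xt) :
    FundamentalGroup X (p x₀) →* (deckGroup p)ᵐᵒᵖ :=
  hp.isQuotientCoveringMap.fundamentalGroupToMulOpposite ⟨x₀, rfl⟩

end IsUniversalCover

end Covering

section Suspension

variable {EX : Type*} [NormedAddCommGroup EX] [NormedSpace ℝ EX]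
  {Xt X : Type*} [TopologicalSpace Xt] [ChartedSpace EX Xt] [TopologicalSpace X] [ChartedSpace EX X]
  {p : Xt → X} (hp : IsUniversalCover EX p) (x₀ : Xt)
  {Y : Type*} {Γ : Type*} [Group Γ] [MulAction Γ Y] (φ : FundamentalGroup X (p x₀) →* Γ)

/-- The diagonal action of the fundamental group of `X` on `Xt × Y`: the class `γ` maps `(x, y)` to
`(γ⁻¹ · x, φ(γ) · y)`, where `γ⁻¹` acts on `Xt` by the associated deck transformation. -/
@[reducible] def suspensionAction : MulAction (FundamentalGroup X (p x₀)) (Xt × Y) where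
  smul γ a := ((hp.deckOfLoop x₀ γ⁻¹).unop • a.1, φ γ • a.2)
  one_smul a := by
    change ((hp.deckOfLoop x₀ 1⁻¹).unop • a.1, φ 1 • a.2) = a
    rw [inv_one, map_one, map_one, MulOpposite.unop_one, one_smul, one_smul]
  mul_smul γ γ' a := by
    change ((hp.deckOfLoop x₀ (γ * γ')⁻¹).unop • a.1, φ (γ * γ') • a.2) =
      ((hp.deckOfLoop x₀ γ⁻¹).unop • (hp.deckOfLoop x₀ γ'⁻¹).unop • a.1, φ γ • φ γ' • a.2)
    rw [mul_inv_rev, map_mul, map_mul, MulOpposite.unop_mul, mul_smul, mul_smul]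

/-- The suspension `𝒮 = (Xt × Y) / ∼`. -/
def Suspension : Type _ :=
  Quotient (@MulAction.orbitRel (FundamentalGroup X (p x₀)) (Xt × Y) _ (suspensionAction hp x₀ φ))

namespace Suspension

/-- The quotient map `σ : Xt × Y → 𝒮`. -/
def proj : Xt × Y → Suspension (Y := Y) hp x₀ φ :=
  Quotient.mk _

theorem proj_surjective : Function.Surjective (proj (Y := Y) hp x₀ φ) :=
  Quotient.mk_surjective

theorem proj_eq_iff {a b : Xt × Y} : proj hp x₀ φ a = proj hp x₀ φ b ↔
    ∃ γ : FundamentalGroup X (p x₀), ((hp.deckOfLoop x₀ γ⁻¹).unop • b.1, φ γ • b.2) = a :=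
  Quotient.eq''

/-- The leaf through `s = [(x, y)]` is `{[(x', y)] | x' ∈ Xt}`. -/
def leaf (s : Suspension (Y := Y) hp x₀ φ) : Set (Suspension (Y := Y) hp x₀ φ) :=
  {t | ∃ x x' : Xt, ∃ y : Y, s = proj hp x₀ φ (x, y) ∧ t = proj hp x₀ φ (x', y)}

variable [TopologicalSpace Y]

instance : TopologicalSpace (Suspension (Y := Y) hp x₀ φ) :=
  inferInstanceAs (TopologicalSpace (Quotient _))

instance : MeasurableSpace (Suspension (Y := Y) hp x₀ φ) := borel _

instance : BorelSpace (Suspension (Y := Y) hp x₀ φ) := ⟨rfl⟩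

variable [ContinuousConstSMul Γ Y]

theorem proj_isLocalHomeomorph : IsLocalHomeomorph (proj (Y := Y) hp x₀ φ) := by
  let := suspensionAction (Y := Y) hp x₀ φ
  have := hp.simplyConnected
  have hq := hp.isQuotientCoveringMap
  have hc := hq.toContinuousConstSMul
  suffices h : IsQuotientCoveringMap (proj (Y := Y) hp x₀ φ) (FundamentalGroup X (p x₀)) from
    h.isCoveringMap.isLocalHomeomorph
  refine ⟨isQuotientMap_quotient_mk', ⟨fun γ => ?_⟩, Quotient.eq'', fun a => ?_⟩
  · change Continuous fun a : Xt × Y => ((hp.deckOfLoop x₀ γ⁻¹).unop • a.1, φ γ • a.2)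
    fun_prop
  · obtain ⟨U, hU, h⟩ := hq.disjoint a.1
    refine ⟨Prod.fst ⁻¹' U, continuous_fst.continuousAt hU, fun γ => ?_⟩
    rintro ⟨_, ⟨b, hb, rfl⟩, hb'⟩
    have h1 := h (hp.deckOfLoop x₀ γ⁻¹).unop ⟨_, ⟨b.1, hb, rfl⟩, hb'⟩
    rw [MulOpposite.unop_eq_one_iff, map_inv, inv_eq_one] at h1
    exact hq.fundamentalGroupToMulOpposite_injective _ (h1.trans (map_one _).symm)

variable {EY : Type*} [NormedAddCommGroup EY] [NormedSpace ℝ EY] [ChartedSpace EY Y]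

/-- The manifold structure of the suspension, for which `σ` is a local diffeomorphism: its charts
are the local inverses of `σ` followed by the charts of `Xt × Y`. -/
instance : ChartedSpace (ModelProd EX EY) (Suspension (Y := Y) hp x₀ φ) :=
  (proj_isLocalHomeomorph hp x₀ φ).chartedSpace (proj_surjective hp x₀ φ)

/-- The metric of the suspension, transported from `Xt × Y` by the local diffeomorphism `σ`: it is
locally the product of the metric of `Xt`, which is the pull-back of the metric of `X`, and the
metric of `Y`. -/
def metric (gX : MetricTensor 𝓘(ℝ, EX) X) (gY : MetricTensor 𝓘(ℝ, EY) Y) :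
    MetricTensor (𝓘(ℝ, EX).prod 𝓘(ℝ, EY)) (Suspension (Y := Y) hp x₀ φ) :=
  fun s =>
    let a : Xt × Y := Function.surjInv (proj_surjective hp x₀ φ) s
    let L : EX × EY →L[ℝ] EX × EY := (mfderiv (𝓘(ℝ, EX).prod 𝓘(ℝ, EY))
      (𝓘(ℝ, EX).prod 𝓘(ℝ, EY)) (proj hp x₀ φ) a).inverse
    let B : EX × EY →L[ℝ] EX × EY →L[ℝ] ℝ :=
      prodMetric (pullbackMetric 𝓘(ℝ, EX) p gX) gY a
    B.bilinearComp L L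

/-- The space of basic functions: the smooth functions that are constant along the leaves. -/
def basicFunctions :
    Submodule ℝ C^∞⟮𝓘(ℝ, EX).prod 𝓘(ℝ, EY), Suspension (Y := Y) hp x₀ φ; ℝ⟯ where
  carrier := {f | ∀ s, ∀ t ∈ leaf hp x₀ φ s, f t = f s}
  zero_mem' _ _ _ := rfl
  add_mem' ha hb s t ht := congrArg₂ (· + ·) (ha s t ht) (hb s t ht)
  smul_mem' c _ ha s t ht := congrArg (c * ·) (ha s t ht)

variable [FiniteDimensional ℝ EX] [FiniteDimensional ℝ EY]

/-- The basic Laplacian `Δ_B = δ_B d_B` on functions: `d_B` is the restriction of `d` to the basic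
functions and `δ_B` its adjoint, so that `Δ_B f = u` means that `f` and `u` are basic and
`∫ u h = ∫ ⟨df, dh⟩` for all basic `h`. -/
def BasicLaplacian (gX : MetricTensor 𝓘(ℝ, EX) X) (gY : MetricTensor 𝓘(ℝ, EY) Y)
    (f u : C^∞⟮𝓘(ℝ, EX).prod 𝓘(ℝ, EY), Suspension (Y := Y) hp x₀ φ; ℝ⟯) : Prop :=
  LaplaceRel (metric hp x₀ φ gX gY) (basicFunctions hp x₀ φ) (basicFunctions hp x₀ φ) f u

end Suspension

end Suspension

section Invariant

variable {E : Type*} [NormedAddCommGroup E] [NormedSpace ℝ E]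
  {H : Type*} [TopologicalSpace H] (I : ModelWithCorners ℝ E H)
  (G : Type*) (Y : Type*) [Group G] [MulAction G Y] [TopologicalSpace Y] [ChartedSpace H Y]

/-- The space of smooth functions that are constant along the orbits of `G`. -/
def invariantFunctions : Submodule ℝ C^∞⟮I, Y; ℝ⟯ where
  carrier := {f | ∀ (a : G) (y : Y), f (a • y) = f y}
  zero_mem' _ _ := rfl
  add_mem' ha hb a y := congrArg₂ (· + ·) (ha a y) (hb a y)
  smul_mem' c _ ha a y := congrArg (c * ·) (ha a y)

variable {I Y} [FiniteDimensional ℝ E] [MeasurableSpace Y]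

/-- The `G`-invariant Laplacian: the restriction of the Laplacian `Δ = δ d` of `Y` to the invariant
functions. Here `Δ f = u` means that `∫ u h = ∫ ⟨df, dh⟩` for all smooth `h`. -/
def InvariantLaplacian (g : MetricTensor I Y) (f u : C^∞⟮I, Y; ℝ⟯) : Prop :=
  LaplaceRel g (invariantFunctions I G Y) ⊤ f u

end Invariant

end BasicSpectrum

end

open BasicSpectrum

set_option linter.unusedSectionVars false

/-! Pulled back by `σ` to `Xt × Y`, a basic function depends on `y` alone, and descending to the
quotient means invariance under the image of `φ`, which is `G₀`. By density and continuity this is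
invariance under `G`. Since `σ` is a local diffeomorphism, smoothness is preserved both ways, so
basic functions correspond linearly to `C^∞(Y)^G` (`basicEquiv`, `invariantFunctions_eq_of_dense`).

This correspondence respects the two integrals in the weak equation. Pointwise, `σ` is a local
isometry and `Xt × Y → Y` is a Riemannian submersion, so inner products of differentials agree
(`innerDifferential_metric`). For the integrals, `𝒮` is isometric to `V × Y` over every open `V ⊆ X`
on which `p` has a section. Cutting `X` into countably many measurable pieces yields a measure
preserving `Θ : X × Y → 𝒮` that sends `(x, y)` into the leaf of `y` (`exists_measurePreserving`). As
`X` has volume one, integrals of basic functions over `𝒮` are integrals over `Y`. So `Δ_B f = u`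
becomes the equation on `Y` tested against invariant functions only (`basicLaplacian_iff`).
Averaging a test function over Haar measure changes neither side when `f` and `u` are invariant, so
testing against all smooth functions is equivalent (`laplaceRel_top_of_invariant`).

For the closures, pull-back along `Θ` and along `X × Y → Y` embeds both `L²` spaces isometrically in
`L²(X × Y)`, and corresponding functions have the same image. The closed spaces and closed graphs
then have equal images, and these determine the spectrum (`l2Spectrum_eq_of_equiv`); neither
self-adjointness nor discreteness of the spectrum is needed.

The longest preparation concerns `riemannianVolume`: it has density `√(det gᵢⱼ)` in every
parametrization, is preserved by local isometries, and is multiplicative on products. -/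

namespace BasicSpectrum

/-! ### Gluing compatible measures -/

section Gluing

variable {α ι : Type*} [MeasurableSpace α]

/-- If measures `μ i`, carried by sets `U i`, agree on the overlaps, and countably many of the `U i`
cover the space, then the supremum of the `μ i` restricts to `μ i` on `U i`. -/
theorem iSup_restrict_of_compatible (μ : ι → Measure α) (U : ι → Set α)
    (hU : ∀ i, MeasurableSet (U i)) (hsupp : ∀ i, μ i (U i)ᶜ = 0)
    (hcompat : ∀ i j, ∀ A ⊆ U i ∩ U j, MeasurableSet A → μ i A = μ j A)
    (c : ℕ → ι) (hc : ⋃ n, U (c n) = Set.univ) (j : ι) :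
    (⨆ i, μ i).restrict (U j) = μ j := by
  let D : ℕ → Set α := disjointed fun n => U (c n)
  have hDm : ∀ n, MeasurableSet (D n) := MeasurableSet.disjointed fun n => hU _
  have hDd : Pairwise (Function.onFun Disjoint D) := disjoint_disjointed _
  have hDU : ∀ n, D n ⊆ U (c n) := fun n => disjointed_subset _ n
  have hDc : ⋃ n, D n = Set.univ := by rw [← hc]; exact iUnion_disjointed
  have split (ν : Measure α) {A : Set α} (hA : MeasurableSet A) : ν A = ∑' n, ν (A ∩ D n) := by
    rw [← measure_iUnion (fun m n h => (hDd h).mono Set.inter_subset_right Set.inter_subset_right)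
      fun n => hA.inter (hDm n), ← Set.inter_iUnion, hDc, Set.inter_univ]
  -- `m` pastes the measures along the disjoint sets `D n`. By compatibility it equals `μ i` on
  -- subsets of `U i`, so it dominates every `μ i`; on each `D n` it is one of the `μ i`, so it is
  -- at most their supremum.
  let m : Measure α := Measure.sum fun n => (μ (c n)).restrict (D n)
  have hm {A : Set α} (hA : MeasurableSet A) : m A = ∑' n, μ (c n) (A ∩ D n) := by
    rw [Measure.sum_apply _ hA]
    exact tsum_congr fun n => Measure.restrict_apply hA
  have hmj (i : ι) {A : Set α} (hA : MeasurableSet A) (hAU : A ⊆ U i) : m A = μ i A := by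
    rw [hm hA, split (μ i) hA]
    exact tsum_congr fun n => hcompat _ _ _
      (fun x hx => ⟨hDU n hx.2, hAU hx.1⟩) (hA.inter (hDm n))
  have hinter (i : ι) (A : Set α) : μ i (A ∩ U i) = μ i A :=
    measure_inter_conull (hsupp i)
  have hle (i : ι) : μ i ≤ m := Measure.le_iff.2 fun A hA => by
    rw [← hinter, ← hmj i (hA.inter (hU i)) Set.inter_subset_right]
    exact measure_mono Set.inter_subset_left
  have hsup : ⨆ i, μ i = m := by
    refine le_antisymm (iSup_le hle) (Measure.le_iff.2 fun A hA => ?_)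
    rw [hm hA, split _ hA]
    exact ENNReal.tsum_le_tsum fun n => le_iSup μ (c n) _
  rw [hsup]
  ext A hA
  rw [Measure.restrict_apply hA, hmj j (hA.inter (hU j)) Set.inter_subset_right, hinter]

end Gluing

/-! ### Gram determinants and change of basis -/

section Gram

variable {E : Type*} [NormedAddCommGroup E] [NormedSpace ℝ E]
  {ι : Type*} [Fintype ι] [DecidableEq ι]

/-- The Gram determinant of a bilinear form with respect to a basis. -/
noncomputable def gram (B : E →L[ℝ] E →L[ℝ] ℝ) (b : Module.Basis ι ℝ E) : ℝ :=
  Matrix.det (Matrix.of fun i j => B (b i) (b j))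

/-- With `A` the matrix of `f` and `S` the Gram matrix of `B`, the new Gram matrix is `Aᵀ S A`. The
same computation serves for pull-backs and for changes of basis. -/
theorem det_of_comp (B : E →L[ℝ] E →L[ℝ] ℝ) (b : Module.Basis ι ℝ E) (f : E →ₗ[ℝ] E) :
    Matrix.det (Matrix.of fun i j => B (f (b i)) (f (b j))) = LinearMap.det f ^ 2 * gram B b := by
  have h : (Matrix.of fun i j => B (f (b i)) (f (b j))) =
      (LinearMap.toMatrix b b f).transpose * (Matrix.of fun i j => B (b i) (b j)) *
        LinearMap.toMatrix b b f := by
    ext i j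
    have hf (i : ι) : f (b i) = ∑ k, LinearMap.toMatrix b b f k i • b k := by
      simp_rw [LinearMap.toMatrix_apply]
      exact (b.sum_repr (f (b i))).symm
    simp only [Matrix.of_apply]
    rw [hf i, hf j]
    simp only [map_sum, map_smul, sum_apply, smul_apply,
      Matrix.mul_apply, Matrix.of_apply, Matrix.transpose_apply, smul_eq_mul, Finset.mul_sum,
      Finset.sum_mul]
    refine Finset.sum_congr rfl fun k _ => Finset.sum_congr rfl fun l _ => by ring
  rw [h, Matrix.det_mul, Matrix.det_mul, Matrix.det_transpose, LinearMap.det_toMatrix, gram]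
  ring

theorem gram_bilinearComp (B : E →L[ℝ] E →L[ℝ] ℝ) (b : Module.Basis ι ℝ E) (f : E →L[ℝ] E) :
    gram (B.bilinearComp f f) b = f.det ^ 2 * gram B b :=
  det_of_comp B b f

theorem gram_map (B : E →L[ℝ] E →L[ℝ] ℝ) (b : Module.Basis ι ℝ E) (f : E ≃ₗ[ℝ] E) :
    gram B (b.map f) = LinearMap.det (f : E →ₗ[ℝ] E) ^ 2 * gram B b :=
  det_of_comp B b f

theorem gram_reindex {κ : Type*} [Fintype κ] [DecidableEq κ] (B : E →L[ℝ] E →L[ℝ] ℝ)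
    (b : Module.Basis ι ℝ E) (f : ι ≃ κ) : gram B (b.reindex f) = gram B b := by
  rw [gram, gram, ← Matrix.det_reindex_self f]
  congr 1
  ext i j
  simp

theorem gram_prod {E' : Type*} [NormedAddCommGroup E'] [NormedSpace ℝ E']
    {κ : Type*} [Fintype κ] [DecidableEq κ] (B : E →L[ℝ] E →L[ℝ] ℝ) (B' : E' →L[ℝ] E' →L[ℝ] ℝ)
    (b : Module.Basis ι ℝ E) (b' : Module.Basis κ ℝ E') :
    -- The Gram matrix in the product basis is block diagonal.
    gram (B.bilinearComp (.fst ℝ E E') (.fst ℝ E E') +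
      B'.bilinearComp (.snd ℝ E E') (.snd ℝ E E')) (b.prod b') = gram B b * gram B' b' := by
  rw [gram, gram, gram, ← Matrix.det_fromBlocks_zero₂₁ _ 0]
  congr 1
  ext i j
  rcases i with i | i <;> rcases j with j | j <;> simp [Matrix.fromBlocks]

theorem ofReal_sqrt_sq_mul (a r : ℝ) :
    ENNReal.ofReal √(a ^ 2 * r) = ENNReal.ofReal |a| * ENNReal.ofReal √r := by
  rw [Real.sqrt_mul (sq_nonneg a), Real.sqrt_sq_eq_abs, ENNReal.ofReal_mul (abs_nonneg a)]

/-- The measure `√(det B(bᵢ, bⱼ)) db` does not depend on the basis `b`. -/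
theorem ofReal_sqrt_gram_smul_addHaar [FiniteDimensional ℝ E] [MeasurableSpace E] [BorelSpace E]
    {κ : Type*} [Fintype κ] [DecidableEq κ] (b : Module.Basis ι ℝ E) (b' : Module.Basis κ ℝ E) :
    ∃ c : NNReal, c ≠ 0 ∧ b'.addHaar = c • b.addHaar ∧
      ∀ B : E →L[ℝ] E →L[ℝ] ℝ,
        c * ENNReal.ofReal √(gram B b') = ENNReal.ofReal √(gram B b) := by
  let f : E ≃ₗ[ℝ] E := b.equiv b' (b.indexEquiv b')
  have hb : b' = (b.map f).reindex (b.indexEquiv b') := by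
    ext i
    simp [f]
  have hdet : LinearMap.det (f : E →ₗ[ℝ] E) ≠ 0 := (LinearEquiv.isUnit_det' f).ne_zero
  have hpos : 0 < |(LinearMap.det (f : E →ₗ[ℝ] E))⁻¹| := abs_pos.2 (inv_ne_zero hdet)
  -- Normalizing the parallelepiped of `b'`, the image under `f` of that of `b`, to volume one
  -- divides Lebesgue measure by `|det f|`, while `√gram` is multiplied by `|det f|`.
  refine ⟨|(LinearMap.det (f : E →ₗ[ℝ] E))⁻¹|.toNNReal, (Real.toNNReal_pos.2 hpos).ne', ?_,
    fun B => ?_⟩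
  · rw [hb, Module.Basis.addHaar_reindex]
    have h := Module.Basis.map_addHaar b f.toContinuousLinearEquiv
    have h' := Measure.map_linearMap_addHaar_eq_smul_addHaar b.addHaar hdet
    change _ = ENNReal.ofReal _ • b.addHaar
    rw [← h']
    exact h.symm
  · have h1 : gram B b' = LinearMap.det (f : E →ₗ[ℝ] E) ^ 2 * gram B b := by
      rw [hb, gram_reindex, gram_map]
    rw [h1, ofReal_sqrt_sq_mul, ← mul_assoc]
    change ENNReal.ofReal _ * _ * _ = _
    rw [← ENNReal.ofReal_mul (abs_nonneg _), ← abs_mul, inv_mul_cancel₀ hdet]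
    simp

end Gram

/-! ### Pull-back of metrics -/

section Pullback

variable {E : Type*} [NormedAddCommGroup E] [NormedSpace ℝ E]
  {H : Type*} [TopologicalSpace H] {I : ModelWithCorners ℝ E H}
  {M : Type*} [TopologicalSpace M] [ChartedSpace H M]
  {E' : Type*} [NormedAddCommGroup E'] [NormedSpace ℝ E']
  {H' : Type*} [TopologicalSpace H'] {J : ModelWithCorners ℝ E' H'}
  {N : Type*} [TopologicalSpace N] [ChartedSpace H' N]
  {E'' : Type*} [NormedAddCommGroup E''] [NormedSpace ℝ E'']
  {H'' : Type*} [TopologicalSpace H''] {K : ModelWithCorners ℝ E'' H''}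
  {P : Type*} [TopologicalSpace P] [ChartedSpace H'' P]

theorem pullbackMetric_apply (F : M → N) (g : MetricTensor J N) (x : M) (u v : TangentSpace I x) :
    pullbackMetric I F g x u v = g (F x) (mfderiv I J F x u) (mfderiv I J F x v) := rfl

theorem pullbackMetric_comp {F : N → P} {ψ : M → N} (g : MetricTensor K P) {x : M}
    (hF : MDifferentiableAt J K F (ψ x)) (hψ : MDifferentiableAt I J ψ x) :
    pullbackMetric I (F ∘ ψ) g x = pullbackMetric I ψ (pullbackMetric J F g) x := by
  ext u v
  rw [pullbackMetric_apply, mfderiv_comp x hF hψ]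
  rfl

theorem pullbackMetric_congr_of_eventuallyEq {F F' : M → N} (g : MetricTensor J N) {x : M}
    (h : F =ᶠ[𝓝 x] F') : pullbackMetric I F g x = pullbackMetric I F' g x := by
  have hx : F x = F' x := h.eq_of_nhds
  -- The tangent spaces at `F x` and `F' x` are formally different types, so the comparison is
  -- carried out on the model space.
  have hd : (mfderiv I J F x : E →L[ℝ] E') = (mfderiv I J F' x : E →L[ℝ] E') := h.mfderiv_eq
  have hg : (g (F x) : E' →L[ℝ] E' →L[ℝ] ℝ) = (g (F' x) : E' →L[ℝ] E' →L[ℝ] ℝ) := by rw [hx]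
  ext u v
  change (g (F x) : E' →L[ℝ] E' →L[ℝ] ℝ) ((mfderiv I J F x : E →L[ℝ] E') u)
      ((mfderiv I J F x : E →L[ℝ] E') v) =
    (g (F' x) : E' →L[ℝ] E' →L[ℝ] ℝ) ((mfderiv I J F' x : E →L[ℝ] E') u)
      ((mfderiv I J F' x : E →L[ℝ] E') v)
  rw [hg, hd]
  rfl

end Pullback

/-! ### The Riemannian measure in an arbitrary parametrization -/

section ChartParam

variable {E : Type*} [NormedAddCommGroup E] [NormedSpace ℝ E]
  {H : Type*} [TopologicalSpace H] {I : ModelWithCorners ℝ E H}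
  {M : Type*} [TopologicalSpace M] [ChartedSpace H M]

/-- The inverse of the chart around a point, as a parametrization. -/
noncomputable def chartParam (I : ModelWithCorners ℝ E H) [I.Boundaryless] (x₀ : M) :
    OpenPartialHomeomorph E M where
  toPartialEquiv := (extChartAt I x₀).symm
  open_source := isOpen_extChartAt_target x₀
  open_target := isOpen_extChartAt_source x₀
  continuousOn_toFun := continuousOn_extChartAt_symm x₀
  continuousOn_invFun := continuousOn_extChartAt x₀

variable [I.Boundaryless]

theorem chartParam_mdifferentiable [IsManifold I 1 M] (x₀ : M) :
    (chartParam I x₀).MDifferentiable 𝓘(ℝ, E) I := by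
  constructor
  · change MDifferentiableOn _ _ (extChartAt I x₀).symm (extChartAt I x₀).target
    exact mdifferentiableOn_extChartAt_symm
  · change MDifferentiableOn _ _ (extChartAt I x₀) (extChartAt I x₀).source
    rw [extChartAt_source]
    exact mdifferentiableOn_extChartAt

theorem mem_chartParam_target (x₀ : M) : x₀ ∈ (chartParam I x₀).target :=
  mem_extChartAt_source x₀

theorem exists_countable_cover_chartParam [SecondCountableTopology M] [Nonempty M] :
    ∃ c : ℕ → M, ⋃ n, (chartParam I (c n)).target = Set.univ := by
  obtain ⟨s, hs, hsc⟩ := TopologicalSpace.countable_cover_nhds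
    fun x : M => (chartParam I x).open_target.mem_nhds (mem_chartParam_target x)
  have hne : s.Nonempty := by
    by_contra h
    rw [Set.not_nonempty_iff_eq_empty] at h
    simp [h] at hsc
    exact (Set.empty_ne_univ hsc).elim
  obtain ⟨c, rfl⟩ := hs.exists_eq_range hne
  exact ⟨c, by simpa using hsc⟩

end ChartParam

section Volume

theorem measurableSet_preimage_inter_source {α β : Type*} [TopologicalSpace α]
    [MeasurableSpace α] [BorelSpace α] [TopologicalSpace β] [MeasurableSpace β] [BorelSpace β]
    (e : OpenPartialHomeomorph α β) {A : Set β} (hA : MeasurableSet A) :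
    MeasurableSet (e ⁻¹' A ∩ e.source) := by
  have h : Measurable (e.source.domRestrict e) :=
    (continuousOn_iff_continuous_domRestrict.1 e.continuousOn).measurable
  have h' := e.open_source.measurableSet.subtype_image (h hA)
  convert h' using 1
  ext z
  simp [and_comm]

variable {E : Type*} [NormedAddCommGroup E] [NormedSpace ℝ E]
  {H : Type*} [TopologicalSpace H] {I : ModelWithCorners ℝ E H}
  {M : Type*} [TopologicalSpace M] [ChartedSpace H M]
  {ι : Type*} [Fintype ι] [DecidableEq ι]

/-- The Gram determinant, with respect to a basis of the parameter space, of the pull-back of the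
metric by a parametrization. -/
noncomputable def paramGram (g : MetricTensor I M) (b : Module.Basis ι ℝ E) (ψ : E → M) (z : E) :
    ℝ :=
  gram (E := E) (pullbackMetric 𝓘(ℝ, E) ψ g z) b

variable [FiniteDimensional ℝ E] [MeasurableSpace E] [BorelSpace E]
  [MeasurableSpace M] [BorelSpace M]

/-- The Riemannian measure on the image of a parametrization. -/
noncomputable def paramVolume (g : MetricTensor I M) (b : Module.Basis ι ℝ E)
    (e : OpenPartialHomeomorph E M) : Measure M :=
  ((b.addHaar.restrict e.source).withDensity
    fun z => ENNReal.ofReal √(paramGram g b e z)).map e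

theorem aemeasurable_param (b : Module.Basis ι ℝ E) (e : OpenPartialHomeomorph E M)
    (f : E → ENNReal) : AEMeasurable e ((b.addHaar.restrict e.source).withDensity f) :=
  (e.continuousOn.aemeasurable e.open_source.measurableSet).mono_ac
    (withDensity_absolutelyContinuous _ _)

theorem paramVolume_apply (g : MetricTensor I M) (b : Module.Basis ι ℝ E)
    (e : OpenPartialHomeomorph E M) {A : Set M} (hA : MeasurableSet A) :
    paramVolume g b e A =
      ∫⁻ z in e ⁻¹' A ∩ e.source, ENNReal.ofReal √(paramGram g b e z) ∂b.addHaar := by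
  rw [paramVolume, Measure.map_apply_of_aemeasurable (aemeasurable_param b e _) hA,
    withDensity_apply', Measure.restrict_restrict' e.open_source.measurableSet]

theorem paramVolume_compl_target (g : MetricTensor I M) (b : Module.Basis ι ℝ E)
    (e : OpenPartialHomeomorph E M) : paramVolume g b e e.targetᶜ = 0 := by
  rw [paramVolume_apply g b e e.open_target.measurableSet.compl]
  have : e ⁻¹' e.targetᶜ ∩ e.source = ∅ := by
    ext z
    simp only [Set.mem_inter_iff, Set.mem_preimage, Set.mem_compl_iff, Set.mem_empty_iff_false,
      iff_false, not_and]
    exact fun h h' => h (e.map_source h')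
  rw [this]
  simp

theorem paramVolume_congr_basis (g : MetricTensor I M) {κ : Type*} [Fintype κ] [DecidableEq κ]
    (b : Module.Basis ι ℝ E) (b' : Module.Basis κ ℝ E) (e : OpenPartialHomeomorph E M) :
    paramVolume g b e = paramVolume g b' e := by
  obtain ⟨c, -, hc, hB⟩ := ofReal_sqrt_gram_smul_addHaar b b'
  ext A hA
  rw [paramVolume_apply g b e hA, paramVolume_apply g b' e hA, hc]
  have : (c • b.addHaar : Measure E) = (c : ENNReal) • b.addHaar := rfl
  rw [this, Measure.restrict_smul, lintegral_smul_measure, smul_eq_mul,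
    ← lintegral_const_mul' _ _ ENNReal.coe_ne_top]
  exact lintegral_congr fun z => (hB _).symm

/-- Change of variables for the transition `τ = e₂⁻¹ ∘ e₁`: since `e₁ = e₂ ∘ τ` locally, the Gram
determinant picks up `(det Dτ)²`, whose root is the Jacobian. Differentiability of `τ` suffices; its
derivative need not be continuous. -/
theorem paramVolume_compatible (g : MetricTensor I M) (b : Module.Basis ι ℝ E)
    {e₁ e₂ : OpenPartialHomeomorph E M} (h₁ : e₁.MDifferentiable 𝓘(ℝ, E) I)
    (h₂ : e₂.MDifferentiable 𝓘(ℝ, E) I) {A : Set M} (hA : A ⊆ e₁.target ∩ e₂.target)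
    (hAm : MeasurableSet A) : paramVolume g b e₁ A = paramVolume g b e₂ A := by
  rw [paramVolume_apply g b e₁ hAm, paramVolume_apply g b e₂ hAm]
  let τ : OpenPartialHomeomorph E E := e₁.trans e₂.symm
  have hτ : τ.MDifferentiable 𝓘(ℝ, E) 𝓘(ℝ, E) := h₁.trans h₂.symm
  set s := e₁ ⁻¹' A ∩ e₁.source
  have hs : MeasurableSet s := measurableSet_preimage_inter_source e₁ hAm
  have hsub : s ⊆ τ.source := fun z hz => by
    simp only [τ, OpenPartialHomeomorph.trans_source, OpenPartialHomeomorph.symm_source]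
    exact ⟨hz.2, (hA hz.1).2⟩
  have himage : τ '' s = e₂ ⁻¹' A ∩ e₂.source := by
    ext w
    constructor
    · rintro ⟨z, hz, rfl⟩
      have h2 : e₂ (τ z) = e₁ z := e₂.right_inv (hA hz.1).2
      exact ⟨by rw [Set.mem_preimage, h2]; exact hz.1, e₂.map_target (hA hz.1).2⟩
    · rintro ⟨hw, hw'⟩
      refine ⟨e₁.symm (e₂ w), ⟨?_, e₁.map_target (hA hw).1⟩, ?_⟩
      · rw [Set.mem_preimage, e₁.right_inv (hA hw).1]
        exact hw
      · change e₂.symm (e₁ (e₁.symm (e₂ w))) = w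
        rw [e₁.right_inv (hA hw).1, e₂.left_inv hw']
  have hderiv : ∀ z ∈ s, HasFDerivWithinAt τ (fderiv ℝ τ z) s z := fun z hz =>
    (hτ.mdifferentiableAt (hsub hz)).differentiableAt.hasFDerivAt.hasFDerivWithinAt
  rw [← himage, lintegral_image_eq_lintegral_abs_det_fderiv_mul _ hs hderiv
    (τ.injOn.mono hsub)]
  refine setLIntegral_congr_fun hs fun z hz => ?_
  rw [← ofReal_sqrt_sq_mul]
  congr 2
  have heq : e₁ =ᶠ[𝓝 z] e₂ ∘ τ := by
    filter_upwards [τ.open_source.mem_nhds (hsub hz)] with w hw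
    simp only [τ, OpenPartialHomeomorph.trans_source, OpenPartialHomeomorph.symm_source] at hw
    exact (e₂.right_inv hw.2).symm
  have h2 : τ z ∈ e₂.source := τ.map_source (hsub hz) |> fun h => by
    simp only [τ, OpenPartialHomeomorph.trans_target, OpenPartialHomeomorph.symm_target] at h
    exact h.1
  have hpb := (pullbackMetric_congr_of_eventuallyEq (I := 𝓘(ℝ, E)) g heq).trans
    (pullbackMetric_comp g (h₂.mdifferentiableAt h2) (hτ.mdifferentiableAt (hsub hz)))
  have hd : fderiv ℝ τ z = (mfderiv 𝓘(ℝ, E) 𝓘(ℝ, E) τ z : E →L[ℝ] E) := mfderiv_eq_fderiv.symm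
  rw [paramGram, hpb, paramGram, hd]
  exact gram_bilinearComp (E := E) (pullbackMetric 𝓘(ℝ, E) e₂ g (τ z)) b
    (mfderiv 𝓘(ℝ, E) 𝓘(ℝ, E) τ z)

variable [I.Boundaryless]

theorem chartVolume_eq (g : MetricTensor I M) (x₀ : M) :
    chartVolume g x₀ = paramVolume g (Module.finBasis ℝ E) (chartParam I x₀) := by
  -- `chartVolume` fixes the Borel σ-algebra of `E` internally; once it replaces the ambient one,
  -- both sides are equal by definition.
  have h := BorelSpace.measurable_eq (α := E)
  subst h
  rfl

/-- On the image of a parametrization, the Riemannian measure has density `√(det gᵢⱼ)` with respect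
to Lebesgue measure in the parameters. -/
theorem riemannianVolume_restrict_target [IsManifold I 1 M] [SecondCountableTopology M]
    (g : MetricTensor I M) (b : Module.Basis ι ℝ E) {e : OpenPartialHomeomorph E M}
    (he : e.MDifferentiable 𝓘(ℝ, E) I) :
    (riemannianVolume g).restrict e.target = paramVolume g b e := by
  rcases isEmpty_or_nonempty M with hM | hM
  · ext A hA
    simp [Set.eq_empty_of_isEmpty A]
  obtain ⟨c, hc⟩ := exists_countable_cover_chartParam (I := I) (M := M)
  have hvol : ∀ x₀ : M, (riemannianVolume g).restrict (chartParam I x₀).target =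
      paramVolume g (Module.finBasis ℝ E) (chartParam I x₀) := by
    intro x₀
    rw [riemannianVolume]
    simp_rw [chartVolume_eq]
    exact iSup_restrict_of_compatible
      (fun x₀ => paramVolume g (Module.finBasis ℝ E) (chartParam I x₀))
      (fun x₀ => (chartParam I x₀).target)
      (fun i => (chartParam I i).open_target.measurableSet)
      (fun i => paramVolume_compl_target _ _ _)
      (fun i j A hA hAm => paramVolume_compatible g _ (chartParam_mdifferentiable i)
        (chartParam_mdifferentiable j) hA hAm) c hc x₀
  -- The charts use `finBasis`, so the basis is exchanged first. Then, on each of countably many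
  -- chart domains, the chart and `e` are two parametrizations of the overlap.
  rw [paramVolume_congr_basis g b (Module.finBasis ℝ E)]
  refine (Measure.ext_iff_of_iUnion_eq_univ hc).2 fun n => ?_
  ext A hA
  have hm := (chartParam I (c n)).open_target.measurableSet
  have hme := e.open_target.measurableSet
  rw [Measure.restrict_apply hA, Measure.restrict_apply hA,
    Measure.restrict_apply (hA.inter hm),
    ← measure_inter_conull (paramVolume_compl_target g _ e),
    ← paramVolume_compatible g _ (chartParam_mdifferentiable (c n)) he
      (fun x hx => ⟨hx.1.2, hx.2⟩) ((hA.inter hm).inter hme), ← hvol,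
    Measure.restrict_apply ((hA.inter hm).inter hme)]
  congr 1
  ext x
  simp only [Set.mem_inter_iff]
  tauto

end Volume

/-! ### Local isometries preserve the Riemannian measure -/

section Isometry

variable {E : Type*} [NormedAddCommGroup E] [NormedSpace ℝ E] [FiniteDimensional ℝ E]
  {H : Type*} [TopologicalSpace H] {I : ModelWithCorners ℝ E H} [I.Boundaryless]
  {M : Type*} [TopologicalSpace M] [ChartedSpace H M] [IsManifold I 1 M]
  [SecondCountableTopology M] [MeasurableSpace M] [BorelSpace M]
  {H' : Type*} [TopologicalSpace H'] {J : ModelWithCorners ℝ E H'} [J.Boundaryless]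
  {N : Type*} [TopologicalSpace N] [ChartedSpace H' N] [IsManifold J 1 N]
  [SecondCountableTopology N] [MeasurableSpace N] [BorelSpace N]

/-- Pulling `g` back through `F` and then through `e` gives the pull-back of `g'`, so both sides
integrate the same density over the same set of parameters. -/
theorem paramVolume_trans [MeasurableSpace E] [BorelSpace E] {ι : Type*} [Fintype ι]
    [DecidableEq ι] (b : Module.Basis ι ℝ E) {F : OpenPartialHomeomorph N M}
    (hF : F.MDifferentiable J I) {g : MetricTensor I M} {g' : MetricTensor J N}
    (hg : ∀ x ∈ F.source, pullbackMetric J F g x = g' x)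
    {e : OpenPartialHomeomorph E N} (he : e.MDifferentiable 𝓘(ℝ, E) J)
    {A : Set M} (hA : MeasurableSet A) :
    paramVolume g b (e.trans F) A = paramVolume g' b e (F ⁻¹' A ∩ F.source) := by
  rw [paramVolume_apply _ _ _ hA,
    paramVolume_apply _ _ _ (measurableSet_preimage_inter_source F hA)]
  have hset : (e.trans F) ⁻¹' A ∩ (e.trans F).source = e ⁻¹' (F ⁻¹' A ∩ F.source) ∩ e.source := by
    ext z
    simp only [OpenPartialHomeomorph.coe_trans, OpenPartialHomeomorph.trans_source,
      Set.mem_inter_iff, Set.mem_preimage, Function.comp_apply]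
    tauto
  rw [hset]
  refine setLIntegral_congr_fun
    (measurableSet_preimage_inter_source e (measurableSet_preimage_inter_source F hA))
    fun z hz => ?_
  have h := pullbackMetric_comp (I := 𝓘(ℝ, E)) g (hF.mdifferentiableAt hz.1.2)
    (he.mdifferentiableAt hz.2)
  have h' : pullbackMetric 𝓘(ℝ, E) e (pullbackMetric J F g) z = pullbackMetric 𝓘(ℝ, E) e g' z := by
    ext u v
    rw [pullbackMetric_apply, hg _ hz.1.2]
    rfl
  simp only [paramGram, OpenPartialHomeomorph.coe_trans]
  rw [h, h']

/-- A local isometry between open subsets preserves the Riemannian measure. -/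
theorem map_riemannianVolume_restrict {F : OpenPartialHomeomorph N M}
    (hF : F.MDifferentiable J I) {g : MetricTensor I M} {g' : MetricTensor J N}
    (hg : ∀ x ∈ F.source, pullbackMetric J F g x = g' x) :
    ((riemannianVolume g').restrict F.source).map F = (riemannianVolume g).restrict F.target := by
  let : MeasurableSpace E := borel E
  have : BorelSpace E := ⟨rfl⟩
  rcases isEmpty_or_nonempty N with hN | hN
  · have h1 : F.source = ∅ := Set.eq_empty_of_isEmpty _
    have h2 : F.target = ∅ := by rw [← F.image_source_eq_target, h1, Set.image_empty]
    simp [h1, h2]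
  obtain ⟨c, hc⟩ := exists_countable_cover_chartParam (I := J) (M := N)
  let e (n : ℕ) : OpenPartialHomeomorph E N := chartParam J (c n)
  have he (n : ℕ) : (e n).MDifferentiable 𝓘(ℝ, E) J := chartParam_mdifferentiable (c n)
  have hFm : AEMeasurable F ((riemannianVolume g').restrict F.source) :=
    F.continuousOn.aemeasurable F.open_source.measurableSet
  have hmap {A : Set M} (hA : MeasurableSet A) :
      ((riemannianVolume g').restrict F.source).map F A =
        riemannianVolume g' (F ⁻¹' A ∩ F.source) := by
    rw [Measure.map_apply_of_aemeasurable hFm hA,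
      Measure.restrict_apply' F.open_source.measurableSet]
  let T (n : ℕ) : Set M := ((e n).trans F).target
  have hT (n : ℕ) : MeasurableSet (T n) := ((e n).trans F).open_target.measurableSet
  have hTF : ⋃ n, T n = F.target := by
    simp only [T, OpenPartialHomeomorph.trans_target]
    rw [← Set.inter_iUnion, ← Set.preimage_iUnion]
    have : ⋃ n, (e n).target = Set.univ := hc
    rw [this, Set.preimage_univ, Set.inter_univ]
  have key : (((riemannianVolume g').restrict F.source).map F).restrict F.target =
      (riemannianVolume g).restrict F.target := by
    rw [← hTF]
    refine Measure.restrict_iUnion_congr.2 fun n => ?_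
    ext A hA
    rw [riemannianVolume_restrict_target g (Module.finBasis ℝ E) ((he n).trans hF),
      paramVolume_trans _ hF hg (he n) hA,
      ← riemannianVolume_restrict_target g' (Module.finBasis ℝ E) (he n),
      Measure.restrict_apply hA, hmap (hA.inter (hT n)),
      Measure.restrict_apply (measurableSet_preimage_inter_source F hA)]
    congr 1
    ext x
    simp only [T, OpenPartialHomeomorph.trans_target, Set.mem_inter_iff, Set.mem_preimage]
    constructor
    · rintro ⟨⟨h1, h2, h3⟩, h4⟩
      rw [F.left_inv h4] at h3
      exact ⟨⟨h1, h4⟩, h3⟩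
    · rintro ⟨⟨h1, h4⟩, h3⟩
      exact ⟨⟨h1, F.map_source h4, by rwa [F.left_inv h4]⟩, h4⟩
  rw [← key]
  ext A hA
  rw [Measure.restrict_apply hA, hmap hA, hmap (hA.inter F.open_target.measurableSet)]
  congr 1
  ext x
  exact ⟨fun h => ⟨⟨h.1, F.map_source h.2⟩, h.2⟩, fun h => ⟨h.1.1, h.2⟩⟩

end Isometry

/-! ### Continuity of the metric and of inner products of differentials -/

section Continuity

variable {E : Type*} [NormedAddCommGroup E] [NormedSpace ℝ E]
  {H : Type*} [TopologicalSpace H] {I : ModelWithCorners ℝ E H} [I.Boundaryless]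
  {M : Type*} [TopologicalSpace M] [ChartedSpace H M] [IsManifold I ∞ M]

/-- The coordinate fields are the tangent map of the smooth parametrization applied to constant
fields; the metric, a smooth section, is evaluated on two of them. -/
theorem continuousOn_pullback_chartParam
    (g : Bundle.ContMDiffRiemannianMetric I ∞ E (fun x : M => TangentSpace I x)) (x₀ : M)
    (u v : E) :
    ContinuousOn (fun z : E => (pullbackMetric 𝓘(ℝ, E) (chartParam I x₀) g.inner z :
      E →L[ℝ] E →L[ℝ] ℝ) u v) (chartParam I x₀).source := by
  set c : E → M := ⇑(chartParam I x₀)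
  set t : Set E := (chartParam I x₀).source
  have ht : IsOpen t := (chartParam I x₀).open_source
  have hc : ContMDiffOn 𝓘(ℝ, E) I ∞ c t := contMDiffOn_extChartAt_symm x₀
  have hv (u : E) : ContMDiffOn 𝓘(ℝ, E) I.tangent 1
      (fun z => (⟨c z, mfderiv 𝓘(ℝ, E) I c z u⟩ : TangentBundle I M)) t := by
    have h1 : ContMDiff 𝓘(ℝ, E) 𝓘(ℝ, E).tangent 1
        (fun z => (⟨z, u⟩ : TangentBundle 𝓘(ℝ, E) E)) := fun z =>
      contMDiffAt_vectorSpace_iff_contDiffAt.2 contDiffAt_const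
    have h2 := (hc.contMDiffOn_tangentMapWithin (m := 1) (by norm_cast) ht.uniqueMDiffOn).comp
      h1.contMDiffOn (fun z hz => hz)
    refine h2.congr fun z hz => ?_
    simp only [Function.comp_apply, tangentMapWithin]
    rw [mfderivWithin_of_isOpen ht hz]
  have h : ContMDiffOn 𝓘(ℝ, E) (I.prod 𝓘(ℝ)) 1
      (fun z ↦ Bundle.TotalSpace.mk' ℝ (E := Bundle.Trivial M ℝ) (c z)
        (g.inner (c z) (mfderiv 𝓘(ℝ, E) I c z u) (mfderiv 𝓘(ℝ, E) I c z v))) t := by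
    apply ContMDiffOn.clm_bundle_apply₂ (F₁ := E) (F₂ := E)
    · exact (g.contMDiff.of_le (by norm_cast)).comp_contMDiffOn (hc.of_le (by norm_cast))
    · exact hv u
    · exact hv v
  intro z hz
  have h' := h z hz
  simp only [Bundle.contMDiffWithinAt_totalSpace] at h'
  exact h'.2.continuousWithinAt

end Continuity

section Forms

variable {E : Type*} [NormedAddCommGroup E] [NormedSpace ℝ E]

/-- Positivity makes the map to the dual injective and equality of dimensions makes it onto;
symmetry plays no role. -/
theorem isInvertible_of_pos [FiniteDimensional ℝ E] (B : E →L[ℝ] E →L[ℝ] ℝ) (hB : ∀ v, v ≠ 0 → 0 < B v v) :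
    B.IsInvertible := by
  have hinj : Function.Injective B := by
    rw [injective_iff_map_eq_zero]
    intro v hv
    by_contra h
    have h' := hB v h
    simp [hv] at h'
  have hdim : Module.finrank ℝ E = Module.finrank ℝ (E →L[ℝ] ℝ) := by
    rw [← (LinearMap.toContinuousLinearMap (𝕜 := ℝ) (E := E) (F' := ℝ)).finrank_eq]
    exact Subspace.dual_finrank_eq.symm
  exact ⟨(LinearMap.linearEquivOfInjective (B : E →ₗ[ℝ] E →L[ℝ] ℝ) hinj
    hdim).toContinuousLinearEquiv, by ext; rfl⟩

theorem apply_self_nonneg_of_pos (B : E →L[ℝ] E →L[ℝ] ℝ) (hB : ∀ v, v ≠ 0 → 0 < B v v) (v : E) :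
    0 ≤ B v v := by
  by_cases h : v = 0
  · simp [h]
  · exact (hB v h).le

/-- The Gram matrix is positive semidefinite: its quadratic form at `x` is `B v v` with `v = ∑ xᵢ
bᵢ`. -/
theorem gram_nonneg {ι : Type*} [Fintype ι] [DecidableEq ι] (B : E →L[ℝ] E →L[ℝ] ℝ)
    (hsymm : ∀ v w, B v w = B w v) (hB : ∀ v, 0 ≤ B v v) (b : Module.Basis ι ℝ E) :
    0 ≤ gram B b := by
  refine Matrix.PosSemidef.det_nonneg (Matrix.PosSemidef.of_dotProduct_mulVec_nonneg ?_ ?_)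
  · ext i j
    exact hsymm _ _
  · intro x
    have h := hB (∑ i, x i • b i)
    refine h.trans_eq ?_
    simp only [map_sum, map_smul, sum_apply, smul_apply, Matrix.mulVec, dotProduct,
      Matrix.of_apply, smul_eq_mul, Finset.mul_sum, star_trivial]
    rw [Finset.sum_comm]
    exact Finset.sum_congr rfl fun i _ => Finset.sum_congr rfl fun j _ => by ring

end Forms

section InnerDifferential

variable {E : Type*} [NormedAddCommGroup E] [NormedSpace ℝ E] [FiniteDimensional ℝ E]
  {H : Type*} [TopologicalSpace H] {I : ModelWithCorners ℝ E H}
  {M : Type*} [TopologicalSpace M] [ChartedSpace H M]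

/-- Positivity ensures that the inverse in the definition is genuine, so any vector representing
`df` can stand for the gradient and inverses need not be computed. -/
theorem innerDifferential_eq_apply {g : MetricTensor I M} {f h : M → ℝ} {x : M}
    (hg : ∀ v : TangentSpace I x, v ≠ 0 → 0 < g x v v) {v : TangentSpace I x}
    (hv : g x v = differential I f x) : innerDifferential g f h x = differential I h x v := by
  have hinv : (g x).IsInvertible := isInvertible_of_pos (E := E) (g x) hg
  rw [innerDifferential, ← hv, hinv.inverse_apply_self]

/-- The gradient of a function, as the vector that represents its differential. -/
theorem exists_gradient {g : MetricTensor I M} (f : M → ℝ) {x : M}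
    (hg : ∀ v : TangentSpace I x, v ≠ 0 → 0 < g x v v) :
    ∃ v : TangentSpace I x, g x v = differential I f x :=
  have hinv : (g x).IsInvertible := isInvertible_of_pos (E := E) (g x) hg
  hinv.surjective _

/-- A submersion `F` that is compatible with the metrics `g'` and `g`, in the sense that horizontal
lifts of vectors exist, preserves the inner products of differentials. -/
theorem innerDifferential_comp {E' : Type*} [NormedAddCommGroup E'] [NormedSpace ℝ E']
    [FiniteDimensional ℝ E'] {H' : Type*} [TopologicalSpace H'] {J : ModelWithCorners ℝ E' H'}
    {N : Type*} [TopologicalSpace N] [ChartedSpace H' N]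
    {g : MetricTensor I M} {g' : MetricTensor J N} {F : N → M} {y : N} {f h : M → ℝ}
    (hF : MDifferentiableAt J I F y) (hf : MDifferentiableAt I 𝓘(ℝ, ℝ) f (F y))
    (hh : MDifferentiableAt I 𝓘(ℝ, ℝ) h (F y))
    (hg : ∀ v : TangentSpace I (F y), v ≠ 0 → 0 < g (F y) v v)
    (hg' : ∀ v : TangentSpace J y, v ≠ 0 → 0 < g' y v v)
    (hlift : ∀ v : TangentSpace I (F y), ∃ w : TangentSpace J y, mfderiv J I F y w = v ∧
      ∀ w', g' y w w' = g (F y) v (mfderiv J I F y w')) :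
    innerDifferential g' (f ∘ F) (h ∘ F) y = innerDifferential g f h (F y) := by
  obtain ⟨v, hv⟩ := exists_gradient f hg
  obtain ⟨w, hw, hw'⟩ := hlift v
  have hfF : differential J (f ∘ F) y = (differential I f (F y)).comp (mfderiv J I F y) :=
    mfderiv_comp y hf hF
  have hhF : differential J (h ∘ F) y = (differential I h (F y)).comp (mfderiv J I F y) :=
    mfderiv_comp y hh hF
  -- The horizontal lift of the gradient of `f` represents `d(f ∘ F)`, hence is the gradient
  -- upstairs.
  have hgrad : g' y w = differential J (f ∘ F) y := by
    ext w'
    rw [hw', hv, hfF]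
    rfl
  rw [innerDifferential_eq_apply hg' hgrad, innerDifferential_eq_apply hg hv, hhF, ← hw]
  rfl

theorem pullback_pos {E' : Type*} [NormedAddCommGroup E'] [NormedSpace ℝ E']
    {H' : Type*} [TopologicalSpace H'] {J : ModelWithCorners ℝ E' H'}
    {N : Type*} [TopologicalSpace N] [ChartedSpace H' N]
    {g : MetricTensor I M} {F : N → M} {y : N}
    (hg : ∀ v : TangentSpace I (F y), v ≠ 0 → 0 < g (F y) v v)
    (hF : Function.Injective (mfderiv J I F y)) (v : TangentSpace J y) (hv : v ≠ 0) :
    0 < pullbackMetric J F g y v v :=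
  hg _ fun h => hv (hF (h.trans (map_zero _).symm))

variable [I.Boundaryless] [IsManifold I ∞ M]

/-- In a chart the expression is `dh (B⁻¹ df)` with `B` continuous and invertible, and inversion is
continuous at invertible maps. The chart is isometric for the pulled-back metric, so
`innerDifferential_comp` justifies the formula. -/
theorem continuous_innerDifferential
    (g : Bundle.ContMDiffRiemannianMetric I ∞ E (fun x : M => TangentSpace I x))
    {f h : M → ℝ} (hf : ContMDiff I 𝓘(ℝ, ℝ) ∞ f) (hh : ContMDiff I 𝓘(ℝ, ℝ) ∞ h) :
    Continuous (innerDifferential g.inner f h) := by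
  rw [continuous_iff_continuousAt]
  intro x₀
  let e := chartParam I x₀
  have he : e.MDifferentiable 𝓘(ℝ, E) I := chartParam_mdifferentiable x₀
  let B : E → E →L[ℝ] E →L[ℝ] ℝ := fun z => pullbackMetric 𝓘(ℝ, E) e g.inner z
  have hBpos : ∀ z ∈ e.source, ∀ v, v ≠ 0 → 0 < B z v v := fun z hz v hv =>
    pullback_pos (J := 𝓘(ℝ, E)) (g.pos _) (he.mfderiv_injective hz) v hv
  have hBc : ContinuousOn B e.source :=
    continuousOn_clm_apply.2 fun u => continuousOn_clm_apply.2 fun v =>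
      continuousOn_pullback_chartParam g x₀ u v
  have hBi : ContinuousOn (fun z => (B z).inverse) e.source := fun z hz =>
    ((isInvertible_of_pos _ (hBpos z hz)).contDiffAt_map_inverse
      (n := 0)).continuousAt.comp_continuousWithinAt (hBc z hz)
  have hcd {k : M → ℝ} (hk : ContMDiff I 𝓘(ℝ, ℝ) ∞ k) :
      ContinuousOn (fun z => fderiv ℝ (k ∘ e) z) e.source := by
    have h1 : ContMDiffOn 𝓘(ℝ, E) 𝓘(ℝ, ℝ) ∞ (k ∘ e) e.source :=
      hk.comp_contMDiffOn (contMDiffOn_extChartAt_symm x₀)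
    exact (contMDiffOn_iff_contDiffOn.1 h1).continuousOn_fderiv_of_isOpen e.open_source
      (by norm_cast)
  have hloc : ∀ z ∈ e.source, innerDifferential g.inner f h (e z) =
      fderiv ℝ (h ∘ e) z ((B z).inverse (fderiv ℝ (f ∘ e) z)) := by
    intro z hz
    have h1 := innerDifferential_comp (J := 𝓘(ℝ, E)) (g := g.inner)
      (g' := pullbackMetric 𝓘(ℝ, E) e g.inner) (he.mdifferentiableAt hz)
      (hf.mdifferentiable (by simp) (e z)) (hh.mdifferentiable (by simp) (e z))
      (g.pos _) (hBpos z hz) fun v => by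
        obtain ⟨w, rfl⟩ := he.mfderiv_surjective hz v
        exact ⟨w, rfl, fun w' => rfl⟩
    rw [← h1, innerDifferential, differential, differential, mfderiv_eq_fderiv, mfderiv_eq_fderiv]
    rfl
  have hc : ContinuousOn (fun z => innerDifferential g.inner f h (e z)) e.source :=
    ((hcd hh).clm_apply (hBi.clm_apply (hcd hf))).congr hloc
  have hx₀ : x₀ ∈ e.target := mem_chartParam_target x₀
  have h2 : ContinuousAt ((fun z => innerDifferential g.inner f h (e z)) ∘ e.symm) x₀ :=
    (hc.continuousAt (e.open_source.mem_nhds (e.map_target hx₀))).comp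
      (e.continuousAt_symm hx₀)
  refine h2.congr ?_
  filter_upwards [e.open_target.mem_nhds hx₀] with x hx
  simp only [Function.comp_apply, e.right_inv hx]

end InnerDifferential

/-! ### Local finiteness and the measure of a product -/

section Finite

variable {E : Type*} [NormedAddCommGroup E] [NormedSpace ℝ E] [FiniteDimensional ℝ E]
  {H : Type*} [TopologicalSpace H] {I : ModelWithCorners ℝ E H} [I.Boundaryless]
  {M : Type*} [TopologicalSpace M] [ChartedSpace H M] [IsManifold I ∞ M]
  {ι : Type*} [Fintype ι] [DecidableEq ι]

theorem continuousOn_paramGram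
    (g : Bundle.ContMDiffRiemannianMetric I ∞ E (fun x : M => TangentSpace I x))
    (b : Module.Basis ι ℝ E) (x₀ : M) :
    ContinuousOn (paramGram g.inner b (chartParam I x₀)) (chartParam I x₀).source := by
  have h : ContinuousOn (fun z => Matrix.of fun i j : ι =>
      (pullbackMetric 𝓘(ℝ, E) (chartParam I x₀) g.inner z : E →L[ℝ] E →L[ℝ] ℝ) (b i) (b j))
      (chartParam I x₀).source :=
    continuousOn_pi.2 fun i => continuousOn_pi.2 fun j =>
      continuousOn_pullback_chartParam g x₀ (b i) (b j)
  exact (Continuous.matrix_det continuous_id).comp_continuousOn h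

variable [MeasurableSpace M] [BorelSpace M] [SecondCountableTopology M]

/-- On a compact set of parameters the continuous density is bounded. As an instance, this makes the
measure of a compact manifold finite. -/
instance isLocallyFiniteMeasure_riemannianVolume
    (g : Bundle.ContMDiffRiemannianMetric I ∞ E (fun x : M => TangentSpace I x)) :
    IsLocallyFiniteMeasure (riemannianVolume g.inner) := by
  let : MeasurableSpace E := borel E
  have : BorelSpace E := ⟨rfl⟩
  refine ⟨fun x₀ => ?_⟩
  let e := chartParam I x₀
  let b := Module.finBasis ℝ E
  have hx₀ : x₀ ∈ e.target := mem_chartParam_target x₀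
  obtain ⟨K, hK, hKs, hKc⟩ := LocallyCompactSpace.local_compact_nhds (e.symm x₀) e.source
    (e.open_source.mem_nhds (e.map_target hx₀))
  refine ⟨e.symm ⁻¹' K ∩ e.target, Filter.inter_mem
    ((e.continuousAt_symm hx₀).preimage_mem_nhds hK) (e.open_target.mem_nhds hx₀), ?_⟩
  have hm : MeasurableSet (e.symm ⁻¹' K ∩ e.target) :=
    measurableSet_preimage_inter_source e.symm hKc.measurableSet
  obtain ⟨C, hC⟩ := hKc.exists_bound_of_continuousOn
    ((continuousOn_paramGram g b x₀).sqrt.mono hKs)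
  rw [← Measure.restrict_eq_self _ Set.inter_subset_right,
    riemannianVolume_restrict_target g.inner b (chartParam_mdifferentiable x₀),
    paramVolume_apply _ _ _ hm]
  have hsub : e ⁻¹' (e.symm ⁻¹' K ∩ e.target) ∩ e.source ⊆ K := fun z hz => by
    have h := hz.1.1
    rwa [Set.mem_preimage, e.left_inv hz.2] at h
  refine (lintegral_mono_set hsub).trans_lt ?_
  refine (setLIntegral_mono' (g := fun _ => ENNReal.ofReal C) hKc.measurableSet fun z hz =>
    ENNReal.ofReal_le_ofReal ((le_abs_self _).trans (hC z hz))).trans_lt ?_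
  rw [setLIntegral_const]
  exact ENNReal.mul_lt_top ENNReal.ofReal_lt_top hKc.measure_lt_top

end Finite

section Product

variable {E : Type*} [NormedAddCommGroup E] [NormedSpace ℝ E]
  {H : Type*} [TopologicalSpace H] {I : ModelWithCorners ℝ E H}
  {M : Type*} [TopologicalSpace M] [ChartedSpace H M]
  {E' : Type*} [NormedAddCommGroup E'] [NormedSpace ℝ E']
  {H' : Type*} [TopologicalSpace H'] {J : ModelWithCorners ℝ E' H'}
  {N : Type*} [TopologicalSpace N] [ChartedSpace H' N]

/-- The parameter space `E × E'` carries the model `𝓘(ℝ, E × E')` of a vector space, not a product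
of models, so the derivative is assembled from the two linear projections. -/
theorem hasMFDerivAt_param_prod {e : OpenPartialHomeomorph E M} {e' : OpenPartialHomeomorph E' N}
    (he : e.MDifferentiable 𝓘(ℝ, E) I) (he' : e'.MDifferentiable 𝓘(ℝ, E') J) {z : E × E'}
    (hz : z ∈ (e.prod e').source) :
    HasMFDerivAt 𝓘(ℝ, E × E') (I.prod J) (e.prod e') z
      (((mfderiv 𝓘(ℝ, E) I e z.1 : E →L[ℝ] E).comp (.fst ℝ E E')).prod
        ((mfderiv 𝓘(ℝ, E') J e' z.2 : E' →L[ℝ] E').comp (.snd ℝ E E'))) := by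
  have h1 : HasMFDerivAt 𝓘(ℝ, E × E') 𝓘(ℝ, E) (Prod.fst : E × E' → E) z (.fst ℝ E E') :=
    hasFDerivAt_fst.hasMFDerivAt
  have h2 : HasMFDerivAt 𝓘(ℝ, E × E') 𝓘(ℝ, E') (Prod.snd : E × E' → E') z (.snd ℝ E E') :=
    hasFDerivAt_snd.hasMFDerivAt
  exact ((he.mdifferentiableAt hz.1).hasMFDerivAt.comp z h1).prodMk
    ((he'.mdifferentiableAt hz.2).hasMFDerivAt.comp z h2)

theorem mdifferentiable_param_prod {e : OpenPartialHomeomorph E M}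
    {e' : OpenPartialHomeomorph E' N}
    (he : e.MDifferentiable 𝓘(ℝ, E) I) (he' : e'.MDifferentiable 𝓘(ℝ, E') J) :
    (e.prod e').MDifferentiable 𝓘(ℝ, E × E') (I.prod J) := by
  refine ⟨fun z hz => (hasMFDerivAt_param_prod he he' hz).mdifferentiableAt.mdifferentiableWithinAt,
    fun x hx => ?_⟩
  exact (((he.mdifferentiableAt_symm hx.1).comp x mdifferentiableAt_fst).prodMk_space
    ((he'.mdifferentiableAt_symm hx.2).comp x mdifferentiableAt_snd)).mdifferentiableWithinAt

theorem pullbackMetric_param_prod {e : OpenPartialHomeomorph E M}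
    {e' : OpenPartialHomeomorph E' N} (he : e.MDifferentiable 𝓘(ℝ, E) I)
    (he' : e'.MDifferentiable 𝓘(ℝ, E') J) (g : MetricTensor I M) (g' : MetricTensor J N)
    {z : E × E'} (hz : z ∈ (e.prod e').source) :
    (pullbackMetric 𝓘(ℝ, E × E') (e.prod e') (prodMetric g g') z :
      (E × E') →L[ℝ] (E × E') →L[ℝ] ℝ) =
      prodMetric (pullbackMetric 𝓘(ℝ, E) e g) (pullbackMetric 𝓘(ℝ, E') e' g') z := by
  refine ContinuousLinearMap.ext fun u => ContinuousLinearMap.ext fun v => ?_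
  change prodMetric g g' _ (mfderiv 𝓘(ℝ, E × E') (I.prod J) (e.prod e') z u)
    (mfderiv 𝓘(ℝ, E × E') (I.prod J) (e.prod e') z v) = _
  rw [(hasMFDerivAt_param_prod he he' hz).mfderiv]
  rfl

theorem paramGram_prod {e : OpenPartialHomeomorph E M}
    {e' : OpenPartialHomeomorph E' N} (he : e.MDifferentiable 𝓘(ℝ, E) I)
    (he' : e'.MDifferentiable 𝓘(ℝ, E') J) (g : MetricTensor I M) (g' : MetricTensor J N)
    {ι κ : Type*} [Fintype ι] [DecidableEq ι] [Fintype κ] [DecidableEq κ]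
    (b : Module.Basis ι ℝ E) (b' : Module.Basis κ ℝ E')
    {z : E × E'} (hz : z ∈ (e.prod e').source) :
    paramGram (prodMetric g g') (b.prod b') (e.prod e') z =
      paramGram g b e z.1 * paramGram g' b' e' z.2 := by
  have h1 : paramGram (prodMetric g g') (b.prod b') (e.prod e') z =
      gram (E := E × E') (prodMetric (pullbackMetric 𝓘(ℝ, E) e g)
        (pullbackMetric 𝓘(ℝ, E') e' g') z) (b.prod b') := by
    unfold paramGram
    congr 1
    exact pullbackMetric_param_prod he he' g g' hz
  rw [h1]
  exact gram_prod (E := E) (E' := E') (pullbackMetric 𝓘(ℝ, E) e g z.1)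
    (pullbackMetric 𝓘(ℝ, E') e' g' z.2) b b'

theorem paramGram_nonneg [FiniteDimensional ℝ E] {g : MetricTensor I M}
    (hsymm : ∀ x v w, g x v w = g x w v) (hpos : ∀ x v, 0 ≤ g x v v)
    {ι : Type*} [Fintype ι] [DecidableEq ι] (b : Module.Basis ι ℝ E) (ψ : E → M) (z : E) :
    0 ≤ paramGram g b ψ z := by
  have h1 : ∀ v w : E, (pullbackMetric 𝓘(ℝ, E) ψ g z : E →L[ℝ] E →L[ℝ] ℝ) v w =
      (pullbackMetric 𝓘(ℝ, E) ψ g z : E →L[ℝ] E →L[ℝ] ℝ) w v := fun v w => hsymm (ψ z) _ _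
  have h2 : ∀ v : E, 0 ≤ (pullbackMetric 𝓘(ℝ, E) ψ g z : E →L[ℝ] E →L[ℝ] ℝ) v v :=
    fun v => hpos (ψ z) _
  exact gram_nonneg (E := E) _ h1 h2 b

theorem metric_self_nonneg [IsManifold I ∞ M]
    (g : Bundle.ContMDiffRiemannianMetric I ∞ E (fun x : M => TangentSpace I x)) (x : M)
    (v : TangentSpace I x) : 0 ≤ g.inner x v v :=
  apply_self_nonneg_of_pos (E := E) (g.inner x) (g.pos x) v

variable [FiniteDimensional ℝ E] [FiniteDimensional ℝ E'] [I.Boundaryless] [J.Boundaryless]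
  [IsManifold I ∞ M] [IsManifold J ∞ N] [SecondCountableTopology M] [SecondCountableTopology N]
  [MeasurableSpace M] [BorelSpace M] [MeasurableSpace N] [BorelSpace N]

/-- The Riemannian measure of a product is the product of the Riemannian measures. -/
theorem riemannianVolume_prodMetric
    (g : Bundle.ContMDiffRiemannianMetric I ∞ E (fun x : M => TangentSpace I x))
    (g' : Bundle.ContMDiffRiemannianMetric J ∞ E' (fun x : N => TangentSpace J x))
    [IsFiniteMeasure (riemannianVolume g.inner)] [IsFiniteMeasure (riemannianVolume g'.inner)] :
    riemannianVolume (prodMetric g.inner g'.inner) =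
      (riemannianVolume g.inner).prod (riemannianVolume g'.inner) := by
  let : MeasurableSpace E := borel E
  have : BorelSpace E := ⟨rfl⟩
  let : MeasurableSpace E' := borel E'
  have : BorelSpace E' := ⟨rfl⟩
  rcases isEmpty_or_nonempty M with hM | hM
  · ext A hA
    simp [Set.eq_empty_of_isEmpty A]
  rcases isEmpty_or_nonempty N with hN | hN
  · ext A hA
    simp [Set.eq_empty_of_isEmpty A]
  obtain ⟨c, hc⟩ := exists_countable_cover_chartParam (I := I) (M := M)
  obtain ⟨c', hc'⟩ := exists_countable_cover_chartParam (I := J) (M := N)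
  let b := Module.finBasis ℝ E
  let b' := Module.finBasis ℝ E'
  have hcover : ⋃ n : ℕ × ℕ, ((chartParam I (c n.1)).prod (chartParam J (c' n.2))).target =
      Set.univ := by
    simp only [OpenPartialHomeomorph.prod_target]
    rw [← Set.univ_prod_univ, ← hc, ← hc']
    exact Set.iUnion_prod (fun n => (chartParam I (c n)).target)
      fun n => (chartParam J (c' n)).target
  refine (Measure.ext_iff_of_iUnion_eq_univ hcover).2 fun n => ?_
  set e := chartParam I (c n.1)
  set e' := chartParam J (c' n.2)
  have he : e.MDifferentiable 𝓘(ℝ, E) I := chartParam_mdifferentiable _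
  have he' : e'.MDifferentiable 𝓘(ℝ, E') J := chartParam_mdifferentiable _
  rw [riemannianVolume_restrict_target _ (b.prod b') (mdifferentiable_param_prod he he'),
    OpenPartialHomeomorph.prod_target, ← Measure.prod_restrict]
  -- On a product chart it suffices to compare on rectangles, where the density factors
  -- (`paramGram_prod`) and the integral splits.
  refine (Measure.prod_eq fun s t hs ht => ?_).symm
  rw [riemannianVolume_restrict_target _ b he, riemannianVolume_restrict_target _ b' he',
    paramVolume_apply _ _ _ (hs.prod ht), paramVolume_apply _ _ _ hs, paramVolume_apply _ _ _ ht]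
  have hset : (e.prod e') ⁻¹' (s ×ˢ t) ∩ (e.prod e').source =
      (e ⁻¹' s ∩ e.source) ×ˢ (e' ⁻¹' t ∩ e'.source) := by
    ext z
    simp only [OpenPartialHomeomorph.prod_source, OpenPartialHomeomorph.prod_apply,
      Set.mem_inter_iff, Set.mem_preimage, Set.mem_prod]
    tauto
  have hms : MeasurableSet (e ⁻¹' s ∩ e.source) := measurableSet_preimage_inter_source e hs
  have hmt : MeasurableSet (e' ⁻¹' t ∩ e'.source) := measurableSet_preimage_inter_source e' ht
  have hdens : ∀ z ∈ (e ⁻¹' s ∩ e.source) ×ˢ (e' ⁻¹' t ∩ e'.source),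
      ENNReal.ofReal √(paramGram (prodMetric g.inner g'.inner) (b.prod b') (e.prod e') z) =
        ENNReal.ofReal √(paramGram g.inner b e z.1) *
          ENNReal.ofReal √(paramGram g'.inner b' e' z.2) := by
    intro z hz
    rw [paramGram_prod he he' _ _ b b' ⟨hz.1.2, hz.2.2⟩,
      Real.sqrt_mul (paramGram_nonneg g.symm (metric_self_nonneg g) _ _ _),
      ENNReal.ofReal_mul (Real.sqrt_nonneg _)]
  rw [hset, setLIntegral_congr_fun (hms.prod hmt) hdens, Module.Basis.prod_addHaar,
    ← Measure.prod_restrict]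
  refine lintegral_prod_mul (f := fun z => ENNReal.ofReal √(paramGram g.inner b e z))
    (g := fun z => ENNReal.ofReal √(paramGram g'.inner b' e' z)) ?_ ?_
  · exact ((continuousOn_paramGram g b (c n.1)).sqrt.mono
      Set.inter_subset_right).aemeasurable hms |>.ennreal_ofReal
  · exact ((continuousOn_paramGram g' b' (c' n.2)).sqrt.mono
      Set.inter_subset_right).aemeasurable hmt |>.ennreal_ofReal

end Product

/-! ### Differentiation under an integral over a compact manifold -/

section ParametricIntegral

variable {EG : Type*} [NormedAddCommGroup EG] [NormedSpace ℝ EG]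
  {HG : Type*} [TopologicalSpace HG] {IG : ModelWithCorners ℝ EG HG}
  {G : Type*} [TopologicalSpace G] [ChartedSpace HG G] [IsManifold IG ∞ G] [CompactSpace G]
  [SecondCountableTopology G] [MeasurableSpace G] [BorelSpace G]
  {E : Type*} [NormedAddCommGroup E] [NormedSpace ℝ E] [FiniteDimensional ℝ E]
  {μ : Measure G} [IsFiniteMeasure μ] {O : Set E} {K : G → E → ℝ}

/-- The partial derivative is again jointly smooth, so the hypothesis on `K` reproduces itself and
differentiation under the integral can be iterated. -/
theorem contMDiffOn_fderiv_snd (hO : IsOpen O)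
    (hK : ContMDiffOn (IG.prod 𝓘(ℝ, E)) 𝓘(ℝ, ℝ) ∞ (Function.uncurry K) (Set.univ ×ˢ O)) :
    ContMDiffOn (IG.prod 𝓘(ℝ, E)) 𝓘(ℝ, E →L[ℝ] ℝ) ∞
      (fun q : G × E => fderiv ℝ (K q.1) q.2) (Set.univ ×ˢ O) := by
  intro q hq
  have hKq : ContMDiffAt (IG.prod 𝓘(ℝ, E)) 𝓘(ℝ, ℝ) ∞ (Function.uncurry K) q :=
    (hK q hq).contMDiffAt ((isOpen_univ.prod hO).mem_nhds hq)
  have h1 : ContMDiffAt ((IG.prod 𝓘(ℝ, E)).prod 𝓘(ℝ, E)) 𝓘(ℝ, ℝ) ∞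
      (Function.uncurry fun (r : G × E) (z : E) => K r.1 z) (q, q.2) :=
    ContMDiffAt.comp (f := fun r : (G × E) × E => (r.1.1, r.2)) (q, q.2) hKq
      (((contMDiff_fst.comp contMDiff_fst).prodMk contMDiff_snd).contMDiffAt)
  have h2 := ContMDiffAt.mfderiv (m := ∞) (fun (r : G × E) (z : E) => K r.1 z) Prod.snd h1
    contMDiffAt_snd (by norm_cast)
  have h3 : ContMDiffAt (IG.prod 𝓘(ℝ, E)) 𝓘(ℝ, E →L[ℝ] ℝ) ∞
      (fun q : G × E => fderiv ℝ (K q.1) q.2) q := by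
    refine h2.congr_of_eventuallyEq (Filter.Eventually.of_forall fun r => ?_)
    have h := congrFun (inTangentCoordinates_model_space (I := 𝓘(ℝ, E)) (I' := 𝓘(ℝ, ℝ)) Prod.snd
      (fun x : G × E => K x.1 x.2)
      (fun x => (mfderiv 𝓘(ℝ, E) 𝓘(ℝ, ℝ) (K x.1) x.2 : E →L[ℝ] ℝ)) q) r
    exact mfderiv_eq_fderiv.symm.trans h.symm
  exact h3.contMDiffWithinAt

/-- On the product of the compact `G` with a compact neighbourhood of `z` the derivative is bounded
by a constant, which is integrable for a finite measure and serves as the dominating function. -/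
theorem hasFDerivAt_integral_of_contMDiffOn (hO : IsOpen O)
    (hK : ContMDiffOn (IG.prod 𝓘(ℝ, E)) 𝓘(ℝ, ℝ) ∞ (Function.uncurry K) (Set.univ ×ˢ O))
    {z : E} (hz : z ∈ O) :
    Integrable (fun a => fderiv ℝ (K a) z) μ ∧
    HasFDerivAt (fun z => ∫ a, K a z ∂μ) (∫ a, fderiv ℝ (K a) z ∂μ) z := by
  have hKc : ∀ z ∈ O, Continuous fun a => K a z := fun z hz =>
    hK.continuousOn.comp_continuous (f := fun a => (a, z)) (by fun_prop) fun a => ⟨trivial, hz⟩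
  have hD := (contMDiffOn_fderiv_snd hO hK).continuousOn
  have hDc : ∀ z ∈ O, Continuous fun a => fderiv ℝ (K a) z := fun z hz =>
    hD.comp_continuous (f := fun a => (a, z)) (by fun_prop) fun a => ⟨trivial, hz⟩
  obtain ⟨S, hS, hSO, hSc⟩ := LocallyCompactSpace.local_compact_nhds z O (hO.mem_nhds hz)
  obtain ⟨C, hC⟩ := (isCompact_univ.prod hSc).exists_bound_of_continuousOn
    (hD.mono (Set.prod_mono_right hSO))
  have hdiff : ∀ a, ∀ w ∈ O, HasFDerivAt (K a) (fderiv ℝ (K a) w) w := fun a w hw => by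
    have h1 : ContMDiffAt (IG.prod 𝓘(ℝ, E)) 𝓘(ℝ, ℝ) ∞ (Function.uncurry K) (a, w) :=
      (hK (a, w) ⟨trivial, hw⟩).contMDiffAt ((isOpen_univ.prod hO).mem_nhds ⟨trivial, hw⟩)
    have h2 : ContMDiffAt 𝓘(ℝ, E) 𝓘(ℝ, ℝ) ∞ (K a) w :=
      ContMDiffAt.comp (f := fun w : E => (a, w)) w h1
        (contMDiff_const.prodMk contMDiff_id).contMDiffAt
    exact ((contMDiffAt_iff_contDiffAt.1 h2).differentiableAt (by simp)).hasFDerivAt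
  refine ⟨Integrable.of_bound (hDc z hz).aestronglyMeasurable C
      (Filter.Eventually.of_forall fun a => hC (a, z) ⟨trivial, mem_of_mem_nhds hS⟩), ?_⟩
  refine hasFDerivAt_integral_of_dominated_of_fderiv_le (F := fun z a => K a z)
    (F' := fun z a => fderiv ℝ (K a) z) (bound := fun _ => C) hS ?_ ?_
    (hDc z hz).aestronglyMeasurable
    (Filter.Eventually.of_forall fun a w hw => hC (a, w) ⟨trivial, hw⟩) (integrable_const C)
    (Filter.Eventually.of_forall fun a w hw => hdiff a w (hSO hw))
  · filter_upwards [hO.mem_nhds hz] with w hw using (hKc w hw).aestronglyMeasurable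
  · obtain ⟨C', hC'⟩ := isCompact_univ.exists_bound_of_continuousOn (hKc z hz).continuousOn
    exact Integrable.of_bound (hKc z hz).aestronglyMeasurable C'
      (Filter.Eventually.of_forall fun a => hC' a trivial)

theorem contDiffOn_integral_of_contMDiffOn (hO : IsOpen O)
    (hK : ContMDiffOn (IG.prod 𝓘(ℝ, E)) 𝓘(ℝ, ℝ) ∞ (Function.uncurry K) (Set.univ ×ˢ O)) :
    ContDiffOn ℝ ∞ (fun z => ∫ a, K a z ∂μ) O := by
  refine contDiffOn_infty.2 fun n => ?_
  -- Generalizing `K` allows the induction hypothesis to be applied to a directional derivative of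
  -- `K`, which is again scalar valued.
  induction n generalizing K with
  | zero =>
    exact contDiffOn_zero.2 fun z hz =>
      (hasFDerivAt_integral_of_contMDiffOn hO hK hz).2.continuousAt.continuousWithinAt
  | succ n ih =>
    push_cast
    refine contDiffOn_succ_of_fderiv_apply (fun z hz =>
      (hasFDerivAt_integral_of_contMDiffOn (μ := μ) hO hK
        hz).2.differentiableAt.differentiableWithinAt) (fun h => by simp at h) fun y => ?_
    have h1 : ContMDiffOn (IG.prod 𝓘(ℝ, E)) 𝓘(ℝ, ℝ) ∞
        (Function.uncurry fun a z => fderiv ℝ (K a) z y) (Set.univ ×ˢ O) :=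
      (contMDiffOn_fderiv_snd hO hK).clm_apply contMDiffOn_const
    refine (ih h1).congr fun z hz => ?_
    obtain ⟨h2, h3⟩ := hasFDerivAt_integral_of_contMDiffOn (μ := μ) hO hK hz
    rw [fderivWithin_of_isOpen hO hz, h3.fderiv, ContinuousLinearMap.integral_apply h2]

end ParametricIntegral

/-! ### Averages over a compact group of isometries -/

section Action

variable {G : Type*} [Group G] [TopologicalSpace G] [CompactSpace G]
  {EY : Type*} [NormedAddCommGroup EY] [NormedSpace ℝ EY] [FiniteDimensional ℝ EY]
  {Y : Type*} [TopologicalSpace Y] [ChartedSpace EY Y] [IsManifold 𝓘(ℝ, EY) ∞ Y]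
  [MulAction G Y]

theorem contMDiff_smul_left (EG : Type*) [NormedAddCommGroup EG] [NormedSpace ℝ EG]
    [ChartedSpace EG G] [LieGroup 𝓘(ℝ, EG) ∞ G] [ContMDiffSMul 𝓘(ℝ, EG) 𝓘(ℝ, EY) ∞ G Y]
    (a : G) : ContMDiff 𝓘(ℝ, EY) 𝓘(ℝ, EY) ∞ (fun y : Y => a • y) :=
  (contMDiff_smul (I := 𝓘(ℝ, EG)) (I' := 𝓘(ℝ, EY)) (n := ∞) (G := G) (M := Y)).comp
    (f := fun y : Y => (a, y)) (contMDiff_const.prodMk contMDiff_id)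

/-- At the centre of its own chart the manifold derivative is by definition that of the coordinate
expression; this moves the differentiation under the integral to a vector space. -/
theorem differential_eq_fderiv_chartParam {k : Y → ℝ} {y : Y}
    (hk : MDifferentiableAt 𝓘(ℝ, EY) 𝓘(ℝ, ℝ) k y) :
    (differential 𝓘(ℝ, EY) k y : EY →L[ℝ] ℝ) =
      fderiv ℝ (k ∘ chartParam 𝓘(ℝ, EY) y) ((chartParam 𝓘(ℝ, EY) y).symm y) := by
  refine hk.mfderiv.trans ?_
  rw [modelWithCornersSelf_coe, Set.range_id, fderivWithin_univ]
  rfl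

variable [SecondCountableTopology G] [MeasurableSpace G] [BorelSpace G] {μ : Measure G}
  [IsFiniteMeasure μ]

theorem contMDiffOn_smul_chartParam (EG : Type*) [NormedAddCommGroup EG] [NormedSpace ℝ EG]
    [ChartedSpace EG G] [LieGroup 𝓘(ℝ, EG) ∞ G] [ContMDiffSMul 𝓘(ℝ, EG) 𝓘(ℝ, EY) ∞ G Y]
    {h : Y → ℝ} (hh : ContMDiff 𝓘(ℝ, EY) 𝓘(ℝ, ℝ) ∞ h) (y₀ : Y) :
    ContMDiffOn (𝓘(ℝ, EG).prod 𝓘(ℝ, EY)) 𝓘(ℝ, ℝ) ∞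
      (Function.uncurry fun (a : G) z => h (a⁻¹ • chartParam 𝓘(ℝ, EY) y₀ z))
      (Set.univ ×ˢ (chartParam 𝓘(ℝ, EY) y₀).source) := by
  have hs := contMDiff_smul (I := 𝓘(ℝ, EG)) (I' := 𝓘(ℝ, EY)) (n := ∞) (G := G) (M := Y)
  have hc : ContMDiffOn 𝓘(ℝ, EY) 𝓘(ℝ, EY) ∞ (chartParam 𝓘(ℝ, EY) y₀)
      (chartParam 𝓘(ℝ, EY) y₀).source := contMDiffOn_extChartAt_symm y₀
  have h1 : ContMDiffOn (𝓘(ℝ, EG).prod 𝓘(ℝ, EY)) (𝓘(ℝ, EG).prod 𝓘(ℝ, EY)) ∞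
      (fun q : G × EY => (q.1⁻¹, chartParam 𝓘(ℝ, EY) y₀ q.2))
      (Set.univ ×ˢ (chartParam 𝓘(ℝ, EY) y₀).source) :=
    (((contMDiff_inv 𝓘(ℝ, EG) ∞).comp contMDiff_fst).contMDiffOn).prodMk
      (hc.comp contMDiffOn_snd fun q hq => hq.2)
  exact (hh.comp hs).comp_contMDiffOn h1

theorem contMDiff_average (EG : Type*) [NormedAddCommGroup EG] [NormedSpace ℝ EG]
    [ChartedSpace EG G] [LieGroup 𝓘(ℝ, EG) ∞ G] [ContMDiffSMul 𝓘(ℝ, EG) 𝓘(ℝ, EY) ∞ G Y]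
    {h : Y → ℝ} (hh : ContMDiff 𝓘(ℝ, EY) 𝓘(ℝ, ℝ) ∞ h) :
    ContMDiff 𝓘(ℝ, EY) 𝓘(ℝ, ℝ) ∞ fun y => ∫ a : G, h (a⁻¹ • y) ∂μ := by
  intro y₀
  let e := chartParam 𝓘(ℝ, EY) y₀
  have hy₀ : y₀ ∈ e.target := mem_chartParam_target y₀
  have h1 := contDiffOn_integral_of_contMDiffOn (μ := μ) e.open_source
    (contMDiffOn_smul_chartParam EG hh y₀)
  have h2 : ContMDiffAt 𝓘(ℝ, EY) 𝓘(ℝ, ℝ) ∞ (fun z => ∫ a : G, h (a⁻¹ • e z) ∂μ) (e.symm y₀) :=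
    (h1.contDiffAt (e.open_source.mem_nhds (e.map_target hy₀))).contMDiffAt
  have h3 : ContMDiffAt 𝓘(ℝ, EY) 𝓘(ℝ, EY) ∞ e.symm y₀ := contMDiffAt_extChartAt
  refine (h2.comp y₀ h3).congr_of_eventuallyEq ?_
  filter_upwards [e.open_target.mem_nhds hy₀] with y hy
  simp only [Function.comp_apply, e.right_inv hy]

theorem differential_average (EG : Type*) [NormedAddCommGroup EG] [NormedSpace ℝ EG]
    [ChartedSpace EG G] [LieGroup 𝓘(ℝ, EG) ∞ G] [ContMDiffSMul 𝓘(ℝ, EG) 𝓘(ℝ, EY) ∞ G Y]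
    {h : Y → ℝ} (hh : ContMDiff 𝓘(ℝ, EY) 𝓘(ℝ, ℝ) ∞ h) (y : Y)
    (v : TangentSpace 𝓘(ℝ, EY) y) :
    differential 𝓘(ℝ, EY) (fun y => ∫ a : G, h (a⁻¹ • y) ∂μ) y v =
      ∫ a : G, differential 𝓘(ℝ, EY) (fun y => h (a⁻¹ • y)) y v ∂μ := by
  let e := chartParam 𝓘(ℝ, EY) y
  have hy : y ∈ e.target := mem_chartParam_target y
  obtain ⟨h1, h2⟩ := hasFDerivAt_integral_of_contMDiffOn (μ := μ) e.open_source
    (contMDiffOn_smul_chartParam EG hh y) (e.map_target hy)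
  have h3 : differential 𝓘(ℝ, EY) (fun y => ∫ a : G, h (a⁻¹ • y) ∂μ) y =
      ∫ a : G, fderiv ℝ (fun z => h (a⁻¹ • e z)) (e.symm y) ∂μ :=
    (differential_eq_fderiv_chartParam
      ((contMDiff_average EG hh).mdifferentiable (by simp) y)).trans h2.fderiv
  have h4 (a : G) : differential 𝓘(ℝ, EY) (fun y => h (a⁻¹ • y)) y =
      fderiv ℝ (fun z => h (a⁻¹ • e z)) (e.symm y) :=
    differential_eq_fderiv_chartParam
      ((hh.comp (contMDiff_smul_left EG a⁻¹)).mdifferentiable (by simp) y)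
  simp_rw [h3, h4]
  exact ContinuousLinearMap.integral_apply h1 v

end Action

section Averaging

variable {G : Type*} [Group G] [TopologicalSpace G] [CompactSpace G]
  {EY : Type*} [NormedAddCommGroup EY] [NormedSpace ℝ EY] [FiniteDimensional ℝ EY]
  {Y : Type*} [TopologicalSpace Y] [CompactSpace Y] [ChartedSpace EY Y] [IsManifold 𝓘(ℝ, EY) ∞ Y]
  [SecondCountableTopology Y] [MeasurableSpace Y] [BorelSpace Y]
  [MulAction G Y]
  {g : Bundle.ContMDiffRiemannianMetric 𝓘(ℝ, EY) ∞ EY (fun y : Y => TangentSpace 𝓘(ℝ, EY) y)}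

theorem mdifferentiable_smul (EG : Type*) [NormedAddCommGroup EG] [NormedSpace ℝ EG]
    [ChartedSpace EG G] [LieGroup 𝓘(ℝ, EG) ∞ G] [ContinuousSMul G Y]
    [ContMDiffSMul 𝓘(ℝ, EG) 𝓘(ℝ, EY) ∞ G Y] (a : G) :
    ((Homeomorph.smul a).toOpenPartialHomeomorph : OpenPartialHomeomorph Y Y).MDifferentiable
      𝓘(ℝ, EY) 𝓘(ℝ, EY) :=
  ⟨((contMDiff_smul_left EG a).mdifferentiable (by simp)).mdifferentiableOn,
    ((contMDiff_smul_left EG a⁻¹).mdifferentiable (by simp)).mdifferentiableOn⟩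

theorem measurePreserving_smul (EG : Type*) [NormedAddCommGroup EG] [NormedSpace ℝ EG]
    [ChartedSpace EG G] [LieGroup 𝓘(ℝ, EG) ∞ G] [ContinuousSMul G Y]
    [ContMDiffSMul 𝓘(ℝ, EG) 𝓘(ℝ, EY) ∞ G Y] {a : G}
    (ha : pullbackMetric 𝓘(ℝ, EY) (fun y : Y => a • y) g.inner = g.inner) :
    MeasurePreserving (fun y : Y => a • y) (riemannianVolume g.inner)
      (riemannianVolume g.inner) := by
  let F : OpenPartialHomeomorph Y Y := (Homeomorph.smul a).toOpenPartialHomeomorph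
  have hF : F.MDifferentiable 𝓘(ℝ, EY) 𝓘(ℝ, EY) := mdifferentiable_smul EG a
  have h := map_riemannianVolume_restrict hF (g := g.inner) (g' := g.inner)
    fun y _ => congrFun ha y
  refine ⟨(continuous_const_smul a).measurable, ?_⟩
  have hs : F.source = Set.univ := rfl
  have ht : F.target = Set.univ := rfl
  rw [hs, ht, Measure.restrict_univ] at h
  exact h

theorem innerDifferential_smul (EG : Type*) [NormedAddCommGroup EG] [NormedSpace ℝ EG]
    [ChartedSpace EG G] [LieGroup 𝓘(ℝ, EG) ∞ G] [ContinuousSMul G Y]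
    [ContMDiffSMul 𝓘(ℝ, EG) 𝓘(ℝ, EY) ∞ G Y] {a : G}
    (ha : pullbackMetric 𝓘(ℝ, EY) (fun y : Y => a • y) g.inner = g.inner)
    {f h : Y → ℝ} (hf : ContMDiff 𝓘(ℝ, EY) 𝓘(ℝ, ℝ) ∞ f) (hh : ContMDiff 𝓘(ℝ, EY) 𝓘(ℝ, ℝ) ∞ h)
    (y : Y) :
    innerDifferential g.inner (fun y => f (a • y)) (fun y => h (a • y)) y =
      innerDifferential g.inner f h (a • y) := by
  let F : OpenPartialHomeomorph Y Y := (Homeomorph.smul a).toOpenPartialHomeomorph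
  have hF : F.MDifferentiable 𝓘(ℝ, EY) 𝓘(ℝ, EY) := mdifferentiable_smul EG a
  refine innerDifferential_comp (F := fun y : Y => a • y) (hF.mdifferentiableAt trivial)
    (hf.mdifferentiable (by simp) _) (hh.mdifferentiable (by simp) _) (g.pos _) (g.pos _)
    fun v => ?_
  obtain ⟨w, rfl⟩ := hF.mfderiv_surjective (x := y) trivial v
  exact ⟨w, rfl, fun w' => by rw [← congrFun ha y]; rfl⟩

variable [SecondCountableTopology G] [MeasurableSpace G] [BorelSpace G] {μ : Measure G}
  [IsProbabilityMeasure μ]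

/-- By Fubini the integral over `Y` is taken first; each translation preserves the Riemannian
measure, and `μ` has mass one. Invariance of `μ` is not needed here. -/
theorem integral_average (EG : Type*) [NormedAddCommGroup EG] [NormedSpace ℝ EG]
    [ChartedSpace EG G] [LieGroup 𝓘(ℝ, EG) ∞ G] [ContinuousSMul G Y]
    [ContMDiffSMul 𝓘(ℝ, EG) 𝓘(ℝ, EY) ∞ G Y]
    (hG : ∀ a : G, pullbackMetric 𝓘(ℝ, EY) (fun y : Y => a • y) g.inner = g.inner)
    {w : Y → ℝ} (hw : Continuous w) :
    ∫ y, ∫ a : G, w (a⁻¹ • y) ∂μ ∂(riemannianVolume g.inner) =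
      ∫ y, w y ∂(riemannianVolume g.inner) := by
  have := topologicalGroup_of_lieGroup 𝓘(ℝ, EG) ∞ (G := G)
  have hc : Continuous (Function.uncurry fun (y : Y) (a : G) => w (a⁻¹ • y)) :=
    hw.comp (continuous_snd.inv.smul continuous_fst)
  rw [integral_integral_swap
    (hc.integrable_of_hasCompactSupport (HasCompactSupport.of_compactSpace _))]
  have h (a : G) : ∫ y, w (a⁻¹ • y) ∂(riemannianVolume g.inner) =
      ∫ y, w y ∂(riemannianVolume g.inner) := by
    have hm := measurePreserving_smul EG (hG a⁻¹)
    have h1 := integral_map (μ := riemannianVolume g.inner) hm.measurable.aemeasurable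
      (f := w) hw.aestronglyMeasurable
    rw [hm.map_eq] at h1
    exact h1.symm
  simp [h]

/-- If the weak equation `Δ f = u`, for invariant functions `f` and `u`, holds when tested against
invariant functions, then it holds when tested against all smooth functions. -/
theorem laplaceRel_top_of_invariant (EG : Type*) [NormedAddCommGroup EG] [NormedSpace ℝ EG]
    [ChartedSpace EG G] [LieGroup 𝓘(ℝ, EG) ∞ G] [ContinuousSMul G Y]
    [ContMDiffSMul 𝓘(ℝ, EG) 𝓘(ℝ, EY) ∞ G Y] [μ.IsMulLeftInvariant]
    (hG : ∀ a : G, pullbackMetric 𝓘(ℝ, EY) (fun y : Y => a • y) g.inner = g.inner)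
    {f u : C^∞⟮𝓘(ℝ, EY), Y; ℝ⟯}
    (h : LaplaceRel g.inner (invariantFunctions 𝓘(ℝ, EY) G Y)
      (invariantFunctions 𝓘(ℝ, EY) G Y) f u) :
    LaplaceRel g.inner (invariantFunctions 𝓘(ℝ, EY) G Y) ⊤ f u := by
  obtain ⟨hf, hu, H⟩ := h
  refine ⟨hf, hu, fun k _ => ?_⟩
  have := topologicalGroup_of_lieGroup 𝓘(ℝ, EG) ∞ (G := G)
  -- Because of the inverse in `a⁻¹ • y`, left invariance of `μ` is what makes the average
  -- invariant.
  let K : C^∞⟮𝓘(ℝ, EY), Y; ℝ⟯ :=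
    ⟨fun y => ∫ a : G, k (a⁻¹ • y) ∂μ, contMDiff_average EG k.contMDiff⟩
  have hK : K ∈ invariantFunctions 𝓘(ℝ, EY) G Y := by
    intro c y
    change ∫ a : G, k (a⁻¹ • c • y) ∂μ = ∫ a : G, k (a⁻¹ • y) ∂μ
    rw [← integral_mul_left_eq_self (μ := μ) (fun a : G => k (a⁻¹ • y)) c⁻¹]
    simp [mul_smul]
  have h1 := H K hK
  have e1 : ∫ y, u y * K y ∂(riemannianVolume g.inner) =
      ∫ y, u y * k y ∂(riemannianVolume g.inner) := by
    rw [← integral_average (μ := μ) EG hG (w := fun y => u y * k y)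
      (u.contMDiff.continuous.mul k.contMDiff.continuous)]
    congr 1
    ext y
    change u y * ∫ a : G, k (a⁻¹ • y) ∂μ = _
    rw [← integral_const_mul]
    congr 1
    ext a
    rw [hu a⁻¹ y]
  have e2 : ∫ y, innerDifferential g.inner f K y ∂(riemannianVolume g.inner) =
      ∫ y, innerDifferential g.inner f k y ∂(riemannianVolume g.inner) := by
    rw [← integral_average (μ := μ) EG hG
      (continuous_innerDifferential g f.contMDiff k.contMDiff)]
    congr 1
    ext y
    -- With `v` the gradient of `f` at `y`, the number `dK v` is the average of `d(k ∘ a⁻¹) v = ⟨df,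
    -- d(k ∘ a⁻¹)⟩`; writing `f` as `f ∘ a⁻¹` turns this into `⟨df, dk⟩` at `a⁻¹ • y`.
    obtain ⟨v, hv⟩ := exists_gradient f (g.pos y)
    rw [innerDifferential_eq_apply (g.pos y) hv]
    refine (differential_average EG k.contMDiff y v).trans ?_
    congr 1
    ext a
    rw [← innerDifferential_smul EG (hG a⁻¹) f.contMDiff k.contMDiff]
    have hfa : (fun y => f (a⁻¹ • y)) = f := funext fun y => hf a⁻¹ y
    rw [hfa, innerDifferential_eq_apply (g.pos y) hv]
  rw [← e1, ← e2, h1]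

end Averaging

theorem laplaceRel_invariant_iff {G : Type*} [Group G] [TopologicalSpace G] [CompactSpace G]
    {EY : Type*} [NormedAddCommGroup EY] [NormedSpace ℝ EY] [FiniteDimensional ℝ EY]
    {Y : Type*} [TopologicalSpace Y] [CompactSpace Y] [ChartedSpace EY Y]
    [IsManifold 𝓘(ℝ, EY) ∞ Y] [SecondCountableTopology Y] [MeasurableSpace Y] [BorelSpace Y]
    [MulAction G Y]
    {g : Bundle.ContMDiffRiemannianMetric 𝓘(ℝ, EY) ∞ EY (fun y : Y => TangentSpace 𝓘(ℝ, EY) y)}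
    (EG : Type*) [NormedAddCommGroup EG] [NormedSpace ℝ EG]
    [FiniteDimensional ℝ EG] [ChartedSpace EG G] [LieGroup 𝓘(ℝ, EG) ∞ G] [T2Space G]
    [ContinuousSMul G Y] [ContMDiffSMul 𝓘(ℝ, EG) 𝓘(ℝ, EY) ∞ G Y]
    (hG : ∀ a : G, pullbackMetric 𝓘(ℝ, EY) (fun y : Y => a • y) g.inner = g.inner)
    (f u : C^∞⟮𝓘(ℝ, EY), Y; ℝ⟯) :
    InvariantLaplacian G g.inner f u ↔
      LaplaceRel g.inner (invariantFunctions 𝓘(ℝ, EY) G Y)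
      (invariantFunctions 𝓘(ℝ, EY) G Y) f u := by
  refine ⟨fun h => ⟨h.1, h.2.1, fun k _ => h.2.2 k trivial⟩, fun h => ?_⟩
  have := topologicalGroup_of_lieGroup 𝓘(ℝ, EG) ∞ (G := G)
  have := ChartedSpace.secondCountable_of_sigmaCompact EG G
  let : MeasurableSpace G := borel G
  have : BorelSpace G := ⟨rfl⟩
  -- Taking the whole compact group as the reference set normalizes Haar measure to mass one.
  let K₀ : TopologicalSpace.PositiveCompacts G := ⊤
  have : IsProbabilityMeasure (Measure.haarMeasure K₀) := ⟨Measure.haarMeasure_self⟩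
  exact laplaceRel_top_of_invariant (μ := Measure.haarMeasure K₀) EG hG h

/-! ### The smooth structure of the suspension -/

section LocalHomeomorph

/-- Two lifts through a local homeomorphism that agree at a point agree near that point. -/
theorem eventuallyEq_of_comp_eventuallyEq {A B Z : Type*} [TopologicalSpace A]
    [TopologicalSpace B] [TopologicalSpace Z] {f : A → B} (hf : IsLocalHomeomorph f)
    {ρ₁ ρ₂ : Z → A} {z : Z} (h₁ : ContinuousAt ρ₁ z) (h₂ : ContinuousAt ρ₂ z)
    (hz : ρ₁ z = ρ₂ z) (h : ∀ᶠ w in 𝓝 z, f (ρ₁ w) = f (ρ₂ w)) : ρ₁ =ᶠ[𝓝 z] ρ₂ := by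
  have hU : (hf.localInverseAt (ρ₁ z)).target ∈ 𝓝 (ρ₁ z) :=
    (hf.localInverseAt (ρ₁ z)).open_target.mem_nhds hf.self_mem_localInverseAt_target
  have h₂' : ∀ᶠ w in 𝓝 z, ρ₂ w ∈ (hf.localInverseAt (ρ₁ z)).target := h₂ (by rwa [← hz])
  filter_upwards [h, h₁ hU, h₂'] with w hw hw₁ hw₂
  exact hf.injOn_localInverseAt_target hw₁ hw₂ hw

end LocalHomeomorph

section Deck

variable {E : Type*} [NormedAddCommGroup E] [NormedSpace ℝ E]
  {Xt X : Type*} [TopologicalSpace Xt] [ChartedSpace E Xt] [TopologicalSpace X] [ChartedSpace E X]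
  {p : Xt → X}

/-- Deck transformations are given only as homeomorphisms. Since `p ∘ d = p`, near `x` such a `d` is
`p` followed by the smooth local inverse of `p` at `d • x`. -/
theorem IsUniversalCover.contMDiff_deck (hp : IsUniversalCover E p) (d : deckGroup p) :
    ContMDiff 𝓘(ℝ, E) 𝓘(ℝ, E) ∞ (fun x : Xt => d • x) := by
  intro x
  have hd : Continuous fun x : Xt => d • x := d.1.continuous
  have h := hp.isLocalDiffeomorph (d • x)
  have hpd (y : Xt) : p (d • y) = p y := d.2 y
  have hp' : ContMDiffAt 𝓘(ℝ, E) 𝓘(ℝ, E) ∞ p x := hp.isLocalDiffeomorph.contMDiff x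
  have h1 : ContMDiffAt 𝓘(ℝ, E) 𝓘(ℝ, E) ∞ (h.localInverse ∘ p) x :=
    ContMDiffAt.comp x ((hpd x) ▸ h.localInverse_contMDiffAt) hp'
  refine h1.congr_of_eventuallyEq ?_
  have hU : h.localInverse.target ∈ 𝓝 (d • x) :=
    h.localInverse.open_target.mem_nhds h.localInverse_mem_target
  filter_upwards [hd.continuousAt hU] with y hy
  rw [Function.comp_apply, ← hpd y]
  exact (h.localInverse_left_inv hy).symm

end Deck

namespace Suspension

variable {EX : Type*} [NormedAddCommGroup EX] [NormedSpace ℝ EX]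
  {Xt X : Type*} [TopologicalSpace Xt] [ChartedSpace EX Xt] [TopologicalSpace X] [ChartedSpace EX X]
  {p : Xt → X} (hp : IsUniversalCover EX p) (x₀ : Xt)
  {Y : Type*} {Γ : Type*} [Group Γ] [MulAction Γ Y] (φ : FundamentalGroup X (p x₀) →* Γ)

/-- The transformation of `Xt × Y` given by an element of the fundamental group. -/
noncomputable def act (γ : FundamentalGroup X (p x₀)) : Xt × Y → Xt × Y :=
  Prod.map (fun x => (hp.deckOfLoop x₀ γ⁻¹).unop • x) (fun y => φ γ • y)

theorem proj_act (γ : FundamentalGroup X (p x₀)) (a : Xt × Y) :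
    proj hp x₀ φ (act hp x₀ φ γ a) = proj hp x₀ φ a :=
  (proj_eq_iff hp x₀ φ).2 ⟨γ, rfl⟩

theorem exists_act_eq {a b : Xt × Y} (h : proj hp x₀ φ a = proj hp x₀ φ b) :
    ∃ γ, act hp x₀ φ γ b = a :=
  (proj_eq_iff hp x₀ φ).1 h

/-- Deck transformations are transitive on fibres and all come from loops, so the first coordinate
can be moved anywhere in its fibre at the cost of acting on `y`. -/
theorem exists_act_fst_eq {x x' : Xt} (h : p x = p x') :
    ∃ γ : FundamentalGroup X (p x₀), ∀ y : Y, act hp x₀ φ γ (x, y) = (x', φ γ • y) := by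
  have := hp.simplyConnected
  obtain ⟨d, rfl⟩ := hp.exists_deck h
  obtain ⟨γ, hγ⟩ := hp.isQuotientCoveringMap.fundamentalGroupToMulOpposite_surjective ⟨x₀, rfl⟩
    (MulOpposite.op d)
  refine ⟨γ⁻¹, fun y => ?_⟩
  have h1 : hp.deckOfLoop x₀ γ = MulOpposite.op d := hγ
  simp [act, h1]

variable [TopologicalSpace Y] [ContinuousConstSMul Γ Y]

theorem continuous_proj : Continuous (proj (Y := Y) hp x₀ φ) :=
  (proj_isLocalHomeomorph hp x₀ φ).continuous

variable {EY : Type*} [NormedAddCommGroup EY] [NormedSpace ℝ EY] [ChartedSpace EY Y]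

theorem contMDiff_act (hΓ : ∀ c : Γ, ContMDiff 𝓘(ℝ, EY) 𝓘(ℝ, EY) ∞ fun y : Y => c • y)
    (γ : FundamentalGroup X (p x₀)) :
    ContMDiff (𝓘(ℝ, EX).prod 𝓘(ℝ, EY)) (𝓘(ℝ, EX).prod 𝓘(ℝ, EY)) ∞ (act (Y := Y) hp x₀ φ γ) :=
  (hp.contMDiff_deck _).prodMap (hΓ _)

/-- The point of `Xt × Y` around which the chart of the suspension at `s` is constructed. -/
noncomputable def basePoint (s : Suspension (Y := Y) hp x₀ φ) : Xt × Y :=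
  (proj_surjective hp x₀ φ).hasRightInverse.choose s

theorem proj_basePoint (s : Suspension (Y := Y) hp x₀ φ) :
    proj hp x₀ φ (basePoint hp x₀ φ s) = s :=
  (proj_surjective hp x₀ φ).hasRightInverse.choose_spec s

/-- The local inverse of `σ` that is used for the chart at `s`. -/
noncomputable def localSection (s : Suspension (Y := Y) hp x₀ φ) :
    OpenPartialHomeomorph (Suspension (Y := Y) hp x₀ φ) (Xt × Y) :=
  (proj_isLocalHomeomorph hp x₀ φ).localInverseAt (basePoint hp x₀ φ s)

theorem mem_localSection_source (s : Suspension (Y := Y) hp x₀ φ) :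
    s ∈ (localSection hp x₀ φ s).source := by
  have h := (proj_isLocalHomeomorph (Y := Y) hp x₀ φ).apply_self_mem_localInverseAt_source
    (x := basePoint hp x₀ φ s)
  rw [proj_basePoint] at h
  exact h

theorem localSection_symm (s : Suspension (Y := Y) hp x₀ φ) :
    ⇑(localSection hp x₀ φ s).symm = proj hp x₀ φ :=
  (proj_isLocalHomeomorph (Y := Y) hp x₀ φ).localInverseAt_symm _

theorem proj_localSection {s t : Suspension (Y := Y) hp x₀ φ}
    (ht : t ∈ (localSection hp x₀ φ s).source) :
    proj hp x₀ φ (localSection hp x₀ φ s t) = t := by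
  rw [← localSection_symm hp x₀ φ s]
  exact (localSection hp x₀ φ s).left_inv ht

theorem chartAt_eq (s : Suspension (Y := Y) hp x₀ φ) :
    chartAt (ModelProd EX EY) s = (localSection hp x₀ φ s).trans
      (chartAt (ModelProd EX EY) (basePoint hp x₀ φ s)) := rfl

/-- Both maps lift `σ` through itself and, for a suitable `γ`, agree at `b`, hence near `b`. The
transition functions of the suspension are therefore `act γ` read in charts of `Xt × Y`, which makes
them smooth. -/
theorem localSection_comp_proj_eventuallyEq {s : Suspension (Y := Y) hp x₀ φ} {b : Xt × Y}
    (hb : proj hp x₀ φ b ∈ (localSection hp x₀ φ s).source) :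
    ∃ γ, localSection hp x₀ φ s ∘ proj hp x₀ φ =ᶠ[𝓝 b] act hp x₀ φ γ := by
  have hq := hp.isQuotientCoveringMap.toContinuousConstSMul
  obtain ⟨γ, hγ⟩ := exists_act_eq hp x₀ φ (proj_localSection hp x₀ φ hb)
  have hact : Continuous (act (Y := Y) hp x₀ φ γ) :=
    (continuous_const_smul _).prodMap (continuous_const_smul _)
  have hσ := continuous_proj (Y := Y) hp x₀ φ
  refine ⟨γ, eventuallyEq_of_comp_eventuallyEq (proj_isLocalHomeomorph hp x₀ φ) ?_
    hact.continuousAt hγ.symm ?_⟩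
  · exact ContinuousAt.comp ((localSection hp x₀ φ s).continuousAt hb) hσ.continuousAt
  · filter_upwards [hσ.continuousAt ((localSection hp x₀ φ s).open_source.mem_nhds hb)] with w hw
    rw [proj_act]
    exact proj_localSection hp x₀ φ hw

variable [IsManifold 𝓘(ℝ, EX) ∞ Xt] [IsManifold 𝓘(ℝ, EY) ∞ Y]

theorem isManifold (hΓ : ∀ c : Γ, ContMDiff 𝓘(ℝ, EY) 𝓘(ℝ, EY) ∞ fun y : Y => c • y) :
    IsManifold (𝓘(ℝ, EX).prod 𝓘(ℝ, EY)) ∞ (Suspension (Y := Y) hp x₀ φ) := by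
  refine isManifold_of_contDiffOn _ _ _ ?_
  rintro _ _ ⟨s, rfl⟩ ⟨t, rfl⟩ z ⟨hz, hzr⟩
  set I := 𝓘(ℝ, EX).prod 𝓘(ℝ, EY)
  set a := basePoint hp x₀ φ s
  set a' := basePoint hp x₀ φ t
  have hz' : I.symm z ∈ ((chartAt (ModelProd EX EY) s).symm.trans
      (chartAt (ModelProd EX EY) t)).source := hz
  simp only [chartAt_eq, OpenPartialHomeomorph.trans_source, OpenPartialHomeomorph.symm_source,
    OpenPartialHomeomorph.trans_target, Set.mem_inter_iff, Set.mem_preimage] at hz'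
  obtain ⟨⟨hza, -⟩, hzt, hza'⟩ := hz'
  have hzE : z ∈ (extChartAt I a).target := by
    rw [extChartAt_target]
    exact ⟨hza, hzr⟩
  set b : Xt × Y := (extChartAt I a).symm z
  have hσb : ((localSection hp x₀ φ s).trans (chartAt (ModelProd EX EY) a)).symm (I.symm z) =
      proj hp x₀ φ b := by
    rw [← localSection_symm hp x₀ φ s]
    rfl
  rw [hσb] at hzt hza'
  obtain ⟨γ, hγ⟩ := localSection_comp_proj_eventuallyEq hp x₀ φ hzt
  have hb : act hp x₀ φ γ b ∈ (chartAt (ModelProd EX EY) a').source := by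
    rw [← hγ.eq_of_nhds]
    exact hza'
  have hc : ContMDiffAt 𝓘(ℝ, EX × EY) I ∞ (extChartAt I a).symm z :=
    (contMDiffOn_extChartAt_symm a).contMDiffAt ((isOpen_extChartAt_target a).mem_nhds hzE)
  have h1 : ContMDiffAt 𝓘(ℝ, EX × EY) 𝓘(ℝ, EX × EY) ∞
      (extChartAt I a' ∘ act hp x₀ φ γ ∘ (extChartAt I a).symm) z :=
    (contMDiffAt_extChartAt' hb).comp z (((contMDiff_act hp x₀ φ hΓ γ) b).comp z hc)
  refine ContDiffAt.contDiffWithinAt ((contMDiffAt_iff_contDiffAt.1 h1).congr_of_eventuallyEq ?_)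
  filter_upwards [hc.continuousAt hγ] with w hw
  have hw' : (localSection hp x₀ φ t) (proj hp x₀ φ ((extChartAt I a).symm w)) =
      act hp x₀ φ γ ((extChartAt I a).symm w) := hw
  rw [← localSection_symm hp x₀ φ s] at hw'
  exact congrArg (extChartAt I a') hw'

theorem contMDiff_proj (hΓ : ∀ c : Γ, ContMDiff 𝓘(ℝ, EY) 𝓘(ℝ, EY) ∞ fun y : Y => c • y) :
    ContMDiff (𝓘(ℝ, EX).prod 𝓘(ℝ, EY)) (𝓘(ℝ, EX).prod 𝓘(ℝ, EY)) ∞ (proj (Y := Y) hp x₀ φ) := by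
  intro b
  have hs := mem_localSection_source hp x₀ φ (proj hp x₀ φ b)
  refine contMDiffAt_iff_target.2 ⟨(continuous_proj hp x₀ φ).continuousAt, ?_⟩
  obtain ⟨γ, hγ⟩ := localSection_comp_proj_eventuallyEq hp x₀ φ hs
  have hb : act hp x₀ φ γ b ∈
      (chartAt (ModelProd EX EY) (basePoint hp x₀ φ (proj hp x₀ φ b))).source := by
    rw [← hγ.eq_of_nhds]
    have h := mem_chart_source (ModelProd EX EY) (proj hp x₀ φ b)
    rw [chartAt_eq, OpenPartialHomeomorph.trans_source] at h
    exact h.2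
  have h1 := (contMDiffAt_extChartAt' (I := 𝓘(ℝ, EX).prod 𝓘(ℝ, EY)) (n := ∞) hb).comp b
    (contMDiff_act hp x₀ φ hΓ γ b)
  refine h1.congr_of_eventuallyEq ?_
  filter_upwards [hγ] with w hw
  rw [Function.comp_apply, Function.comp_apply, ← hw]
  rfl

/-- Continuous local sections of `σ` are smooth. -/
theorem contMDiffAt_section
    (hΓ : ∀ c : Γ, ContMDiff 𝓘(ℝ, EY) 𝓘(ℝ, EY) ∞ fun y : Y => c • y)
    {s : Suspension (Y := Y) hp x₀ φ} {ρ : Suspension (Y := Y) hp x₀ φ → Xt × Y}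
    (hρ : ContinuousAt ρ s) (h : ∀ᶠ t in 𝓝 s, proj hp x₀ φ (ρ t) = t) :
    ContMDiffAt (𝓘(ℝ, EX).prod 𝓘(ℝ, EY)) (𝓘(ℝ, EX).prod 𝓘(ℝ, EY)) ∞ ρ s := by
  have := isManifold (EX := EX) (EY := EY) hp x₀ φ hΓ
  have hq := hp.isQuotientCoveringMap.toContinuousConstSMul
  have hs := mem_localSection_source hp x₀ φ s
  set I := 𝓘(ℝ, EX).prod 𝓘(ℝ, EY)
  set a := basePoint hp x₀ φ s
  have hsc : s ∈ (chartAt (ModelProd EX EY) s).source := mem_chart_source _ s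
  have hloc : ContMDiffAt I I ∞ (localSection hp x₀ φ s) s := by
    have h1 : ContMDiffAt I 𝓘(ℝ, EX × EY) ∞ (extChartAt I s) s := contMDiffAt_extChartAt
    have h2 : ContMDiffAt 𝓘(ℝ, EX × EY) I ∞ (extChartAt I a).symm (extChartAt I s s) := by
      refine (contMDiffOn_extChartAt_symm a).contMDiffAt
        ((isOpen_extChartAt_target a).mem_nhds ?_)
      rw [chartAt_eq, OpenPartialHomeomorph.trans_source] at hsc
      have h3 := (extChartAt I a).map_source (x := localSection hp x₀ φ s s)
        (by rw [extChartAt_source]; exact hsc.2)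
      exact h3
    refine (h2.comp s h1).congr_of_eventuallyEq ?_
    filter_upwards [(chartAt (ModelProd EX EY) s).open_source.mem_nhds hsc] with t ht
    rw [chartAt_eq, OpenPartialHomeomorph.trans_source] at ht
    exact ((extChartAt I a).left_inv (by rw [extChartAt_source]; exact ht.2)).symm
  obtain ⟨γ, hγ⟩ := exists_act_eq hp x₀ φ (h.self_of_nhds.trans (proj_localSection hp x₀ φ hs).symm)
  have hact := contMDiff_act (EX := EX) (EY := EY) hp x₀ φ hΓ γ
  refine ((hact _).comp s hloc).congr_of_eventuallyEq ?_
  refine eventuallyEq_of_comp_eventuallyEq (proj_isLocalHomeomorph hp x₀ φ) hρ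
    (ContinuousAt.comp hact.continuous.continuousAt hloc.continuousAt) hγ.symm ?_
  filter_upwards [h, (localSection hp x₀ φ s).open_source.mem_nhds hs] with t ht ht'
  rw [ht, Function.comp_apply, proj_act, proj_localSection hp x₀ φ ht']

end Suspension

/-! ### Product metrics, and `σ` as a local isometry -/

theorem prodMetric_pos {E : Type*} [NormedAddCommGroup E] [NormedSpace ℝ E]
    {H : Type*} [TopologicalSpace H] {I : ModelWithCorners ℝ E H}
    {M : Type*} [TopologicalSpace M] [ChartedSpace H M]
    {E' : Type*} [NormedAddCommGroup E'] [NormedSpace ℝ E']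
    {H' : Type*} [TopologicalSpace H'] {J : ModelWithCorners ℝ E' H'}
    {N : Type*} [TopologicalSpace N] [ChartedSpace H' N]
    {g : MetricTensor I M} {g' : MetricTensor J N} {a : M × N}
    (hg : ∀ v : TangentSpace I a.1, v ≠ 0 → 0 < g a.1 v v)
    (hg' : ∀ v : TangentSpace J a.2, v ≠ 0 → 0 < g' a.2 v v)
    (v : TangentSpace (I.prod J) a) (hv : v ≠ 0) : 0 < prodMetric g g' a v v := by
  change 0 < g a.1 (v : E × E').1 (v : E × E').1 + g' a.2 (v : E × E').2 (v : E × E').2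
  have h1 : 0 ≤ g a.1 (v : E × E').1 (v : E × E').1 :=
    apply_self_nonneg_of_pos (E := E) (g a.1) hg _
  have h2 : 0 ≤ g' a.2 (v : E × E').2 (v : E × E').2 :=
    apply_self_nonneg_of_pos (E := E') (g' a.2) hg' _
  by_cases h : (v : E × E').1 = 0
  · have h' : (v : E × E').2 ≠ 0 := fun h' => hv (Prod.ext h h')
    exact add_pos_of_nonneg_of_pos h1 (hg' _ h')
  · exact add_pos_of_pos_of_nonneg (hg _ h) h2

section ProdMap

variable {E : Type*} [NormedAddCommGroup E] [NormedSpace ℝ E]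
  {H : Type*} [TopologicalSpace H] {I : ModelWithCorners ℝ E H}
  {M : Type*} [TopologicalSpace M] [ChartedSpace H M]
  {E' : Type*} [NormedAddCommGroup E'] [NormedSpace ℝ E']
  {H' : Type*} [TopologicalSpace H'] {J : ModelWithCorners ℝ E' H'}
  {N : Type*} [TopologicalSpace N] [ChartedSpace H' N]

theorem prodMetric_congr {g₁ g₂ : MetricTensor I M} {g₁' g₂' : MetricTensor J N} {a : M × N}
    (h : g₁ a.1 = g₂ a.1) (h' : g₁' a.2 = g₂' a.2) :
    prodMetric g₁ g₁' a = prodMetric g₂ g₂' a := by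
  unfold prodMetric
  rw [h, h']

theorem pullbackMetric_id (g : MetricTensor I M) : pullbackMetric I id g = g := by
  funext x
  refine ContinuousLinearMap.ext fun u => ContinuousLinearMap.ext fun v => ?_
  rw [pullbackMetric_apply, mfderiv_id]
  rfl

theorem pullbackMetric_prodMap
    {H₁ : Type*} [TopologicalSpace H₁] {I₁ : ModelWithCorners ℝ E H₁}
    {M₁ : Type*} [TopologicalSpace M₁] [ChartedSpace H₁ M₁]
    {H₁' : Type*} [TopologicalSpace H₁'] {J₁ : ModelWithCorners ℝ E' H₁'}
    {N₁ : Type*} [TopologicalSpace N₁] [ChartedSpace H₁' N₁]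
    (g : MetricTensor I M) (g' : MetricTensor J N) {f : M₁ → M} {f' : N₁ → N} {a : M₁ × N₁}
    (hf : MDifferentiableAt I₁ I f a.1) (hf' : MDifferentiableAt J₁ J f' a.2) :
    pullbackMetric (I₁.prod J₁) (Prod.map f f') (prodMetric g g') a =
      prodMetric (pullbackMetric I₁ f g) (pullbackMetric J₁ f' g') a := by
  refine ContinuousLinearMap.ext fun u => ContinuousLinearMap.ext fun v => ?_
  rw [pullbackMetric_apply, mfderiv_prodMap hf hf']
  rfl

end ProdMap

namespace Suspension

variable {EX : Type*} [NormedAddCommGroup EX] [NormedSpace ℝ EX]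
  {Xt X : Type*} [TopologicalSpace Xt] [ChartedSpace EX Xt] [TopologicalSpace X] [ChartedSpace EX X]
  {p : Xt → X} (hp : IsUniversalCover EX p) (x₀ : Xt)
  {Y : Type*} {Γ : Type*} [Group Γ] [MulAction Γ Y] (φ : FundamentalGroup X (p x₀) →* Γ)
  [TopologicalSpace Y] [ContinuousConstSMul Γ Y]
  {EY : Type*} [NormedAddCommGroup EY] [NormedSpace ℝ EY] [ChartedSpace EY Y]

theorem pullbackMetric_deck (hp : IsUniversalCover EX p) (gX : MetricTensor 𝓘(ℝ, EX) X)
    (d : deckGroup p) (x : Xt) :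
    pullbackMetric 𝓘(ℝ, EX) (fun x : Xt => d • x) (pullbackMetric 𝓘(ℝ, EX) p gX) x =
      pullbackMetric 𝓘(ℝ, EX) p gX x := by
  rw [← pullbackMetric_comp gX (hp.isLocalDiffeomorph.mdifferentiable (by simp) _)
    ((hp.contMDiff_deck d).mdifferentiable (by simp) x)]
  exact pullbackMetric_congr_of_eventuallyEq gX (Filter.Eventually.of_forall fun y => d.2 y)

theorem pullbackMetric_act (hΓ : ∀ c : Γ, ContMDiff 𝓘(ℝ, EY) 𝓘(ℝ, EY) ∞ fun y : Y => c • y)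
    (gX : MetricTensor 𝓘(ℝ, EX) X) {gY : MetricTensor 𝓘(ℝ, EY) Y}
    (hg : ∀ c : Γ, pullbackMetric 𝓘(ℝ, EY) (fun y : Y => c • y) gY = gY)
    (γ : FundamentalGroup X (p x₀)) (b : Xt × Y) :
    pullbackMetric (𝓘(ℝ, EX).prod 𝓘(ℝ, EY)) (act hp x₀ φ γ)
      (prodMetric (pullbackMetric 𝓘(ℝ, EX) p gX) gY) b =
      prodMetric (pullbackMetric 𝓘(ℝ, EX) p gX) gY b := by
  refine (pullbackMetric_prodMap _ _ ((hp.contMDiff_deck _).mdifferentiable (by simp) _)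
    ((hΓ (φ γ)).mdifferentiable (by simp) _)).trans ?_
  exact prodMetric_congr (pullbackMetric_deck hp gX _ _) (congrFun (hg (φ γ)) b.2)

variable [IsManifold 𝓘(ℝ, EX) ∞ Xt] [IsManifold 𝓘(ℝ, EY) ∞ Y]

/-- Partial homeomorphisms that coincide with `σ` are diffeomorphisms. -/
theorem mdifferentiable_of_eqOn_proj
    (hΓ : ∀ c : Γ, ContMDiff 𝓘(ℝ, EY) 𝓘(ℝ, EY) ∞ fun y : Y => c • y)
    {Φ : OpenPartialHomeomorph (Xt × Y) (Suspension (Y := Y) hp x₀ φ)}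
    (hΦ : ∀ b ∈ Φ.source, Φ b = proj hp x₀ φ b) :
    Φ.MDifferentiable (𝓘(ℝ, EX).prod 𝓘(ℝ, EY)) (𝓘(ℝ, EX).prod 𝓘(ℝ, EY)) := by
  constructor
  · exact ((contMDiff_proj hp x₀ φ hΓ).mdifferentiable (by simp)).mdifferentiableOn.congr hΦ
  · intro s hs
    refine ((contMDiffAt_section hp x₀ φ hΓ (Φ.continuousAt_symm hs)
      ?_).mdifferentiableAt (by simp)).mdifferentiableWithinAt
    filter_upwards [Φ.open_target.mem_nhds hs] with t ht
    rw [← hΦ _ (Φ.map_target ht), Φ.right_inv ht]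

theorem bijective_mfderiv_proj
    (hΓ : ∀ c : Γ, ContMDiff 𝓘(ℝ, EY) 𝓘(ℝ, EY) ∞ fun y : Y => c • y) (b : Xt × Y) :
    Function.Bijective (mfderiv (𝓘(ℝ, EX).prod 𝓘(ℝ, EY)) (𝓘(ℝ, EX).prod 𝓘(ℝ, EY))
      (proj hp x₀ φ) b) := by
  let Φ := ((proj_isLocalHomeomorph (Y := Y) hp x₀ φ).localInverseAt b).symm
  have hΦ : ⇑Φ = proj hp x₀ φ := (proj_isLocalHomeomorph hp x₀ φ).localInverseAt_symm b
  have hb : b ∈ Φ.source := (proj_isLocalHomeomorph hp x₀ φ).self_mem_localInverseAt_target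
  have h := (mdifferentiable_of_eqOn_proj (EX := EX) (EY := EY) hp x₀ φ hΓ
    (fun b _ => congrFun hΦ b)).mfderiv_bijective hb
  rw [hΦ] at h
  exact h

variable [FiniteDimensional ℝ EX] [FiniteDimensional ℝ EY]

/-- `σ` is a local isometry. -/
theorem pullbackMetric_proj (hΓ : ∀ c : Γ, ContMDiff 𝓘(ℝ, EY) 𝓘(ℝ, EY) ∞ fun y : Y => c • y)
    (gX : MetricTensor 𝓘(ℝ, EX) X) {gY : MetricTensor 𝓘(ℝ, EY) Y}
    (hg : ∀ c : Γ, pullbackMetric 𝓘(ℝ, EY) (fun y : Y => c • y) gY = gY) (b : Xt × Y) :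
    pullbackMetric (𝓘(ℝ, EX).prod 𝓘(ℝ, EY)) (proj hp x₀ φ) (metric hp x₀ φ gX gY) b =
      prodMetric (pullbackMetric 𝓘(ℝ, EX) p gX) gY b := by
  let I := 𝓘(ℝ, EX).prod 𝓘(ℝ, EY)
  let P : MetricTensor I (Xt × Y) := prodMetric (pullbackMetric 𝓘(ℝ, EX) p gX) gY
  let dσ (a : Xt × Y) : EX × EY →L[ℝ] EX × EY := mfderiv I I (proj hp x₀ φ) a
  have hinv (a : Xt × Y) : (dσ a).IsInvertible := by
    obtain ⟨h1, h2⟩ := bijective_mfderiv_proj (EX := EX) (EY := EY) hp x₀ φ hΓ a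
    exact ⟨(LinearEquiv.ofBijective (dσ a : EX × EY →ₗ[ℝ] EX × EY)
      ⟨h1, h2⟩).toContinuousLinearEquiv, by ext <;> rfl⟩
  -- `metric` uses an arbitrary preimage `a` of the point. Any such `a` is `act γ b`, and the chain
  -- rule for `σ ∘ act γ = σ` reduces independence of the choice to invariance of the product metric
  -- under `act γ`.
  have key (a : Xt × Y) (ha : proj hp x₀ φ a = proj hp x₀ φ b) (u v : EX × EY) :
      (P a : EX × EY →L[ℝ] EX × EY →L[ℝ] ℝ) ((dσ a).inverse (dσ b u))
        ((dσ a).inverse (dσ b v)) = (P b : EX × EY →L[ℝ] EX × EY →L[ℝ] ℝ) u v := by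
    obtain ⟨γ, rfl⟩ := exists_act_eq hp x₀ φ ha
    have hcomp : proj (Y := Y) hp x₀ φ ∘ act hp x₀ φ γ = proj hp x₀ φ :=
      funext fun c => proj_act hp x₀ φ γ c
    have hd : dσ b = (dσ (act hp x₀ φ γ b)) ∘L
        (mfderiv I I (act hp x₀ φ γ) b : EX × EY →L[ℝ] EX × EY) := by
      have h := mfderiv_comp b ((contMDiff_proj (EX := EX) (EY := EY) hp x₀ φ hΓ).mdifferentiable
        (by simp) _) ((contMDiff_act (EX := EX) (EY := EY) hp x₀ φ hΓ γ).mdifferentiable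
          (by simp) b)
      rw [hcomp] at h
      exact h
    have hd' (u : EX × EY) : (dσ (act hp x₀ φ γ b)).inverse (dσ b u) =
        (mfderiv I I (act hp x₀ φ γ) b : EX × EY →L[ℝ] EX × EY) u := by
      rw [hd]
      exact (hinv _).inverse_apply_self _
    rw [hd', hd']
    exact congrArg (fun B : EX × EY →L[ℝ] EX × EY →L[ℝ] ℝ => B u v)
      (pullbackMetric_act hp x₀ φ hΓ gX hg γ b)
  refine ContinuousLinearMap.ext fun u => ContinuousLinearMap.ext fun v => ?_
  exact key _ (Function.surjInv_eq (proj_surjective hp x₀ φ) _) u v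

theorem metric_pos (hΓ : ∀ c : Γ, ContMDiff 𝓘(ℝ, EY) 𝓘(ℝ, EY) ∞ fun y : Y => c • y)
    {gX : MetricTensor 𝓘(ℝ, EX) X} {gY : MetricTensor 𝓘(ℝ, EY) Y}
    (hg : ∀ c : Γ, pullbackMetric 𝓘(ℝ, EY) (fun y : Y => c • y) gY = gY)
    (hX : ∀ x v, v ≠ 0 → 0 < gX x v v) (hY : ∀ y v, v ≠ 0 → 0 < gY y v v)
    (b : Xt × Y) (v : TangentSpace (𝓘(ℝ, EX).prod 𝓘(ℝ, EY)) (proj hp x₀ φ b)) (hv : v ≠ 0) :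
    0 < metric hp x₀ φ gX gY (proj hp x₀ φ b) v v := by
  obtain ⟨u, rfl⟩ := (bijective_mfderiv_proj (EX := EX) (EY := EY) hp x₀ φ hΓ b).2 v
  have hu : u ≠ 0 := fun h => hv (by rw [h, map_zero])
  rw [← pullbackMetric_apply (g := metric hp x₀ φ gX gY), pullbackMetric_proj hp x₀ φ hΓ gX hg]
  refine prodMetric_pos (fun w hw => ?_) (hY _) u hu
  exact pullback_pos (hX _) ((hp.isLocalDiffeomorph b.1).mfderivToContinuousLinearEquiv
    (by simp)).injective w hw

end Suspension

/-! ### Compactness and isometric local trivializations -/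

namespace Suspension

variable {EX : Type*} [NormedAddCommGroup EX] [NormedSpace ℝ EX]
  {Xt X : Type*} [TopologicalSpace Xt] [ChartedSpace EX Xt] [TopologicalSpace X] [ChartedSpace EX X]
  {p : Xt → X} (hp : IsUniversalCover EX p) (x₀ : Xt)
  {Y : Type*} {Γ : Type*} [Group Γ] [MulAction Γ Y] (φ : FundamentalGroup X (p x₀) →* Γ)

/-- Deck transformations act freely and `deckOfLoop` is injective, so fixing a first coordinate
forces `γ = 1`. -/
theorem act_eq_self {γ : FundamentalGroup X (p x₀)} {b : Xt × Y}
    (h : (act hp x₀ φ γ b).1 = b.1) : act hp x₀ φ γ b = b := by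
  have := hp.simplyConnected
  have hc := hp.isQuotientCoveringMap.isCancelSMul
  have h1 : (hp.deckOfLoop x₀ γ⁻¹).unop = 1 := isCancelSMul_iff_eq_one_of_smul_eq.1 hc _ b.1 h
  rw [MulOpposite.unop_eq_one_iff, map_inv, inv_eq_one] at h1
  have h2 : γ = 1 := hp.isQuotientCoveringMap.fundamentalGroupToMulOpposite_injective _
    (h1.trans (map_one _).symm)
  subst h2
  change ((hp.deckOfLoop x₀ 1⁻¹).unop • b.1, φ 1 • b.2) = b
  rw [inv_one, map_one, map_one, MulOpposite.unop_one, one_smul, one_smul]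

/-- The projection of the suspension onto `X`. -/
noncomputable def toBase : Suspension (Y := Y) hp x₀ φ → X :=
  Quotient.lift (fun a : Xt × Y => p a.1) fun a b h => by
    obtain ⟨γ, rfl⟩ := h
    exact (hp.deckOfLoop x₀ γ⁻¹).unop.2 b.1

theorem toBase_proj (a : Xt × Y) : toBase hp x₀ φ (proj hp x₀ φ a) = p a.1 := rfl

variable [TopologicalSpace Y]

theorem continuous_toBase : Continuous (toBase (Y := Y) hp x₀ φ) :=
  Continuous.quotient_lift (hp.isCoveringMap.continuous.comp continuous_fst) _

/-- Images under `p` of finitely many compact sets `K` cover `X`, and the images `σ (K × Y)` then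
cover `𝒮`. -/
theorem compactSpace [FiniteDimensional ℝ EX] [CompactSpace X] [CompactSpace Y]
    [ContinuousConstSMul Γ Y] : CompactSpace (Suspension (Y := Y) hp x₀ φ) := by
  have := ChartedSpace.locallyCompactSpace EX Xt
  have hK (x : Xt) : ∃ K : Set Xt, IsCompact K ∧ K ∈ 𝓝 x := exists_compact_mem_nhds x
  choose K hKc hKn using hK
  let r : X → Xt := Function.surjInv hp.surjective
  have hr (x : X) : p (r x) = x := Function.surjInv_eq hp.surjective x
  have hn (x : X) : p '' K (r x) ∈ 𝓝 x := by
    have h := hp.isCoveringMap.isLocalHomeomorph.isOpenMap.image_mem_nhds (hKn (r x))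
    rwa [hr] at h
  obtain ⟨t, ht⟩ := CompactSpace.elim_nhds_subcover _ hn
  have hσ := continuous_proj (Y := Y) hp x₀ φ
  have hc : IsCompact (⋃ x ∈ t, proj (Y := Y) hp x₀ φ '' (K (r x) ×ˢ Set.univ)) :=
    t.finite_toSet.isCompact_biUnion fun x _ => ((hKc (r x)).prod isCompact_univ).image hσ
  refine ⟨?_⟩
  convert hc
  refine (Set.eq_univ_of_forall fun s => ?_).symm
  obtain ⟨⟨x, y⟩, rfl⟩ := proj_surjective hp x₀ φ s
  have hx : p x ∈ ⋃ x ∈ t, p '' K (r x) := by rw [ht]; trivial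
  simp only [Set.mem_iUnion] at hx ⊢
  obtain ⟨z, hz, x', hx', hpx⟩ := hx
  obtain ⟨γ, hγ⟩ := exists_act_fst_eq (Y := Y) hp x₀ φ hpx.symm
  refine ⟨z, hz, (x', φ γ • y), ⟨hx', trivial⟩, ?_⟩
  rw [← hγ, proj_act]

variable [ContinuousConstSMul Γ Y]

/-- Over an open set on which `p` has a section, `σ` is injective. -/
theorem exists_trivialization [Nonempty Y] (x : X) :
    ∃ (r : OpenPartialHomeomorph X Xt)
      (Φ : OpenPartialHomeomorph (Xt × Y) (Suspension (Y := Y) hp x₀ φ)),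
      x ∈ r.source ∧ ⇑r.symm = p ∧ ⇑Φ = proj hp x₀ φ ∧ Φ.source = r.target ×ˢ Set.univ := by
  obtain ⟨xt, rfl⟩ := hp.surjective x
  have hloc := hp.isCoveringMap.isLocalHomeomorph
  let r := hloc.localInverseAt xt
  have : Nonempty (Xt × Y) := ⟨(xt, Classical.arbitrary Y)⟩
  have hinj : Set.InjOn (proj (Y := Y) hp x₀ φ) (r.target ×ˢ Set.univ) := by
    intro a ha b hb hab
    obtain ⟨γ, rfl⟩ := exists_act_eq hp x₀ φ hab
    refine act_eq_self hp x₀ φ (hloc.injOn_localInverseAt_target ha.1 hb.1 ?_)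
    exact (hp.deckOfLoop x₀ γ⁻¹).unop.2 b.1
  refine ⟨r, OpenPartialHomeomorph.ofContinuousOpen hinj.toPartialEquiv
    (continuous_proj hp x₀ φ).continuousOn (proj_isLocalHomeomorph hp x₀ φ).isOpenMap
    (r.open_target.prod isOpen_univ), hloc.apply_self_mem_localInverseAt_source,
    hloc.localInverseAt_symm xt, rfl, rfl⟩

variable {EY : Type*} [NormedAddCommGroup EY] [NormedSpace ℝ EY] [ChartedSpace EY Y]
  [IsManifold 𝓘(ℝ, EX) ∞ Xt] [IsManifold 𝓘(ℝ, EY) ∞ Y]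
  [FiniteDimensional ℝ EX] [FiniteDimensional ℝ EY]

/-- `σ` is isometric for `p^* gX` plus `gY`, and `p ∘ r = id` cancels the pull-back by `p`. -/
theorem pullbackMetric_proj_comp_section
    (hΓ : ∀ c : Γ, ContMDiff 𝓘(ℝ, EY) 𝓘(ℝ, EY) ∞ fun y : Y => c • y)
    (gX : MetricTensor 𝓘(ℝ, EX) X) {gY : MetricTensor 𝓘(ℝ, EY) Y}
    (hg : ∀ c : Γ, pullbackMetric 𝓘(ℝ, EY) (fun y : Y => c • y) gY = gY)
    {r : X → Xt} {a : X × Y} (hr : MDifferentiableAt 𝓘(ℝ, EX) 𝓘(ℝ, EX) r a.1)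
    (hpr : p ∘ r =ᶠ[𝓝 a.1] id) :
    pullbackMetric (𝓘(ℝ, EX).prod 𝓘(ℝ, EY)) (proj hp x₀ φ ∘ Prod.map r id)
      (metric hp x₀ φ gX gY) a = prodMetric gX gY a := by
  have hd : MDifferentiableAt (𝓘(ℝ, EX).prod 𝓘(ℝ, EY)) (𝓘(ℝ, EX).prod 𝓘(ℝ, EY))
      (Prod.map r (id : Y → Y)) a :=
    MDifferentiableAt.prodMap (x := a.1) (y := a.2) hr mdifferentiableAt_id
  have h1 := pullbackMetric_comp (metric hp x₀ φ gX gY)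
    ((contMDiff_proj hp x₀ φ hΓ).mdifferentiable (by simp) (Prod.map r (id : Y → Y) a)) hd
  have h2 : pullbackMetric (𝓘(ℝ, EX).prod 𝓘(ℝ, EY)) (proj hp x₀ φ) (metric hp x₀ φ gX gY) =
      prodMetric (pullbackMetric 𝓘(ℝ, EX) p gX) gY :=
    funext (pullbackMetric_proj hp x₀ φ hΓ gX hg)
  rw [h2] at h1
  have h3 := pullbackMetric_prodMap (J₁ := 𝓘(ℝ, EY)) (f' := (id : Y → Y))
    (pullbackMetric 𝓘(ℝ, EX) p gX) gY hr mdifferentiableAt_id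
  have h4 : pullbackMetric 𝓘(ℝ, EX) r (pullbackMetric 𝓘(ℝ, EX) p gX) a.1 = gX a.1 := by
    rw [← pullbackMetric_comp gX (hp.isLocalDiffeomorph.mdifferentiable (by simp) _) hr,
      pullbackMetric_congr_of_eventuallyEq gX hpr, pullbackMetric_id]
  exact h1.trans (h3.trans (prodMetric_congr h4 (congrFun (pullbackMetric_id gY) a.2)))

/-- Local trivializations of the suspension that are isometric for the product metric. -/
theorem exists_isometric_trivialization [Nonempty Y]
    (hΓ : ∀ c : Γ, ContMDiff 𝓘(ℝ, EY) 𝓘(ℝ, EY) ∞ fun y : Y => c • y)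
    (gX : MetricTensor 𝓘(ℝ, EX) X) {gY : MetricTensor 𝓘(ℝ, EY) Y}
    (hg : ∀ c : Γ, pullbackMetric 𝓘(ℝ, EY) (fun y : Y => c • y) gY = gY) (x : X) :
    ∃ (V : Set X) (r : X → Xt)
      (Θ : OpenPartialHomeomorph (X × Y) (Suspension (Y := Y) hp x₀ φ)),
      IsOpen V ∧ x ∈ V ∧ Θ.source = V ×ˢ Set.univ ∧ Θ.target = toBase hp x₀ φ ⁻¹' V ∧
      (∀ a ∈ Θ.source, p (r a.1) = a.1 ∧ Θ a = proj hp x₀ φ (r a.1, a.2)) ∧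
      Θ.MDifferentiable (𝓘(ℝ, EX).prod 𝓘(ℝ, EY)) (𝓘(ℝ, EX).prod 𝓘(ℝ, EY)) ∧
      ∀ a ∈ Θ.source, pullbackMetric (𝓘(ℝ, EX).prod 𝓘(ℝ, EY)) Θ (metric hp x₀ φ gX gY) a =
        prodMetric gX gY a := by
  obtain ⟨r, Φ, hx, hr, hΦ, hΦs⟩ := exists_trivialization (Y := Y) hp x₀ φ x
  let Θ := (r.prod (OpenPartialHomeomorph.refl Y)).trans Φ
  have hΘs : Θ.source = r.source ×ˢ Set.univ := by
    ext a
    simp only [Θ, OpenPartialHomeomorph.trans_source, OpenPartialHomeomorph.prod_source, hΦs,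
      OpenPartialHomeomorph.refl_source, Set.mem_inter_iff, Set.mem_prod, Set.mem_preimage,
      Set.mem_univ, and_true, OpenPartialHomeomorph.prod_apply]
    exact ⟨fun h => h.1, fun h => ⟨h, r.map_source h⟩⟩
  have hpr : ∀ y ∈ r.source, p (r y) = y := fun y hy => by rw [← hr]; exact r.left_inv hy
  have hΘ (a : X × Y) : Θ a = proj hp x₀ φ (r a.1, a.2) := by
    rw [← hΦ]
    rfl
  -- `r` is a topological section; near each point it agrees with the smooth local inverse of `p`.
  have hrd : r.MDifferentiable 𝓘(ℝ, EX) 𝓘(ℝ, EX) := by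
    have hsymm : MDifferentiable 𝓘(ℝ, EX) 𝓘(ℝ, EX) p :=
      hp.isLocalDiffeomorph.mdifferentiable (by simp)
    refine ⟨fun y hy => ?_, by rw [hr]; exact hsymm.mdifferentiableOn⟩
    have h := hp.isLocalDiffeomorph (r y)
    have h1 : MDifferentiableAt 𝓘(ℝ, EX) 𝓘(ℝ, EX) h.localInverse y := by
      have h2 := h.localInverse_mdifferentiableAt (by simp)
      rwa [hpr y hy] at h2
    refine (h1.congr_of_eventuallyEq ?_).mdifferentiableWithinAt
    have hU : h.localInverse.target ∈ 𝓝 (r y) :=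
      h.localInverse.open_target.mem_nhds h.localInverse_mem_target
    filter_upwards [r.open_source.mem_nhds hy, (r.continuousAt hy) hU] with w hw hw'
    have h3 := h.localInverse_left_inv hw'
    rw [hpr w hw] at h3
    exact h3.symm
  have hrprod : (r.prod (OpenPartialHomeomorph.refl Y)).MDifferentiable
      (𝓘(ℝ, EX).prod 𝓘(ℝ, EY)) (𝓘(ℝ, EX).prod 𝓘(ℝ, EY)) := by
    refine ⟨fun a ha => ?_, fun a ha => ?_⟩
    · exact (((hrd.mdifferentiableAt ha.1).comp a mdifferentiableAt_fst).prodMk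
        mdifferentiableAt_snd).mdifferentiableWithinAt
    · exact (((hrd.mdifferentiableAt_symm ha.1).comp a mdifferentiableAt_fst).prodMk
        mdifferentiableAt_snd).mdifferentiableWithinAt
  have hΦd := mdifferentiable_of_eqOn_proj (EX := EX) (EY := EY) hp x₀ φ hΓ
    fun b _ => congrFun hΦ b
  refine ⟨r.source, r, Θ, r.open_source, hx, hΘs, ?_, fun a ha => ⟨hpr _ ?_, hΘ a⟩,
    hrprod.trans hΦd, fun a ha => ?_⟩
  · ext s
    constructor
    · intro hs
      have h1 := Θ.map_target hs
      rw [hΘs] at h1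
      rw [Set.mem_preimage, ← Θ.right_inv hs, hΘ, toBase_proj, hpr _ h1.1]
      exact h1.1
    · intro hs
      obtain ⟨⟨x', y⟩, rfl⟩ := proj_surjective hp x₀ φ s
      rw [Set.mem_preimage, toBase_proj] at hs
      -- Moving the first coordinate into the sheet of `r` changes only the point of `Y`, so the
      -- target is the full preimage of `V`.
      obtain ⟨γ, hγ⟩ := exists_act_fst_eq (Y := Y) hp x₀ φ (hpr _ hs).symm
      have h1 : Θ (p x', φ γ • y) = proj hp x₀ φ (x', y) := by
        rw [hΘ]
        change proj hp x₀ φ (r (p x'), φ γ • y) = _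
        rw [← hγ y, proj_act]
      rw [← h1]
      exact Θ.map_source (by rw [hΘs]; exact ⟨hs, trivial⟩)
  · rw [hΘs] at ha
    exact ha.1
  · rw [hΘs] at ha
    have h5 : p ∘ r =ᶠ[𝓝 a.1] id := by
      filter_upwards [r.open_source.mem_nhds ha.1] with w hw using hpr w hw
    have h6 : ⇑Θ = proj hp x₀ φ ∘ Prod.map r id := funext hΘ
    rw [h6]
    exact pullbackMetric_proj_comp_section hp x₀ φ hΓ gX hg (hrd.mdifferentiableAt ha.1) h5

end Suspension

/-! ### Measurable gluing of the trivializations -/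

/-- A measure preserving map glued from countably many pieces. -/
theorem exists_measurePreserving_of_cover {A B X : Type*} [MeasurableSpace A] [MeasurableSpace B]
    [MeasurableSpace X] {μ : Measure A} {ν : Measure B} {a : A → X} {b : B → X}
    (ha : Measurable a) (hb : Measurable b) {V : ℕ → Set X} (hV : ∀ n, MeasurableSet (V n))
    (hcov : ⋃ n, V n = Set.univ) {θ : ℕ → A → B}
    (hθ : ∀ n, ∀ C, MeasurableSet C → MeasurableSet (θ n ⁻¹' C ∩ a ⁻¹' V n))
    (hae : ∀ n, AEMeasurable (θ n) (μ.restrict (a ⁻¹' V n)))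
    (hab : ∀ n, ∀ z, a z ∈ V n → b (θ n z) = a z)
    (hmap : ∀ n, (μ.restrict (a ⁻¹' V n)).map (θ n) = ν.restrict (b ⁻¹' V n)) :
    ∃ Θ : A → B, MeasurePreserving Θ μ ν ∧ ∀ z, ∃ n, a z ∈ V n ∧ Θ z = θ n z := by
  have hD (x : X) : ∃ n, x ∈ disjointed V n := by
    have hx : x ∈ ⋃ n, disjointed V n := by rw [iUnion_disjointed, hcov]; trivial
    exact Set.mem_iUnion.1 hx
  -- `i x` is the index of the one disjointed piece containing `x`; the glued map uses `θ (i x)`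
  -- over `x`.
  choose i hi using hD
  have hDm (n : ℕ) : MeasurableSet (disjointed V n) := MeasurableSet.disjointed hV n
  have hi' {x : X} {n : ℕ} (hx : x ∈ disjointed V n) : i x = n := by
    by_contra hne
    exact Set.disjoint_left.1 (disjoint_disjointed V hne) (hi x) hx
  have hpre (C : Set B) : (fun z => θ (i (a z)) z) ⁻¹' C =
      ⋃ n, θ n ⁻¹' C ∩ a ⁻¹' V n ∩ a ⁻¹' disjointed V n := by
    ext z
    simp only [Set.mem_preimage, Set.mem_iUnion, Set.mem_inter_iff]
    constructor
    · exact fun h => ⟨i (a z), ⟨h, disjointed_subset V _ (hi _)⟩, hi _⟩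
    · rintro ⟨n, ⟨h, -⟩, hn⟩
      rwa [hi' hn]
  have hm (n : ℕ) {C : Set B} (hC : MeasurableSet C) :
      MeasurableSet (θ n ⁻¹' C ∩ a ⁻¹' V n ∩ a ⁻¹' disjointed V n) :=
    (hθ n C hC).inter (ha (hDm n))
  refine ⟨fun z => θ (i (a z)) z, ⟨fun C hC => ?_, ?_⟩,
    fun z => ⟨_, disjointed_subset V _ (hi _), rfl⟩⟩
  · rw [hpre]
    exact MeasurableSet.iUnion fun n => hm n hC
  · ext C hC
    have hmeas : Measurable fun z => θ (i (a z)) z := fun C hC => by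
      rw [hpre]
      exact MeasurableSet.iUnion fun n => hm n hC
    rw [Measure.map_apply hmeas hC, hpre, measure_iUnion _ fun n => hm n hC]
    · have hC' : C = ⋃ n, C ∩ b ⁻¹' disjointed V n := by
        rw [← Set.inter_iUnion, ← Set.preimage_iUnion, iUnion_disjointed, hcov, Set.preimage_univ,
          Set.inter_univ]
      conv_rhs => rw [hC']
      rw [measure_iUnion _ fun n => hC.inter (hb (hDm n))]
      · refine tsum_congr fun n => ?_
        have hCn : MeasurableSet (C ∩ b ⁻¹' disjointed V n) := hC.inter (hb (hDm n))
        have h1 : ν (C ∩ b ⁻¹' disjointed V n) =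
            ν.restrict (b ⁻¹' V n) (C ∩ b ⁻¹' disjointed V n) := by
          have h2 : C ∩ b ⁻¹' disjointed V n ⊆ b ⁻¹' V n :=
            fun z hz => disjointed_subset V n hz.2
          rw [Measure.restrict_apply hCn, Set.inter_eq_self_of_subset_left h2]
        rw [h1, ← hmap, Measure.map_apply_of_aemeasurable (hae n) hCn,
          Measure.restrict_apply' (ha (hV n))]
        congr 1
        -- Since `b ∘ θ n = a` over `V n`, the cut of `B` into disjoint pieces pulls back to that of
        -- `A`.
        ext z
        constructor
        · rintro ⟨⟨h2, h3⟩, h4⟩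
          refine ⟨⟨h2, ?_⟩, h3⟩
          rw [Set.mem_preimage, hab n z h3]
          exact h4
        · rintro ⟨⟨h2, h4⟩, h3⟩
          refine ⟨⟨h2, h3⟩, ?_⟩
          rw [Set.mem_preimage, hab n z h3] at h4
          exact h4
      · exact fun n m hnm => ((disjoint_disjointed V hnm).preimage b).mono
          Set.inter_subset_right Set.inter_subset_right
    · exact fun n m hnm => ((disjoint_disjointed V hnm).preimage a).mono
        Set.inter_subset_right Set.inter_subset_right

namespace Suspension

variable {EX : Type*} [NormedAddCommGroup EX] [NormedSpace ℝ EX] [FiniteDimensional ℝ EX]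
  {Xt X : Type*} [TopologicalSpace Xt] [ChartedSpace EX Xt] [TopologicalSpace X] [ChartedSpace EX X]
  [IsManifold 𝓘(ℝ, EX) ∞ Xt] [IsManifold 𝓘(ℝ, EX) ∞ X] [CompactSpace X]
  [MeasurableSpace X] [BorelSpace X]
  {p : Xt → X} (hp : IsUniversalCover EX p) (x₀ : Xt)
  {EY : Type*} [NormedAddCommGroup EY] [NormedSpace ℝ EY] [FiniteDimensional ℝ EY]
  {Y : Type*} [TopologicalSpace Y] [ChartedSpace EY Y] [IsManifold 𝓘(ℝ, EY) ∞ Y] [CompactSpace Y]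
  [MeasurableSpace Y] [BorelSpace Y]
  {Γ : Type*} [Group Γ] [MulAction Γ Y] [ContinuousConstSMul Γ Y]
  (φ : FundamentalGroup X (p x₀) →* Γ)

/-- Up to measurable gluing of local trivializations, the suspension is the product `X × Y`. -/
theorem exists_measurePreserving
    (hΓ : ∀ c : Γ, ContMDiff 𝓘(ℝ, EY) 𝓘(ℝ, EY) ∞ fun y : Y => c • y)
    (gX : Bundle.ContMDiffRiemannianMetric 𝓘(ℝ, EX) ∞ EX
      (fun x : X => TangentSpace 𝓘(ℝ, EX) x))
    (gY : Bundle.ContMDiffRiemannianMetric 𝓘(ℝ, EY) ∞ EY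
      (fun y : Y => TangentSpace 𝓘(ℝ, EY) y))
    (hg : ∀ c : Γ, pullbackMetric 𝓘(ℝ, EY) (fun y : Y => c • y) gY.inner = gY.inner) :
    ∃ Θ : X × Y → Suspension (Y := Y) hp x₀ φ,
      MeasurePreserving Θ ((riemannianVolume gX.inner).prod (riemannianVolume gY.inner))
        (riemannianVolume (metric hp x₀ φ gX.inner gY.inner)) ∧
      ∀ a, ∃ x : Xt, Θ a = proj hp x₀ φ (x, a.2) := by
  have := ChartedSpace.secondCountable_of_sigmaCompact EX X
  have := ChartedSpace.secondCountable_of_sigmaCompact EY Y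
  have := compactSpace (Y := Y) hp x₀ φ
  have : SecondCountableTopology (ModelProd EX EY) :=
    inferInstanceAs (SecondCountableTopology (EX × EY))
  have := ChartedSpace.secondCountable_of_sigmaCompact (ModelProd EX EY)
    (Suspension (Y := Y) hp x₀ φ)
  have := isManifold (EX := EX) (EY := EY) hp x₀ φ hΓ
  have : IsManifold (𝓘(ℝ, EX).prod 𝓘(ℝ, EY)) 1 (Suspension (Y := Y) hp x₀ φ) :=
    IsManifold.of_le (n := ∞) (by norm_cast)
  have : IsManifold (𝓘(ℝ, EX).prod 𝓘(ℝ, EY)) 1 (X × Y) :=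
    IsManifold.of_le (n := ∞) (by norm_cast)
  rcases isEmpty_or_nonempty Y with hY | hY
  · have hS : IsEmpty (Suspension (Y := Y) hp x₀ φ) :=
      ⟨fun s => by
        obtain ⟨a, -⟩ := proj_surjective hp x₀ φ s
        exact hY.false a.2⟩
    refine ⟨fun a => isEmptyElim a.2, ⟨measurable_of_empty _, Subsingleton.elim _ _⟩,
      fun a => isEmptyElim a.2⟩
  have : Nonempty X := ⟨p x₀⟩
  rw [← riemannianVolume_prodMetric gX gY]
  choose V r θ hVo hxV hθs hθt hθr hθd hθg using
    exists_isometric_trivialization (Y := Y) hp x₀ φ hΓ gX.inner hg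
  obtain ⟨t, htc, ht⟩ := TopologicalSpace.countable_cover_nhds fun x => (hVo x).mem_nhds (hxV x)
  have htne : t.Nonempty := by
    by_contra h
    rw [Set.not_nonempty_iff_eq_empty] at h
    rw [h, Set.biUnion_empty] at ht
    exact Set.empty_ne_univ ht
  obtain ⟨c, rfl⟩ := htc.exists_eq_range htne
  have hs (n : ℕ) : (θ (c n)).source = Prod.fst ⁻¹' V (c n) := by
    rw [hθs, Set.prod_univ]
  have h1 (n : ℕ) (C) (hC : MeasurableSet C) :
      MeasurableSet (θ (c n) ⁻¹' C ∩ Prod.fst ⁻¹' V (c n)) := by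
    rw [← hs]
    exact measurableSet_preimage_inter_source (θ (c n)) hC
  have h2 (n : ℕ) : AEMeasurable (θ (c n))
      ((riemannianVolume (prodMetric gX.inner gY.inner)).restrict (Prod.fst ⁻¹' V (c n))) := by
    rw [← hs]
    exact (θ (c n)).continuousOn.aemeasurable (θ (c n)).open_source.measurableSet
  have h3 (n : ℕ) (z : X × Y) (hz : z.1 ∈ V (c n)) : toBase hp x₀ φ (θ (c n) z) = z.1 := by
    obtain ⟨h1, h2⟩ := hθr (c n) z (by rw [hs]; exact hz)
    rw [h2, toBase_proj, h1]
  have h4 (n : ℕ) : ((riemannianVolume (prodMetric gX.inner gY.inner)).restrict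
      (Prod.fst ⁻¹' V (c n))).map (θ (c n)) =
      (riemannianVolume (metric hp x₀ φ gX.inner gY.inner)).restrict
        (toBase hp x₀ φ ⁻¹' V (c n)) := by
    have h := map_riemannianVolume_restrict (hθd (c n)) (hθg (c n))
    rwa [hs, hθt] at h
  -- On overlaps the trivializations may differ by the action of some `φ γ` on `Y`, so `Θ` is in
  -- general only measurable.
  obtain ⟨Θ, hΘ, h⟩ := exists_measurePreserving_of_cover measurable_fst
    (continuous_toBase hp x₀ φ).measurable (V := fun n => V (c n))
    (fun n => (hVo _).measurableSet) (by rw [← ht, Set.biUnion_range]) h1 h2 h3 h4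
  refine ⟨Θ, hΘ, fun a => ?_⟩
  obtain ⟨n, hn, hna⟩ := h a
  exact ⟨r (c n) a.1, hna.trans (hθr (c n) a (by rw [hs]; exact hn)).2⟩

end Suspension

/-! ### Basic functions, invariant functions and their Laplacians -/

/-- For fixed `y` the map `a ↦ f (a • y)` is continuous, so its value on a dense subgroup determines
it. Density enters the whole argument only here. -/
theorem invariantFunctions_eq_of_dense {E : Type*} [NormedAddCommGroup E] [NormedSpace ℝ E]
    {H : Type*} [TopologicalSpace H] (I : ModelWithCorners ℝ E H)
    {G : Type*} {Y : Type*} [Group G] [TopologicalSpace G] [MulAction G Y] [TopologicalSpace Y]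
    [ChartedSpace H Y] [ContinuousSMul G Y] {G₀ : Subgroup G} (hG₀ : Dense (G₀ : Set G)) :
    invariantFunctions I G₀ Y = invariantFunctions I G Y := by
  ext f
  constructor
  · intro hf a y
    have h : (fun a : G => f (a • y)) = fun _ => f y := by
      refine Continuous.ext_on hG₀ (by fun_prop) continuous_const fun a ha => ?_
      exact hf ⟨a, ha⟩ y
    exact congrFun h a
  · exact fun hf a y => hf a y

namespace Suspension

variable {EX : Type*} [NormedAddCommGroup EX] [NormedSpace ℝ EX]
  {Xt X : Type*} [TopologicalSpace Xt] [ChartedSpace EX Xt] [TopologicalSpace X] [ChartedSpace EX X]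
  {p : Xt → X} (hp : IsUniversalCover EX p) (x₀ : Xt)
  {EY : Type*} [NormedAddCommGroup EY] [NormedSpace ℝ EY]
  {Y : Type*} [TopologicalSpace Y] [ChartedSpace EY Y]
  {Γ : Type*} [Group Γ] [MulAction Γ Y] [ContinuousConstSMul Γ Y]
  (φ : FundamentalGroup X (p x₀) →* Γ)

theorem basicFunctions_apply_eq
    {f : C^∞⟮𝓘(ℝ, EX).prod 𝓘(ℝ, EY), Suspension (Y := Y) hp x₀ φ; ℝ⟯}
    (hf : f ∈ basicFunctions hp x₀ φ) (x x' : Xt) (y : Y) :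
    f (proj hp x₀ φ (x, y)) = f (proj hp x₀ φ (x', y)) :=
  hf _ _ ⟨x', x, y, rfl, rfl⟩

variable [IsManifold 𝓘(ℝ, EX) ∞ Xt] [IsManifold 𝓘(ℝ, EY) ∞ Y]

/-- The basic functions on the suspension are the `Γ`-invariant functions on `Y`. -/
noncomputable def basicEquiv
    (hΓ : ∀ c : Γ, ContMDiff 𝓘(ℝ, EY) 𝓘(ℝ, EY) ∞ fun y : Y => c • y)
    (hφ : Function.Surjective φ) :
    basicFunctions (EY := EY) (Y := Y) hp x₀ φ ≃ₗ[ℝ] invariantFunctions 𝓘(ℝ, EY) Γ Y where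
  toFun f := ⟨⟨fun y => f.1 (proj hp x₀ φ (x₀, y)), f.1.contMDiff.comp
      ((contMDiff_proj hp x₀ φ hΓ).comp (contMDiff_const.prodMk contMDiff_id))⟩, fun c y => by
    -- Surjectivity of `φ` turns invariance under the fundamental group into invariance under all of
    -- `Γ`.
    obtain ⟨γ, rfl⟩ := hφ c
    change f.1 (proj hp x₀ φ (x₀, φ γ • y)) = f.1 (proj hp x₀ φ (x₀, y))
    rw [← proj_act hp x₀ φ γ (x₀, y)]
    exact basicFunctions_apply_eq hp x₀ φ f.2 _ _ _⟩
  map_add' _ _ := rfl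
  map_smul' _ _ := rfl
  invFun h := ⟨⟨Quotient.lift (fun a : Xt × Y => h.1 a.2) fun a b hab => by
      obtain ⟨γ, rfl⟩ := hab
      exact h.2 (φ γ) b.2, fun s => by
    have h1 : ContMDiffAt (𝓘(ℝ, EX).prod 𝓘(ℝ, EY)) 𝓘(ℝ, ℝ) ∞
        (fun t => h.1 (localSection hp x₀ φ s t).2) s := by
      refine (h.1.contMDiff _).comp s (contMDiffAt_snd.comp s
        (contMDiffAt_section hp x₀ φ hΓ ?_ ?_))
      · exact (localSection hp x₀ φ s).continuousAt (mem_localSection_source hp x₀ φ s)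
      · filter_upwards [(localSection hp x₀ φ s).open_source.mem_nhds
          (mem_localSection_source hp x₀ φ s)] with t ht using proj_localSection hp x₀ φ ht
    refine h1.congr_of_eventuallyEq ?_
    filter_upwards [(localSection hp x₀ φ s).open_source.mem_nhds
      (mem_localSection_source hp x₀ φ s)] with t ht
    conv_lhs => rw [← proj_localSection hp x₀ φ ht]
    rfl⟩, by
    rintro _ _ ⟨x, x', y, rfl, rfl⟩
    rfl⟩
  left_inv f := by
    ext s
    obtain ⟨⟨x, y⟩, rfl⟩ := proj_surjective hp x₀ φ s
    exact basicFunctions_apply_eq hp x₀ φ f.2 _ _ _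
  right_inv h := by
    ext y
    rfl

theorem basicEquiv_apply
    (hΓ : ∀ c : Γ, ContMDiff 𝓘(ℝ, EY) 𝓘(ℝ, EY) ∞ fun y : Y => c • y)
    (hφ : Function.Surjective φ) (f : basicFunctions (EY := EY) (Y := Y) hp x₀ φ) (a : Xt × Y) :
    (basicEquiv hp x₀ φ hΓ hφ f).1 a.2 = f.1 (proj hp x₀ φ a) :=
  basicFunctions_apply_eq hp x₀ φ f.2 _ _ _

variable [FiniteDimensional ℝ EX] [FiniteDimensional ℝ EY]

/-- The projection is a Riemannian submersion: `(0, v)` is the horizontal lift of `v`. -/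
theorem innerDifferential_prodMetric_comp_snd {gX : MetricTensor 𝓘(ℝ, EX) Xt}
    {gY : MetricTensor 𝓘(ℝ, EY) Y} (hX : ∀ x v, v ≠ 0 → 0 < gX x v v)
    (hY : ∀ y v, v ≠ 0 → 0 < gY y v v) {f h : Y → ℝ}
    (hf : MDifferentiable 𝓘(ℝ, EY) 𝓘(ℝ, ℝ) f) (hh : MDifferentiable 𝓘(ℝ, EY) 𝓘(ℝ, ℝ) h)
    (b : Xt × Y) :
    innerDifferential (prodMetric gX gY) (f ∘ Prod.snd) (h ∘ Prod.snd) b =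
      innerDifferential gY f h b.2 := by
  refine innerDifferential_comp (F := (Prod.snd : Xt × Y → Y)) mdifferentiableAt_snd (hf _) (hh _)
    (hY _) (prodMetric_pos (hX _) (hY _)) fun v => ⟨((0 : EX), (v : EY)), ?_, fun w' => ?_⟩
  · rw [mfderiv_snd]
    rfl
  · rw [mfderiv_snd]
    have h0 : gX b.1 (0 : EX) (w' : EX × EY).1 = 0 :=
      congrArg (fun B : EX →L[ℝ] ℝ => B (w' : EX × EY).1) (map_zero (gX b.1 : EX →L[ℝ] EX →L[ℝ] ℝ))
    exact (congrArg (· + gY b.2 v (w' : EX × EY).2) h0).trans (zero_add _)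

/-- Both sides are compared on `Xt × Y`, by the local isometry `σ` and by the projection to `Y`. -/
theorem innerDifferential_metric
    (hΓ : ∀ c : Γ, ContMDiff 𝓘(ℝ, EY) 𝓘(ℝ, EY) ∞ fun y : Y => c • y)
    {gX : MetricTensor 𝓘(ℝ, EX) X} {gY : MetricTensor 𝓘(ℝ, EY) Y}
    (hg : ∀ c : Γ, pullbackMetric 𝓘(ℝ, EY) (fun y : Y => c • y) gY = gY)
    (hX : ∀ x v, v ≠ 0 → 0 < gX x v v) (hY : ∀ y v, v ≠ 0 → 0 < gY y v v)
    {f h : Suspension (Y := Y) hp x₀ φ → ℝ} {f' h' : Y → ℝ}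
    (hf : MDifferentiable (𝓘(ℝ, EX).prod 𝓘(ℝ, EY)) 𝓘(ℝ, ℝ) f)
    (hh : MDifferentiable (𝓘(ℝ, EX).prod 𝓘(ℝ, EY)) 𝓘(ℝ, ℝ) h)
    (hf' : MDifferentiable 𝓘(ℝ, EY) 𝓘(ℝ, ℝ) f') (hh' : MDifferentiable 𝓘(ℝ, EY) 𝓘(ℝ, ℝ) h')
    (hff' : ∀ a : Xt × Y, f' a.2 = f (proj hp x₀ φ a))
    (hhh' : ∀ a : Xt × Y, h' a.2 = h (proj hp x₀ φ a)) (b : Xt × Y) :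
    innerDifferential (metric hp x₀ φ gX gY) f h (proj hp x₀ φ b) =
      innerDifferential gY f' h' b.2 := by
  have hXt : ∀ (x : Xt) (v : TangentSpace 𝓘(ℝ, EX) x), v ≠ 0 →
      0 < pullbackMetric 𝓘(ℝ, EX) p gX x v v := fun x v hv =>
    pullback_pos (hX _) ((hp.isLocalDiffeomorph x).mfderivToContinuousLinearEquiv
      (by simp)).injective v hv
  have h1 : innerDifferential (prodMetric (pullbackMetric 𝓘(ℝ, EX) p gX) gY)
      (f ∘ proj hp x₀ φ) (h ∘ proj hp x₀ φ) b =
      innerDifferential (metric hp x₀ φ gX gY) f h (proj hp x₀ φ b) := by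
    refine innerDifferential_comp ((contMDiff_proj hp x₀ φ hΓ).mdifferentiable (by simp) b)
      (hf _) (hh _) (metric_pos hp x₀ φ hΓ hg hX hY b) (prodMetric_pos (hXt _) (hY _))
      fun v => ?_
    obtain ⟨w, rfl⟩ := (bijective_mfderiv_proj (EX := EX) (EY := EY) hp x₀ φ hΓ b).2 v
    refine ⟨w, rfl, fun w' => ?_⟩
    rw [← pullbackMetric_proj hp x₀ φ hΓ gX hg]
    rfl
  have h2 : f ∘ proj hp x₀ φ = f' ∘ Prod.snd := funext fun a => (hff' a).symm
  have h3 : h ∘ proj hp x₀ φ = h' ∘ Prod.snd := funext fun a => (hhh' a).symm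
  rw [← h1, h2, h3]
  exact innerDifferential_prodMetric_comp_snd hXt hY hf' hh' b

variable [IsManifold 𝓘(ℝ, EX) ∞ X] [CompactSpace X] [MeasurableSpace X] [BorelSpace X]
  [CompactSpace Y] [MeasurableSpace Y] [BorelSpace Y]

/-- `w ∘ Θ` depends only on `y`, and integrating over `X` contributes the factor one. -/
theorem integral_eq_of_comp_proj_eq {μ : Measure X} [IsProbabilityMeasure μ] {ν : Measure Y}
    [SFinite ν] {τ : Measure (Suspension (Y := Y) hp x₀ φ)}
    {Θ : X × Y → Suspension (Y := Y) hp x₀ φ} (hΘ : MeasurePreserving Θ (μ.prod ν) τ)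
    (hΘ' : ∀ a, ∃ x : Xt, Θ a = proj hp x₀ φ (x, a.2))
    {w : Suspension (Y := Y) hp x₀ φ → ℝ} {w' : Y → ℝ} (hw' : Continuous w')
    (h : ∀ a : Xt × Y, w (proj hp x₀ φ a) = w' a.2) :
    ∫ s, w s ∂τ = ∫ y, w' y ∂ν := by
  have hq : Topology.IsQuotientMap (proj (Y := Y) hp x₀ φ) := isQuotientMap_quotient_mk'
  -- Continuity comes from the quotient topology, so no regularity of the metric of `𝒮` has to be
  -- known.
  have hw : Continuous w := by
    rw [hq.continuous_iff]
    exact (hw'.comp continuous_snd).congr fun a => (h a).symm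
  have h1 : ∀ a, w (Θ a) = w' a.2 := fun a => by
    obtain ⟨x, hx⟩ := hΘ' a
    rw [hx, h]
  rw [← hΘ.map_eq, integral_map hΘ.measurable.aemeasurable hw.measurable.aestronglyMeasurable]
  simp only [h1]
  have h2 := (measurePreserving_snd (μ := μ) (ν := ν)).map_eq
  conv_rhs => rw [← h2]
  rw [integral_map measurable_snd.aemeasurable hw'.measurable.aestronglyMeasurable]

/-- Since `basicEquiv` is onto, the test functions on the two sides also correspond. -/
theorem basicLaplacian_iff
    (hΓ : ∀ c : Γ, ContMDiff 𝓘(ℝ, EY) 𝓘(ℝ, EY) ∞ fun y : Y => c • y)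
    (hφ : Function.Surjective φ)
    (gX : Bundle.ContMDiffRiemannianMetric 𝓘(ℝ, EX) ∞ EX
      (fun x : X => TangentSpace 𝓘(ℝ, EX) x))
    (gY : Bundle.ContMDiffRiemannianMetric 𝓘(ℝ, EY) ∞ EY
      (fun y : Y => TangentSpace 𝓘(ℝ, EY) y))
    (hg : ∀ c : Γ, pullbackMetric 𝓘(ℝ, EY) (fun y : Y => c • y) gY.inner = gY.inner)
    [IsProbabilityMeasure (riemannianVolume gX.inner)] [SFinite (riemannianVolume gY.inner)]
    {Θ : X × Y → Suspension (Y := Y) hp x₀ φ}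
    (hΘ : MeasurePreserving Θ ((riemannianVolume gX.inner).prod (riemannianVolume gY.inner))
        (riemannianVolume (metric hp x₀ φ gX.inner gY.inner)))
    (hΘ' : ∀ a, ∃ x : Xt, Θ a = proj hp x₀ φ (x, a.2))
    (f u : basicFunctions (EY := EY) (Y := Y) hp x₀ φ) :
    BasicLaplacian hp x₀ φ gX.inner gY.inner f.1 u.1 ↔
      LaplaceRel gY.inner (invariantFunctions 𝓘(ℝ, EY) Γ Y) (invariantFunctions 𝓘(ℝ, EY) Γ Y)
        (basicEquiv hp x₀ φ hΓ hφ f).1 (basicEquiv hp x₀ φ hΓ hφ u).1 := by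
  have key (h : basicFunctions (EY := EY) (Y := Y) hp x₀ φ) :
      (∫ s, u.1 s * h.1 s ∂(riemannianVolume (metric hp x₀ φ gX.inner gY.inner)) =
        ∫ s, innerDifferential (metric hp x₀ φ gX.inner gY.inner) f.1 h.1 s
          ∂(riemannianVolume (metric hp x₀ φ gX.inner gY.inner))) ↔
      (∫ y, (basicEquiv hp x₀ φ hΓ hφ u).1 y * (basicEquiv hp x₀ φ hΓ hφ h).1 y
          ∂(riemannianVolume gY.inner) =
        ∫ y, innerDifferential gY.inner (basicEquiv hp x₀ φ hΓ hφ f).1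
          (basicEquiv hp x₀ φ hΓ hφ h).1 y ∂(riemannianVolume gY.inner)) := by
    rw [integral_eq_of_comp_proj_eq hp x₀ φ hΘ hΘ'
        (w' := fun y => (basicEquiv hp x₀ φ hΓ hφ u).1 y * (basicEquiv hp x₀ φ hΓ hφ h).1 y)
        (((basicEquiv hp x₀ φ hΓ hφ u).1.contMDiff.continuous).mul
          (basicEquiv hp x₀ φ hΓ hφ h).1.contMDiff.continuous)
        fun a => by rw [basicEquiv_apply, basicEquiv_apply],
      integral_eq_of_comp_proj_eq hp x₀ φ hΘ hΘ'
        (continuous_innerDifferential gY (basicEquiv hp x₀ φ hΓ hφ f).1.contMDiff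
          (basicEquiv hp x₀ φ hΓ hφ h).1.contMDiff)
        (innerDifferential_metric hp x₀ φ hΓ hg gX.pos gY.pos
          (f.1.contMDiff.mdifferentiable (by simp)) (h.1.contMDiff.mdifferentiable (by simp))
          ((basicEquiv hp x₀ φ hΓ hφ f).1.contMDiff.mdifferentiable (by simp))
          ((basicEquiv hp x₀ φ hΓ hφ h).1.contMDiff.mdifferentiable (by simp))
          (basicEquiv_apply hp x₀ φ hΓ hφ f) (basicEquiv_apply hp x₀ φ hΓ hφ h))]
  constructor
  · rintro ⟨-, -, H⟩
    refine ⟨(basicEquiv hp x₀ φ hΓ hφ f).2, (basicEquiv hp x₀ φ hΓ hφ u).2, fun h hh => ?_⟩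
    have h1 := (key ((basicEquiv hp x₀ φ hΓ hφ).symm ⟨h, hh⟩)).1 (H _ (Subtype.prop _))
    rwa [LinearEquiv.apply_symm_apply] at h1
  · rintro ⟨-, -, H⟩
    exact ⟨f.2, u.2, fun h hh => (key ⟨h, hh⟩).2 (H _ (Subtype.prop _))⟩

end Suspension

/-! ### Transport of eigenspaces and of the spectrum -/

/-- The resolvent condition involves only the linear structure, the space and the graph, so it can
be tested after an injective linear embedding. -/
theorem forall_existsUnique_image_iff {V W : Type*} [AddCommGroup V] [Module ℝ V]
    [AddCommGroup W] [Module ℝ W] {J : V →ₗ[ℝ] W} (hJ : Function.Injective J) (K : Set V)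
    (Λ : Set (V × V)) (c : ℝ) :
    (∀ k ∈ J '' K, ∃! a, a ∈ Prod.map J J '' Λ ∧ a.2 - c • a.1 = k) ↔
      ∀ k ∈ K, ∃! a, a ∈ Λ ∧ a.2 - c • a.1 = k := by
  have hJ2 : Function.Injective (Prod.map J J) := hJ.prodMap hJ
  have hiff (a : V × V) (k : V) :
      (Prod.map J J a).2 - c • (Prod.map J J a).1 = J k ↔ a.2 - c • a.1 = k := by
    rw [Prod.map_fst, Prod.map_snd, ← map_smul, ← map_sub, hJ.eq_iff]
  rw [Set.forall_mem_image]
  refine forall₂_congr fun k _ => ⟨?_, ?_⟩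
  · rintro ⟨_, ⟨⟨a, ha, rfl⟩, hk⟩, huniq⟩
    exact ⟨a, ⟨ha, (hiff a k).1 hk⟩, fun a' ha' =>
      hJ2 (huniq _ ⟨⟨a', ha'.1, rfl⟩, (hiff a' k).2 ha'.2⟩)⟩
  · rintro ⟨a, ⟨ha, hk⟩, huniq⟩
    refine ⟨_, ⟨⟨a, ha, rfl⟩, (hiff a k).2 hk⟩, ?_⟩
    rintro _ ⟨⟨a', ha', rfl⟩, hk'⟩
    rw [huniq a' ⟨ha', (hiff a' k).1 hk'⟩]

section Transport

variable {E : Type*} [NormedAddCommGroup E] [NormedSpace ℝ E] [FiniteDimensional ℝ E]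
  {H : Type*} [TopologicalSpace H] {I : ModelWithCorners ℝ E H}
  {M : Type*} [TopologicalSpace M] [ChartedSpace H M]
  {E' : Type*} [NormedAddCommGroup E'] [NormedSpace ℝ E'] [FiniteDimensional ℝ E']
  {H' : Type*} [TopologicalSpace H'] {I' : ModelWithCorners ℝ E' H'}
  {M' : Type*} [TopologicalSpace M'] [ChartedSpace H' M']
  {D : Submodule ℝ C^∞⟮I, M; ℝ⟯} {D' : Submodule ℝ C^∞⟮I', M'; ℝ⟯} (e : D ≃ₗ[ℝ] D')
  {R : C^∞⟮I, M; ℝ⟯ → C^∞⟮I, M; ℝ⟯ → Prop} {R' : C^∞⟮I', M'; ℝ⟯ → C^∞⟮I', M'; ℝ⟯ → Prop}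

/-- The equivalence `e` exists only on `D`, so the span is first formed inside `D`. -/
theorem eigenspace_eq_map (hR : ∀ f u, R f u → f ∈ D) (c : ℝ) :
    eigenspace R c = (Submodule.span ℝ {f : D | R f (c • f : D)}).map D.subtype := by
  rw [Submodule.map_span, eigenspace]
  congr 1
  ext f
  constructor
  · exact fun hf => ⟨⟨f, hR _ _ hf⟩, hf, rfl⟩
  · rintro ⟨f, hf, rfl⟩
    exact hf

theorem nonempty_eigenspace_equiv (hR : ∀ f u, R f u → f ∈ D) (hR' : ∀ f u, R' f u → f ∈ D')
    (he : ∀ f u : D, R f u ↔ R' (e f) (e u)) (c : ℝ) :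
    Nonempty (eigenspace R c ≃ₗ[ℝ] eigenspace R' c) := by
  rw [eigenspace_eq_map hR, eigenspace_eq_map hR']
  have h : (Submodule.span ℝ {f : D | R f (c • f : D)}).map (e : D →ₗ[ℝ] D') =
      Submodule.span ℝ {f : D' | R' f (c • f : D')} := by
    rw [Submodule.map_span]
    congr 1
    ext f
    constructor
    · rintro ⟨f, hf, rfl⟩
      have h1 := (he _ _).1 hf
      rwa [map_smul] at h1
    · intro hf
      refine ⟨e.symm f, (he _ _).2 ?_, e.apply_symm_apply f⟩
      rw [map_smul, e.apply_symm_apply]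
      exact hf
  rw [← h]
  exact ⟨(D.equivSubtypeMap _).symm.trans ((e.submoduleMap _).trans (D'.equivSubtypeMap _))⟩

variable [MeasurableSpace M] [MeasurableSpace M'] {g : MetricTensor I M} {g' : MetricTensor I' M'}
  {Z : Type*} [MeasurableSpace Z] {μ : Measure Z}

theorem compMeasurePreserving_eq_of_comp_eq {A B : Type*} [MeasurableSpace A] [MeasurableSpace B]
    {ν : Measure A} {ν' : Measure B} {α : Z → A} {β : Z → B}
    (hα : MeasurePreserving α μ ν) (hβ : MeasurePreserving β μ ν') {f : A → ℝ} {f' : B → ℝ}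
    (hff' : ∀ z, f (α z) = f' (β z)) {a : Lp ℝ 2 ν} {a' : Lp ℝ 2 ν'} (ha : a =ᵐ[ν] f)
    (ha' : a' =ᵐ[ν'] f') :
    Lp.compMeasurePreservingₗᵢ ℝ α hα a = Lp.compMeasurePreservingₗᵢ ℝ β hβ a' := by
  refine Lp.ext ?_
  refine (Lp.coeFn_compMeasurePreserving a hα).trans (.trans ?_
    (Lp.coeFn_compMeasurePreserving a' hβ).symm)
  filter_upwards [hα.quasiMeasurePreserving.ae_eq_comp ha,
    hβ.quasiMeasurePreserving.ae_eq_comp ha'] with z hz hz'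
  rw [hz, hz']
  exact hff' z

/-- Pull-back along `α` and `β` embeds both spaces in `L²(Z)`. Being isometric on complete spaces,
the embeddings have closed image and commute with closure, and functions matched by `e` have the
same pull-back. -/
theorem l2Spectrum_eq_of_equiv (hR : ∀ f u, R f u → f ∈ D ∧ u ∈ D)
    (hR' : ∀ f u, R' f u → f ∈ D' ∧ u ∈ D') (he : ∀ f u : D, R f u ↔ R' (e f) (e u))
    {α : Z → M} {β : Z → M'} (hα : MeasurePreserving α μ (riemannianVolume g))
    (hβ : MeasurePreserving β μ (riemannianVolume g'))
    (hαβ : ∀ (f : D) z, f.1 (α z) = (e f).1 (β z))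
    (hD : ∀ f : C^∞⟮I, M; ℝ⟯, MemLp f 2 (riemannianVolume g))
    (hD' : ∀ f : C^∞⟮I', M'; ℝ⟯, MemLp f 2 (riemannianVolume g')) :
    l2Spectrum g D R = l2Spectrum g' D' R' := by
  let J := Lp.compMeasurePreservingₗᵢ ℝ (E := ℝ) (p := 2) α hα
  let J' := Lp.compMeasurePreservingₗᵢ ℝ (E := ℝ) (p := 2) β hβ
  have hJ : Topology.IsClosedEmbedding J := J.isometry.isClosedEmbedding
  have hJ' : Topology.IsClosedEmbedding J' := J'.isometry.isClosedEmbedding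
  have hJJ : Topology.IsClosedEmbedding (Prod.map J J) :=
    (J.isometry.prodMap J.isometry).isClosedEmbedding
  have hJJ' : Topology.IsClosedEmbedding (Prod.map J' J') :=
    (J'.isometry.prodMap J'.isometry).isClosedEmbedding
  have hαβ' (f' : D') (z : Z) : (e.symm f').1 (α z) = f'.1 (β z) := by
    rw [hαβ, e.apply_symm_apply]
  have hspace : J '' l2Space g D = J' '' l2Space g' D' := by
    rw [l2Space, l2Space, ← hJ.closure_image_eq, ← hJ'.closure_image_eq]
    congr 1
    ext b
    constructor
    · rintro ⟨a, ⟨f, hf, ha⟩, rfl⟩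
      have ha' := (hD' (e ⟨f, hf⟩).1).coeFn_toLp
      exact ⟨_, ⟨_, (e ⟨f, hf⟩).2, ha'⟩,
        (compMeasurePreserving_eq_of_comp_eq hα hβ (hαβ ⟨f, hf⟩) ha ha').symm⟩
    · rintro ⟨a, ⟨f, hf, ha⟩, rfl⟩
      have ha' := (hD (e.symm ⟨f, hf⟩).1).coeFn_toLp
      exact ⟨_, ⟨_, (e.symm ⟨f, hf⟩).2, ha'⟩,
        compMeasurePreserving_eq_of_comp_eq hα hβ (hαβ' ⟨f, hf⟩) ha' ha⟩
  have hgraph : Prod.map J J '' l2Graph g R = Prod.map J' J' '' l2Graph g' R' := by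
    rw [l2Graph, l2Graph, ← hJJ.closure_image_eq, ← hJJ'.closure_image_eq]
    congr 1
    ext b
    constructor
    · rintro ⟨⟨a₁, a₂⟩, ⟨f, u, hfu, h1, h2⟩, rfl⟩
      obtain ⟨hf, hu⟩ := hR f u hfu
      have h1' := (hD' (e ⟨f, hf⟩).1).coeFn_toLp
      have h2' := (hD' (e ⟨u, hu⟩).1).coeFn_toLp
      exact ⟨⟨_, _⟩, ⟨_, _, (he ⟨f, hf⟩ ⟨u, hu⟩).1 hfu, h1', h2'⟩, Prod.ext
        (compMeasurePreserving_eq_of_comp_eq hα hβ (hαβ ⟨f, hf⟩) h1 h1').symm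
        (compMeasurePreserving_eq_of_comp_eq hα hβ (hαβ ⟨u, hu⟩) h2 h2').symm⟩
    · rintro ⟨⟨a₁, a₂⟩, ⟨f, u, hfu, h1, h2⟩, rfl⟩
      obtain ⟨hf, hu⟩ := hR' f u hfu
      have h1' := (hD (e.symm ⟨f, hf⟩).1).coeFn_toLp
      have h2' := (hD (e.symm ⟨u, hu⟩).1).coeFn_toLp
      refine ⟨⟨_, _⟩, ⟨_, _, (he (e.symm ⟨f, hf⟩) (e.symm ⟨u, hu⟩)).2 ?_, h1', h2'⟩, Prod.ext
        (compMeasurePreserving_eq_of_comp_eq hα hβ (hαβ' ⟨f, hf⟩) h1' h1)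
        (compMeasurePreserving_eq_of_comp_eq hα hβ (hαβ' ⟨u, hu⟩) h2' h2)⟩
      rwa [e.apply_symm_apply, e.apply_symm_apply]
  ext c
  rw [l2Spectrum, l2Spectrum, Set.mem_ofPred_eq, Set.mem_ofPred_eq, not_iff_not,
    ← forall_existsUnique_image_iff (J := J.toLinearMap) J.injective,
    ← forall_existsUnique_image_iff (J := J'.toLinearMap) J'.injective]
  exact Eq.to_iff (congrArg₂ (fun (K : Set (Lp ℝ 2 μ)) (Λ : Set (Lp ℝ 2 μ × Lp ℝ 2 μ)) =>
    ∀ k ∈ K, ∃! a, a ∈ Λ ∧ a.2 - c • a.1 = k) hspace hgraph)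

theorem memLp_of_compactSpace [CompactSpace M] [BorelSpace M] {ν : Measure M} [IsFiniteMeasure ν]
    (f : C^∞⟮I, M; ℝ⟯) : MemLp f 2 ν := by
  obtain ⟨C, hC⟩ := isCompact_univ.exists_bound_of_continuousOn f.contMDiff.continuous.continuousOn
  exact MemLp.of_bound f.contMDiff.continuous.measurable.aestronglyMeasurable C
    (Filter.Eventually.of_forall fun x => hC x trivial)

end Transport

end BasicSpectrum

theorem mainTheorem5
    -- the compact Lie group `G`
    {EG : Type*} [NormedAddCommGroup EG] [NormedSpace ℝ EG] [FiniteDimensional ℝ EG]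
    {G : Type*} [Group G] [TopologicalSpace G] [T2Space G] [CompactSpace G]
    [ChartedSpace EG G] [LieGroup 𝓘(ℝ, EG) ∞ G]
    -- the closed Riemannian manifold `Y` with a smooth isometric action of `G`
    {EY : Type*} [NormedAddCommGroup EY] [NormedSpace ℝ EY] [FiniteDimensional ℝ EY]
    {Y : Type*} [TopologicalSpace Y] [T2Space Y] [CompactSpace Y]
    [ChartedSpace EY Y] [IsManifold 𝓘(ℝ, EY) ∞ Y] [MeasurableSpace Y] [BorelSpace Y]
    (gY : Bundle.ContMDiffRiemannianMetric 𝓘(ℝ, EY) ∞ EY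
      (fun y : Y => TangentSpace 𝓘(ℝ, EY) y))
    [MulAction G Y] [ContinuousSMul G Y] [ContMDiffSMul 𝓘(ℝ, EG) 𝓘(ℝ, EY) ∞ G Y]
    (hG : ∀ a : G, pullbackMetric 𝓘(ℝ, EY) (fun y : Y => a • y) gY.inner = gY.inner)
    -- the closed connected Riemannian manifold `X` of unit volume
    {EX : Type*} [NormedAddCommGroup EX] [NormedSpace ℝ EX] [FiniteDimensional ℝ EX]
    {X : Type*} [TopologicalSpace X] [T2Space X] [CompactSpace X] [ConnectedSpace X]
    [ChartedSpace EX X] [IsManifold 𝓘(ℝ, EX) ∞ X] [MeasurableSpace X] [BorelSpace X]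
    (gX : Bundle.ContMDiffRiemannianMetric 𝓘(ℝ, EX) ∞ EX
      (fun x : X => TangentSpace 𝓘(ℝ, EX) x))
    (hX : riemannianVolume gX.inner Set.univ = 1)
    -- its universal cover
    {Xt : Type*} [TopologicalSpace Xt] [T2Space Xt]
    [ChartedSpace EX Xt] [IsManifold 𝓘(ℝ, EX) ∞ Xt]
    (p : Xt → X) (hp : IsUniversalCover EX p) (x₀ : Xt)
    -- the dense subgroup `G₀` and the surjective homomorphism `φ : π₁(X) → G₀`
    (G₀ : Subgroup G) (hG₀ : Dense (G₀ : Set G))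
    (φ : FundamentalGroup X (p x₀) →* G₀) (hφ : Function.Surjective φ) :
    -- the two operators have the same spectrum,
    l2Spectrum (Suspension.metric hp x₀ φ gX.inner gY.inner) (Suspension.basicFunctions hp x₀ φ)
        (Suspension.BasicLaplacian hp x₀ φ gX.inner gY.inner) =
      l2Spectrum gY.inner (invariantFunctions 𝓘(ℝ, EY) G Y) (InvariantLaplacian G gY.inner) ∧
    -- and every number has the same multiplicity as an eigenvalue of both
    ∀ c : ℝ, Nonempty
      (eigenspace (Suspension.BasicLaplacian hp x₀ φ gX.inner gY.inner) c ≃ₗ[ℝ]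
        eigenspace (InvariantLaplacian G gY.inner) c) := by
  have := ChartedSpace.secondCountable_of_sigmaCompact EY Y
  have hμ : IsProbabilityMeasure (riemannianVolume gX.inner) := ⟨hX⟩
  have hΓ (c : G₀) : ContMDiff 𝓘(ℝ, EY) 𝓘(ℝ, EY) ∞ fun y : Y => c • y :=
    contMDiff_smul_left EG (c : G)
  have hg (c : G₀) : pullbackMetric 𝓘(ℝ, EY) (fun y : Y => c • y) gY.inner = gY.inner := hG c
  obtain ⟨Θ, hΘ, hΘ'⟩ := Suspension.exists_measurePreserving hp x₀ φ hΓ gX gY hg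
  have := Suspension.compactSpace (Y := Y) hp x₀ φ
  -- The metric of `𝒮` is a bare tensor field, so local finiteness is not at hand; finiteness is
  -- read off from `Θ`.
  have : IsFiniteMeasure (riemannianVolume (Suspension.metric hp x₀ φ gX.inner gY.inner)) := by
    rw [← hΘ.map_eq]
    infer_instance
  have hinv := invariantFunctions_eq_of_dense (Y := Y) 𝓘(ℝ, EY) hG₀
  let e := (Suspension.basicEquiv hp x₀ φ hΓ hφ).trans (LinearEquiv.ofEq _ _ hinv)
  have he (f u : Suspension.basicFunctions (EY := EY) (Y := Y) hp x₀ φ) :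
      Suspension.BasicLaplacian hp x₀ φ gX.inner gY.inner f u ↔
        InvariantLaplacian G gY.inner (e f).1 (e u).1 := by
    rw [Suspension.basicLaplacian_iff hp x₀ φ hΓ hφ gX gY hg hΘ hΘ',
      laplaceRel_invariant_iff EG hG]
    exact Eq.to_iff (congrArg (fun D : Submodule ℝ C^∞⟮𝓘(ℝ, EY), Y; ℝ⟯ =>
      LaplaceRel gY.inner D D (e f).1 (e u).1) hinv)
  -- The common space is `X × Y`, with `α = Θ` and `β` the projection to `Y`, which preserves
  -- measure because `X` has volume one.
  refine ⟨l2Spectrum_eq_of_equiv e (fun f u h => ⟨h.1, h.2.1⟩) (fun f u h => ⟨h.1, h.2.1⟩) he hΘ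
    measurePreserving_snd (fun f z => ?_) memLp_of_compactSpace memLp_of_compactSpace,
    nonempty_eigenspace_equiv e (fun f u h => h.1) (fun f u h => h.1) he⟩
  obtain ⟨x, hx⟩ := hΘ' z
  rw [hx]
  exact (Suspension.basicEquiv_apply hp x₀ φ hΓ hφ f (x, z.2)).symm
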